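/- **Setting.** Let $(\Omega,\mathcal F,\mathbb P)$ be a probability space with a group $(\tau_x)_{x\in\mathbb R}$ of measure-preserving transformations ($\tau_0=\mathrm{id}$, $\tau_{x+y}=\tau_x\circ\tau_y$) under which $\mathbb P$ is ergodic (every invariant event has probability $0$ or $1$). Let $V:\mathbb R\times\Omega\to\mathbb R$ be measurable and stationary, $V(x,\omega)=V(0,\tau_x\omega)$, with $V(\cdot,\omega)$ bounded and uniformly continuous for every $\omega$, and $\inf_x V(x,\omega)=0$, $\sup_x V(x,\omega)=1$ for $\mathbb P$-a.e. $\omega$. Let $\beta>0$. Let $G:\mathbb R\to\mathbb R$ be continuous with $G(p)\to+\infty$ as $p\to\pm\infty$, and let $p_m<p_M<0$ be such that $G(0)=0\le G(p_m)=m<G(p_M)=M$, where $G$ is strictly decreasing on $(-\infty,p_m]$ and on $[p_M,0]$, and strictly increasing on $[p_m,p_M]$ and on $[0,+\infty)$. Let $G_1,G_3,G_4$ be the restrictions of $G$ to $(-\infty,p_m]$, $[p_M,0]$, $[0,+\infty)$, and put $\theta_i(\lambda)=\mathbb E[G_i^{-1}(\lambda-\beta V(0,\omega))]$ for $i\in\{1,3,4\}$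 (for $\lambda\ge m+\beta$ if $i=1$, for $\beta\le\lambda\le M$ if $i=3$, for $\lambda\ge\beta$ if $i=4$). Viscosity solutions below are taken in the class of uniformly continuous functions on $[0,+\infty)\times\mathbb R$. A function $\overline H:\mathbb R\to\mathbb R$ is said to have a flat piece at height $h$ if it is equal to $h$ on some interval of positive length. **Theorem.** There is a function $\overline H:\mathbb R\to\mathbb R$ (the effective Hamiltonian) such that, for every $\theta\in\mathbb R$ and $\mathbb P$-a.e. $\omega$, the equation $$\partial_t u+G(\partial_x u)+\beta V(x,\omega)=0\quad\text{on }(0,+\infty)\times\mathbb R,\qquad u(0,x)=\theta x,$$ has a viscosity solution, and every such solution $u_\theta$ satisfies $\lim_{t\to+\infty}-u_\theta(t,0,\omega)/t=\overline H(\theta)$. Whenever the equation $\partial_t u^\epsilon+G(\partial_x u^\epsilon)+\beta V(x/\epsilon,\omega)=0$ homogenizes to $\partial_t\overline u+H'(\partial_x\overline u)=0$ with a continuous coercive $H'$ (that is, for $\mathbb P$-a.e. $\omega$ and every uniformly continuous initial datum, the viscosity solutions $u^\epsilon$ converge locally uniformly on $[0,+\infty)\times\mathbb R$ to $\overline u$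 as $\epsilon\to0$), one has $H'=\overline H$. Moreover: - (a) If $\beta<M=m+\beta$, then $\overline H=M$ on the whole interval $[\theta_1(M),\theta_3(M)]$. - (b) If $\beta<M<m+\beta$, then - (i) $\overline H$ has a flat piece at height $M$ if and only if $\mathbb P(V(x,\omega)=0\text{ for some }x\in\mathbb R)=1$; and - (ii) $\overline H$ has a flat piece at height $m+\beta$ if and only if $\mathbb P(V(x,\omega)=1\text{ for some }x\in\mathbb R)=1$. - (c) If $M\le\beta=m+\beta$, then $\overline H=\beta$ on the whole interval $[\theta_1(\beta),\theta_4(\beta)]$. - (d) If $M\le\beta<m+\beta$, then - (i) $\overline H$ has a flat piece at height $\beta$; and - (ii) $\overline H$ has a flat piece at height $m+\beta$ if and only if $\mathbb P(V(x,\omega)=1\text{ for some }x\in\mathbb R)=1$. -/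

import Mathlib

open Set Filter Topology MeasureTheory

namespace HJ

/-- `τ` is a group of `P`-preserving transformations of `Ω` indexed by `ℝ`, and `P` is ergodic
under it: every (strictly) invariant event has probability `0` or `1`. -/
structure IsErgodicFlow {Ω : Type*} [MeasurableSpace Ω] (P : Measure Ω) (τ : ℝ → Ω → Ω) :
    Prop where
  measurePreserving : ∀ x, MeasurePreserving (τ x) P P
  zero : τ 0 = id
  add : ∀ x y, τ (x + y) = τ x ∘ τ y
  ergodic : ∀ A, MeasurableSet A → (∀ x, τ x ⁻¹' A = A) → P A = 0 ∨ P A = 1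

/-- `V` is a stationary, measurable potential whose realizations are bounded and uniformly
continuous, and almost surely have infimum `0` and supremum `1`. -/
structure IsPotential {Ω : Type*} [MeasurableSpace Ω] (P : Measure Ω) (τ : ℝ → Ω → Ω)
    (V : ℝ → Ω → ℝ) : Prop where
  measurable : Measurable (fun q : ℝ × Ω => V q.1 q.2)
  stationary : ∀ x ω, V x ω = V 0 (τ x ω)
  bounded : ∀ ω, ∃ C, ∀ x, |V x ω| ≤ C
  uniformContinuous : ∀ ω, UniformContinuous (fun x => V x ω)
  normalized : ∀ᵐ ω ∂P, IsGLB (range fun x => V x ω) 0 ∧ IsLUB (range fun x => V x ω) 1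

/-- `G` tends to `+∞` at `±∞`. -/
def Coercive (G : ℝ → ℝ) : Prop :=
  Tendsto G atTop atTop ∧ Tendsto G atBot atTop

/-- `G` is a continuous coercive double-well function, with minimum value `0` at `0`, a local
minimum value `m` at `pm` and a local maximum value `M` at `pM`. -/
structure IsDoubleWell (G : ℝ → ℝ) (m M pm pM : ℝ) : Prop where
  continuous : Continuous G
  coercive : Coercive G
  pm_lt_pM : pm < pM
  pM_neg : pM < 0
  map_zero : G 0 = 0
  m_nonneg : 0 ≤ m
  map_pm : G pm = m
  m_lt_M : m < M
  map_pM : G pM = M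
  anti₁ : StrictAntiOn G (Iic pm)
  mono₂ : StrictMonoOn G (Icc pm pM)
  anti₃ : StrictAntiOn G (Icc pM 0)
  mono₄ : StrictMonoOn G (Ici 0)

/-- Viscosity subsolution of `∂ₜu + H(∂ₓu, x) = 0` on `(0,∞) × ℝ`, for a continuous function `u`
of the pair `(t, x)`, tested with `C¹` functions. -/
def IsSubsolution (H : ℝ → ℝ → ℝ) (u : ℝ × ℝ → ℝ) : Prop :=
  ∀ t x : ℝ, 0 < t → ∀ φ : ℝ × ℝ → ℝ, ContDiff ℝ 1 φ →
    IsLocalMax (fun q => u q - φ q) (t, x) →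
    fderiv ℝ φ (t, x) (1, 0) + H (fderiv ℝ φ (t, x) (0, 1)) x ≤ 0

/-- Viscosity supersolution of `∂ₜu + H(∂ₓu, x) = 0` on `(0,∞) × ℝ`. -/
def IsSupersolution (H : ℝ → ℝ → ℝ) (u : ℝ × ℝ → ℝ) : Prop :=
  ∀ t x : ℝ, 0 < t → ∀ φ : ℝ × ℝ → ℝ, ContDiff ℝ 1 φ →
    IsLocalMin (fun q => u q - φ q) (t, x) →
    0 ≤ fderiv ℝ φ (t, x) (1, 0) + H (fderiv ℝ φ (t, x) (0, 1)) x

/-- `u` is a viscosity solution of `∂ₜu + H(∂ₓu, x) = 0` on `(0,∞) × ℝ` with `u(0, ·) = g`, in the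
class of uniformly continuous functions on `[0,∞) × ℝ` (the values at `t < 0` play no role). -/
structure IsSolution (H : ℝ → ℝ → ℝ) (g : ℝ → ℝ) (u : ℝ × ℝ → ℝ) : Prop where
  uniformContinuousOn : UniformContinuousOn u (Ici 0 ×ˢ univ)
  initial : ∀ x, u (0, x) = g x
  sub : IsSubsolution H u
  super : IsSupersolution H u

/-- The equation `∂ₜuᵉ + G(∂ₓuᵉ) + β V(x/ε, ω) = 0` homogenizes, as `ε → 0`, to
`∂ₜu + Hbar(∂ₓu) = 0` with `Hbar` continuous and coercive: almost surely, for all uniformly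
continuous initial data, the solutions converge locally uniformly on `[0,∞) × ℝ`. -/
def HomogenizesTo {Ω : Type*} [MeasurableSpace Ω] (P : Measure Ω) (G : ℝ → ℝ) (β : ℝ)
    (V : ℝ → Ω → ℝ) (Hbar : ℝ → ℝ) : Prop :=
  Continuous Hbar ∧ Coercive Hbar ∧
    ∀ᵐ ω ∂P, ∀ g : ℝ → ℝ, UniformContinuous g →
      ∀ u : ℝ → ℝ × ℝ → ℝ,
        (∀ ε, 0 < ε → IsSolution (fun p x => G p + β * V (x / ε) ω) g (u ε)) →
        ∀ ubar : ℝ × ℝ → ℝ, IsSolution (fun p _ => Hbar p) g ubar →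
          TendstoLocallyUniformlyOn u ubar (𝓝[>] 0) (Ici 0 ×ˢ univ)

/-- `Hbar θ` is, for every `θ`, the almost sure limit as `t → ∞` of `-u_θ(t, 0, ω) / t`, where
`u_θ(·, ·, ω)` is the viscosity solution of `∂ₜu + G(∂ₓu) + β V(x, ω) = 0` with initial condition
`x ↦ θ x`. The existence of the solution is part of the condition. -/
def IsEffectiveHamiltonian {Ω : Type*} [MeasurableSpace Ω] (P : Measure Ω) (G : ℝ → ℝ) (β : ℝ)
    (V : ℝ → Ω → ℝ) (Hbar : ℝ → ℝ) : Prop :=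
  ∀ θ : ℝ, ∀ᵐ ω ∂P,
    (∃ u, IsSolution (fun p x => G p + β * V x ω) (fun x => θ * x) u) ∧
    ∀ u, IsSolution (fun p x => G p + β * V x ω) (fun x => θ * x) u →
      Tendsto (fun t : ℝ => -u (t, 0) / t) atTop (𝓝 (Hbar θ))

/-- `E[(G|_s)⁻¹(lam - β V(0, ω))]`, where `G` is injective on `s`. With `s = (-∞, pm]`, `[pM, 0]`,
`[0, ∞)` this is `θ₁(lam)`, `θ₃(lam)`, `θ₄(lam)`. -/
noncomputable def branchMean {Ω : Type*} [MeasurableSpace Ω] (P : Measure Ω) (G : ℝ → ℝ) (β : ℝ)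
    (V : ℝ → Ω → ℝ) (s : Set ℝ) (lam : ℝ) : ℝ :=
  ∫ ω, Function.invFunOn G s (lam - β * V 0 ω) ∂P

/-- The graph of `Hbar` has a flat piece at height `h`: `Hbar` is equal to `h` on some interval of
positive length. -/
def HasFlatPiece (Hbar : ℝ → ℝ) (h : ℝ) : Prop :=
  ∃ a b : ℝ, a < b ∧ ∀ θ ∈ Ioo a b, Hbar θ = h

end HJ

namespace HJ

/-! ### Derivatives along the coordinate axes -/

theorem hasDerivAt_time {φ : ℝ × ℝ → ℝ} {t x : ℝ} (h : DifferentiableAt ℝ φ (t, x)) :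
    HasDerivAt (fun s => φ (s, x)) (fderiv ℝ φ (t, x) (1, 0)) t := by
  have h1 : HasDerivAt (fun s : ℝ => (s, x)) ((1 : ℝ), (0 : ℝ)) t :=
    (hasDerivAt_id t).prodMk (hasDerivAt_const t x)
  exact HasFDerivAt.comp_hasDerivAt t (f := fun s : ℝ => (s, x)) h.hasFDerivAt h1

theorem hasDerivAt_space {φ : ℝ × ℝ → ℝ} {t x : ℝ} (h : DifferentiableAt ℝ φ (t, x)) :
    HasDerivAt (fun y => φ (t, y)) (fderiv ℝ φ (t, x) (0, 1)) x := by
  have h1 : HasDerivAt (fun y : ℝ => (t, y)) ((0 : ℝ), (1 : ℝ)) x :=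
    (hasDerivAt_const x t).prodMk (hasDerivAt_id x)
  exact HasFDerivAt.comp_hasDerivAt x (f := fun y : ℝ => (t, y)) h.hasFDerivAt h1

theorem hasDerivAt_quadratic {f : ℝ → ℝ} {d x : ℝ} (A B C : ℝ)
    (hf : ∀ y, f y = A + B * y + C * y ^ 2) (hd : d = B + 2 * C * x) : HasDerivAt f d x := by
  obtain rfl : f = fun y => A + B * y + C * y ^ 2 := funext hf
  have h1 := ((hasDerivAt_id' x).const_mul B).const_add A
  have h2 := (hasDerivAt_pow 2 x).const_mul C
  refine (h1.add h2).congr_deriv ?_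
  rw [hd]
  norm_num
  ring

/-! ### Piecewise smooth barriers -/

/-- `p` has one-sided limits everywhere, and its primitive is a viscosity subsolution of
`g(w') + f(x) = lam`. -/
def IsSubSlope (g f : ℝ → ℝ) (lam : ℝ) (p : ℝ → ℝ) : Prop :=
  ∀ x, ∃ a b, Tendsto p (𝓝[<] x) (𝓝 a) ∧ Tendsto p (𝓝[>] x) (𝓝 b) ∧
    ∀ q, b ≤ q → q ≤ a → g q + f x ≤ lam

/-- `p` has one-sided limits everywhere, and its primitive is a viscosity supersolution of
`g(w') + f(x) = lam`. -/
def IsSuperSlope (g f : ℝ → ℝ) (lam : ℝ) (p : ℝ → ℝ) : Prop :=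
  ∀ x, ∃ a b, Tendsto p (𝓝[<] x) (𝓝 a) ∧ Tendsto p (𝓝[>] x) (𝓝 b) ∧
    ∀ q, a ≤ q → q ≤ b → lam ≤ g q + f x

theorem IsSuperSlope.neg {g f p : ℝ → ℝ} {lam : ℝ} (h : IsSuperSlope g f lam p) :
    IsSubSlope (fun q => -g (-q)) (fun x => -f x) (-lam) (fun x => -p x) := by
  intro x
  obtain ⟨a, b, ha, hb, hq⟩ := h x
  refine ⟨-a, -b, ha.neg, hb.neg, fun q h1 h2 => ?_⟩
  have := hq (-q) (by linarith) (by linarith)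
  linarith

/-- Bounded measurable functions. -/
structure IsBddMeas (p : ℝ → ℝ) : Prop where
  meas : Measurable p
  bdd : ∃ K, ∀ x, |p x| ≤ K

theorem IsBddMeas.intervalIntegrable {p : ℝ → ℝ} (h : IsBddMeas p) (a b : ℝ) :
    IntervalIntegrable p volume a b := by
  obtain ⟨K, hK⟩ := h.bdd
  refine (intervalIntegrable_const (c := K)).mono_fun h.meas.aestronglyMeasurable ?_
  filter_upwards with x
  simpa using (hK x).trans (le_abs_self K)

theorem IsBddMeas.neg {p : ℝ → ℝ} (h : IsBddMeas p) : IsBddMeas (fun x => -p x) :=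
  ⟨h.meas.neg, h.bdd.imp fun K hK x => by simpa using hK x⟩

theorem IsBddMeas.hasDerivWithinAt_right {p : ℝ → ℝ} (h : IsBddMeas p) {x b : ℝ}
    (hb : Tendsto p (𝓝[>] x) (𝓝 b)) :
    HasDerivWithinAt (fun y => ∫ s in (0 : ℝ)..y, p s) b (Ici x) x :=
  intervalIntegral.integral_hasDerivWithinAt_of_tendsto_ae_right (t := Ioi x)
    (h.intervalIntegrable 0 x) (h.meas.stronglyMeasurable.stronglyMeasurableAtFilter)
    (hb.mono_left inf_le_left)

theorem IsBddMeas.hasDerivWithinAt_left {p : ℝ → ℝ} (h : IsBddMeas p) {x a : ℝ}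
    (ha : Tendsto p (𝓝[<] x) (𝓝 a)) :
    HasDerivWithinAt (fun y => ∫ s in (0 : ℝ)..y, p s) a (Iic x) x := by
  refine intervalIntegral.integral_hasDerivWithinAt_of_tendsto_ae_right (t := Iic x)
    (h.intervalIntegrable 0 x) (h.meas.stronglyMeasurable.stronglyMeasurableAtFilter)
    (ha.mono_left ?_)
  have h1 : {x}ᶜ ∈ ae (volume : Measure ℝ) := by simp [mem_ae_iff]
  rw [← Iio_union_right, nhdsWithin_union, inf_sup_right]
  refine sup_le inf_le_left ?_
  have : 𝓝[{x}] x ⊓ ae (volume : Measure ℝ) = ⊥ := by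
    rw [nhdsWithin_singleton, inf_eq_bot_iff]
    exact ⟨{x}, by simp, {x}ᶜ, h1, inter_compl_self _⟩
  rw [this]; exact bot_le

theorem slope_mem_of_isLocalMax {w φ : ℝ → ℝ} {x a b d : ℝ}
    (hl : HasDerivWithinAt w a (Iic x) x) (hr : HasDerivWithinAt w b (Ici x) x)
    (hφ : HasDerivAt φ d x) (hmax : IsLocalMax (fun y => w y - φ y) x) : b ≤ d ∧ d ≤ a := by
  constructor
  · have h := (hr.sub hφ.hasDerivWithinAt)
    rw [hasDerivWithinAt_iff_tendsto_slope, Ici_sdiff_left] at h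
    have : b - d ≤ 0 := by
      refine le_of_tendsto h ?_
      filter_upwards [self_mem_nhdsWithin, hmax.filter_mono nhdsWithin_le_nhds] with y hy hy2
      rw [slope_def_field]
      exact div_nonpos_of_nonpos_of_nonneg (by simpa using hy2) (sub_nonneg.2 (le_of_lt hy))
    linarith
  · have h := (hl.sub hφ.hasDerivWithinAt)
    rw [hasDerivWithinAt_iff_tendsto_slope, Iic_sdiff_right] at h
    have : 0 ≤ a - d := by
      refine ge_of_tendsto h ?_
      filter_upwards [self_mem_nhdsWithin, hmax.filter_mono nhdsWithin_le_nhds] with y hy hy2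
      rw [slope_def_field]
      exact div_nonneg_of_nonpos (by simpa using hy2) (sub_nonpos.2 (le_of_lt hy))
    linarith

/-! ### Comparison with barriers -/

theorem linear_growth_of_uniformContinuousOn {u : ℝ × ℝ → ℝ}
    (hu : UniformContinuousOn u (Ici 0 ×ˢ univ)) :
    ∃ A, 0 ≤ A ∧ ∀ t x, 0 ≤ t → |u (t, x) - u (0, x)| ≤ A * t + 1 := by
  rw [Metric.uniformContinuousOn_iff] at hu
  obtain ⟨δ, hδ, h⟩ := hu 1 one_pos
  have key : ∀ x, ∀ s, 0 ≤ s → s < δ → ∀ n : ℕ, |u (n * s, x) - u (0, x)| ≤ n := by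
    intro x s hs hsδ n
    induction n with
    | zero => simp
    | succ k ih =>
      have h1 : dist (u ((k + 1 : ℕ) * s, x)) (u (k * s, x)) < 1 := by
        refine h _ ⟨by simp; positivity, trivial⟩ _ ⟨by simp; positivity, trivial⟩ ?_
        rw [Prod.dist_eq]
        simp only [dist_self, Real.dist_eq]
        have : ((k + 1 : ℕ) : ℝ) * s - k * s = s := by push_cast; ring
        rw [this, abs_of_nonneg hs]
        exact max_lt hsδ hδ
      rw [Real.dist_eq] at h1
      have := abs_sub_le (u ((k + 1 : ℕ) * s, x)) (u (k * s, x)) (u (0, x))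
      push_cast at *
      linarith
  refine ⟨1 / δ, by positivity, fun t x ht => ?_⟩
  set n : ℕ := ⌊t / δ⌋₊ + 1 with hn
  have hn0 : (0 : ℝ) < n := by positivity
  have hlt : t / δ < n := by rw [hn]; push_cast; exact Nat.lt_floor_add_one _
  have hle : (n : ℝ) ≤ t / δ + 1 := by
    rw [hn]; push_cast; linarith [Nat.floor_le (show 0 ≤ t / δ by positivity)]
  have h1 := key x (t / n) (by positivity)
    (by rw [div_lt_iff₀ hn0]; rw [div_lt_iff₀ hδ] at hlt; linarith) n
  rw [mul_div_cancel₀ _ hn0.ne'] at h1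
  calc _ ≤ (n : ℝ) := h1
    _ ≤ _ := by rw [one_div_mul_eq_div]; exact hle

/-- A supersolution with linear initial datum lies above a strict viscosity subsolution of the
form `W(x) - C - ν t`. -/
theorem IsSupersolution.lower_bound {g f : ℝ → ℝ} (hf : UniformContinuous f)
    {u : ℝ × ℝ → ℝ} {θ : ℝ} (hu : UniformContinuousOn u (Ici 0 ×ˢ univ))
    (hinit : ∀ x, u (0, x) = θ * x) (hsup : IsSupersolution (fun p x => g p + f x) u)
    {W : ℝ → ℝ} (hW : Continuous W) {C δ μ ν : ℝ} (hδ : 0 < δ)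
    (hgrow : ∀ x, W x ≤ θ * x + C - δ * |x|)
    (hsub : ∀ x (φ : ℝ → ℝ) (d : ℝ), HasDerivAt φ d x → IsLocalMax (fun y => W y - φ y) x →
      g d + f x ≤ μ) (hμν : μ < ν) (t x : ℝ) (ht : 0 ≤ t) :
    W x - C - ν * t ≤ u (t, x) := by
  by_contra! hcon
  obtain ⟨A, hA0, hA⟩ := linear_growth_of_uniformContinuousOn hu
  obtain ⟨D, hD⟩ : ∃ D, D = W x - C - ν * t - u (t, x) := ⟨_, rfl⟩
  have hDpos : 0 < D := by linarith
  obtain ⟨η, hη⟩ : ∃ η, η = D / (2 * (t ^ 2 + 1)) := ⟨_, rfl⟩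
  have hηpos : 0 < η := by rw [hη]; positivity
  have hηt : η * t ^ 2 < D := by
    rw [hη, div_mul_eq_mul_div, div_lt_iff₀ (by positivity)]
    nlinarith [sq_nonneg t]
  obtain ⟨E, hE⟩ : ∃ E, ∀ s : ℝ, -ν * s - η * s ^ 2 + A * s + 1 ≤ E - s := by
    refine ⟨1 + (A + 1 - ν) ^ 2 / (4 * η), fun s => ?_⟩
    have : (A + 1 - ν) * s - η * s ^ 2 ≤ (A + 1 - ν) ^ 2 / (4 * η) := by
      rw [le_div_iff₀ (by positivity)]
      nlinarith [sq_nonneg (A + 1 - ν - 2 * η * s)]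
    linarith
  have hE2 : 0 ≤ E + θ ^ 2 / 2 := by
    have := hE 0
    nlinarith [sq_nonneg θ]
  obtain ⟨ρ, hρ, hρf⟩ := Metric.uniformContinuous_iff.1 hf (ν - μ) (by linarith)
  obtain ⟨E2, hE2def⟩ : ∃ E2, E2 = E + θ ^ 2 / 2 := ⟨_, rfl⟩
  rw [← hE2def] at hE2
  obtain ⟨D', hD'⟩ : ∃ D', D' = D - η * t ^ 2 := ⟨_, rfl⟩
  have hD'pos : 0 < D' := by linarith
  obtain ⟨N, hN1, hN2, hN3⟩ : ∃ N : ℝ, 1 ≤ N ∧ θ ^ 2 < 4 * N * D' ∧ 2 * E2 < N * ρ ^ 2 := by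
    refine ⟨1 + θ ^ 2 / D' + 2 * E2 / ρ ^ 2, ?_, ?_, ?_⟩
    · have : 0 ≤ θ ^ 2 / D' := by positivity
      have : 0 ≤ 2 * E2 / ρ ^ 2 := by positivity
      linarith
    · have h1 : θ ^ 2 / D' * D' = θ ^ 2 := by field_simp
      have h2 : 0 ≤ 2 * E2 / ρ ^ 2 * D' := by positivity
      nlinarith [sq_nonneg θ]
    · have h1 : 2 * E2 / ρ ^ 2 * ρ ^ 2 = 2 * E2 := by field_simp
      have h2 : 0 ≤ θ ^ 2 / D' * ρ ^ 2 := by positivity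
      nlinarith [sq_pos_of_pos hρ]
  obtain ⟨Φ, hΦ'⟩ : ∃ Φ : ℝ × ℝ × ℝ → ℝ, Φ = fun q =>
    W q.2.1 - C - ν * q.1 - η * q.1 ^ 2 - u (q.1, q.2.2) - N * (q.2.1 - q.2.2) ^ 2 := ⟨_, rfl⟩
  have hΦ : ∀ s y z, Φ (s, y, z) =
    W y - C - ν * s - η * s ^ 2 - u (s, z) - N * (y - z) ^ 2 := fun s y z => by rw [hΦ']
  have hΦ0 : Φ (t, x, x) = D' := by rw [hΦ, hD', hD]; ring
  have hbound : ∀ s y z, 0 ≤ s → 0 < Φ (s, y, z) →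
      s + δ * |y| + (N - 1 / 2) * (y - z) ^ 2 ≤ E2 := by
    intro s y z hs hpos
    have h1 := (abs_le.1 (hA s z hs)).1
    rw [hinit] at h1
    have h2 := hgrow y
    have h3 := hE s
    simp only [hΦ] at hpos
    have h4 : θ * (y - z) ≤ θ ^ 2 / 2 + (y - z) ^ 2 / 2 := by nlinarith [sq_nonneg (θ - (y - z))]
    rw [hE2def]
    linarith
  obtain ⟨R, hR⟩ : ∃ R, R = E2 / δ + E2 + 2 := ⟨_, rfl⟩
  set B : Set (ℝ × ℝ × ℝ) := Icc 0 E2 ×ˢ (Icc (-R) R ×ˢ Icc (-R) R) with hB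
  have hmemB : ∀ s y z, 0 ≤ s → 0 < Φ (s, y, z) → (s, y, z) ∈ B := by
    intro s y z hs hpos
    have h1 := hbound s y z hs hpos
    have hsq : (y - z) ^ 2 / 2 ≤ (N - 1 / 2) * (y - z) ^ 2 := by nlinarith [sq_nonneg (y - z)]
    have h0 : 0 ≤ δ * |y| := by positivity
    have hy : |y| ≤ E2 / δ := by
      rw [le_div_iff₀ hδ]; linarith [sq_nonneg (y - z)]
    have hw : (y - z) ^ 2 / 2 ≤ E2 := by linarith
    have hz : |y - z| ≤ E2 + 1 :=
      abs_le.2 ⟨by linarith [sq_nonneg (y - z + 1)], by linarith [sq_nonneg (y - z - 1)]⟩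
    have hy' := abs_le.1 hy
    have hz' := abs_le.1 hz
    have := sq_nonneg (y - z)
    refine ⟨⟨hs, ?_⟩, ⟨?_, ?_⟩, ?_, ?_⟩ <;> simp only <;> linarith
  have hcont : ContinuousOn Φ B := by
    have h1 : ContinuousOn (fun q : ℝ × ℝ × ℝ => u (q.1, q.2.2)) B := by
      refine hu.continuousOn.comp (by fun_prop) ?_
      intro q hq
      exact ⟨hq.1.1, trivial⟩
    have h2 : Continuous fun q : ℝ × ℝ × ℝ => W q.2.1 - C - ν * q.1 - η * q.1 ^ 2 :=
      (((hW.comp (continuous_fst.comp continuous_snd)).sub continuous_const).sub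
        (by fun_prop)).sub (by fun_prop)
    rw [hΦ']
    exact (h2.continuousOn.sub h1).sub (by fun_prop)
  have hBne : (t, x, x) ∈ B := hmemB t x x ht (by rw [hΦ0]; exact hD'pos)
  obtain ⟨⟨s, y, z⟩, hmem, hmax⟩ := (isCompact_Icc.prod (isCompact_Icc.prod isCompact_Icc)
    : IsCompact B).exists_isMaxOn ⟨_, hBne⟩ hcont
  have hge : D' ≤ Φ (s, y, z) := by rw [← hΦ0]; exact hmax hBne
  have hs0 : 0 ≤ s := hmem.1.1
  have hglob : ∀ s' y' z', 0 ≤ s' → Φ (s', y', z') ≤ Φ (s, y, z) := by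
    intro s' y' z' hs'
    by_cases hp : 0 < Φ (s', y', z')
    · exact hmax (hmemB _ _ _ hs' hp)
    · linarith
  have hspos : 0 < s := by
    rcases hs0.lt_or_eq with h | h
    · exact h
    · exfalso
      have h2 := hgrow y
      have h0 : 0 ≤ δ * |y| := by positivity
      rw [← h] at hge
      simp only [hΦ, hinit] at hge
      have : D' ≤ θ * (y - z) - N * (y - z) ^ 2 := by linarith
      nlinarith [sq_nonneg (θ - 2 * N * (y - z))]
  have hyz : |y - z| < ρ := by
    have h1 := hbound s y z hs0 (by linarith)
    have h0 : 0 ≤ δ * |y| := by positivity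
    have h2 : N * (y - z) ^ 2 ≤ 2 * E2 := by
      have := mul_nonneg (sub_nonneg.2 hN1) (sq_nonneg (y - z))
      linarith
    refine abs_lt_of_sq_lt_sq ?_ hρ.le
    exact lt_of_mul_lt_mul_left (h2.trans_lt hN3) (by linarith)
  have hsubt := hsub y (fun y' => N * (y' - z) ^ 2) (2 * N * (y - z)) (by
      exact hasDerivAt_quadratic (N * z ^ 2) (-2 * N * z) N (fun y' => by ring) (by ring)) (by
      refine Eventually.of_forall fun y' => ?_
      have := hglob s y' z hs0
      simp only [hΦ] at this
      simp only
      linarith)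
  set φ : ℝ × ℝ → ℝ := fun q => -ν * q.1 - η * q.1 ^ 2 - N * (y - q.2) ^ 2 with hφ
  have hφc : ContDiff ℝ 1 φ := by simp only [hφ]; fun_prop
  have hsupt := hsup s z hspos φ hφc (by
      have : ∀ᶠ q : ℝ × ℝ in 𝓝 (s, z), 0 < q.1 :=
        continuous_fst.continuousAt.eventually (lt_mem_nhds hspos)
      filter_upwards [this] with q hq
      have := hglob q.1 y q.2 hq.le
      simp only [hΦ] at this
      simp only [hφ]
      linarith)
  have hd := hφc.differentiable one_ne_zero (s, z)
  have e1 : fderiv ℝ φ (s, z) (1, 0) = -ν - 2 * η * s := by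
    refine (hasDerivAt_time hd).unique ?_
    exact hasDerivAt_quadratic (-(N * (y - z) ^ 2)) (-ν) (-η) (fun s' => by simp only [hφ]; ring)
      (by ring)
  have e2 : fderiv ℝ φ (s, z) (0, 1) = 2 * N * (y - z) := by
    refine (hasDerivAt_space hd).unique ?_
    exact hasDerivAt_quadratic (-ν * s - η * s ^ 2 - N * y ^ 2) (2 * N * y) (-N)
      (fun z' => by simp only [hφ]; ring) (by ring)
  rw [e1, e2] at hsupt
  have hff := hρf (a := z) (b := y) (by rw [Real.dist_eq, abs_sub_comm]; exact hyz)
  rw [Real.dist_eq] at hff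
  have := (abs_lt.1 hff).2
  have := mul_nonneg hηpos.le hspos.le
  linarith

/-- There is a viscosity subsolution of `g(w') + f(x) = lam` that lies below a function of slope
`θ` at both ends. -/
def SubAt (g f : ℝ → ℝ) (θ lam : ℝ) : Prop :=
  ∃ p, IsBddMeas p ∧ IsSubSlope g f lam p ∧ ∃ a b, θ ≤ a ∧ b ≤ θ ∧
    Tendsto (fun x => (∫ s in (0 : ℝ)..x, p s) / x) atBot (𝓝 a) ∧
    Tendsto (fun x => (∫ s in (0 : ℝ)..x, p s) / x) atTop (𝓝 b)

/-- There is a viscosity supersolution of `g(w') + f(x) = lam` that lies above a function of slope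
`θ` at both ends. -/
def SuperAt (g f : ℝ → ℝ) (θ lam : ℝ) : Prop :=
  ∃ p, IsBddMeas p ∧ IsSuperSlope g f lam p ∧ ∃ a b, a ≤ θ ∧ θ ≤ b ∧
    Tendsto (fun x => (∫ s in (0 : ℝ)..x, p s) / x) atBot (𝓝 a) ∧
    Tendsto (fun x => (∫ s in (0 : ℝ)..x, p s) / x) atTop (𝓝 b)

theorem SuperAt.neg {g f : ℝ → ℝ} {θ lam : ℝ} (h : SuperAt g f θ lam) :
    SubAt (fun q => -g (-q)) (fun x => -f x) (-θ) (-lam) := by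
  obtain ⟨p, hp, hs, a, b, ha, hb, hta, htb⟩ := h
  refine ⟨_, hp.neg, hs.neg, -a, -b, by linarith, by linarith, ?_, ?_⟩
  · simpa only [intervalIntegral.integral_neg, neg_div] using hta.neg
  · simpa only [intervalIntegral.integral_neg, neg_div] using htb.neg

theorem IsBddMeas.integral_le_of_means {p : ℝ → ℝ} (hp : IsBddMeas p) {θ a b : ℝ}
    (ha : θ ≤ a) (hb : b ≤ θ)
    (hta : Tendsto (fun x => (∫ s in (0 : ℝ)..x, p s) / x) atBot (𝓝 a))
    (htb : Tendsto (fun x => (∫ s in (0 : ℝ)..x, p s) / x) atTop (𝓝 b)) {δ : ℝ} (hδ : 0 < δ) :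
    ∃ C, ∀ x, ∫ s in (0 : ℝ)..x, p s ≤ θ * x + C + δ * |x| := by
  obtain ⟨K, hK⟩ := hp.bdd
  have h1 := (htb.eventually (gt_mem_nhds (show b < b + δ by linarith))).and
    (eventually_gt_atTop 0)
  have h2 := (hta.eventually (lt_mem_nhds (show a - δ < a by linarith))).and
    (eventually_lt_atBot 0)
  obtain ⟨X, hX⟩ := eventually_atTop.1 h1
  obtain ⟨Y, hY⟩ := eventually_atBot.1 h2
  have hK0 : 0 ≤ K := (abs_nonneg _).trans (hK 0)
  refine ⟨(K + |θ|) * (|X| + |Y|), fun x => ?_⟩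
  have hC : 0 ≤ (K + |θ|) * (|X| + |Y|) := by positivity
  rcases le_total X x with hx | hx
  · obtain ⟨h, h0⟩ := hX x hx
    rw [div_lt_iff₀ h0] at h
    rw [abs_of_pos h0]
    nlinarith
  rcases le_total x Y with hy | hy
  · obtain ⟨h, h0⟩ := hY x hy
    rw [lt_div_iff_of_neg h0] at h
    rw [abs_of_neg h0]
    nlinarith
  have hI : |∫ s in (0 : ℝ)..x, p s| ≤ K * |x| := by
    have := intervalIntegral.norm_integral_le_of_norm_le_const (a := 0) (b := x) (f := p) (C := K)
      (fun s _ => hK s)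
    simpa using this
  have hx' : |x| ≤ |X| + |Y| := by
    rw [abs_le]
    constructor
    · linarith [neg_abs_le Y, abs_nonneg X]
    · linarith [le_abs_self X, abs_nonneg Y]
  have h3 := (le_abs_self _).trans hI
  have h4 := neg_abs_le (θ * x)
  rw [abs_mul] at h4
  have h5 := mul_le_mul_of_nonneg_left hx' (show 0 ≤ K + |θ| by positivity)
  have h6 : 0 ≤ δ * |x| := by positivity
  linarith

theorem SubAt.eventually_le {g f : ℝ → ℝ} {θ lam : ℝ} (h : SubAt g f θ lam) (hg : Continuous g)
    (hf : UniformContinuous f) {u : ℝ × ℝ → ℝ} (hu : UniformContinuousOn u (Ici 0 ×ˢ univ))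
    (hinit : ∀ x, u (0, x) = θ * x) (hsup : IsSupersolution (fun p x => g p + f x) u)
    {ε : ℝ} (hε : 0 < ε) : ∀ᶠ t in atTop, -u (t, 0) / t ≤ lam + ε := by
  obtain ⟨p, hp, hs, a, b, ha, hb, hta, htb⟩ := h
  obtain ⟨K, hK⟩ := hp.bdd
  have huc := (isCompact_Icc (a := -K - 1) (b := K + 1)).uniformContinuousOn_of_continuous
    hg.continuousOn
  obtain ⟨ρ, hρ, hgρ⟩ := Metric.uniformContinuousOn_iff.1 huc (ε / 4) (by positivity)
  obtain ⟨δ, hδ, hδ1, hδρ⟩ : ∃ δ : ℝ, 0 < δ ∧ δ ≤ 1 ∧ δ < ρ :=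
    ⟨min 1 (ρ / 2), by positivity, min_le_left _ _, (min_le_right _ _).trans_lt (by linarith)⟩
  obtain ⟨C, hC⟩ := hp.integral_le_of_means ha hb hta htb (half_pos hδ)
  have hsqrt : ∀ x : ℝ, |x| ≤ √(1 + x ^ 2) := fun x => by
    rw [← Real.sqrt_sq_eq_abs]; exact Real.sqrt_le_sqrt (by linarith)
  have hsqrtd : ∀ x : ℝ, HasDerivAt (fun y => √(1 + y ^ 2)) (x / √(1 + x ^ 2)) x := fun x => by
    have h1 : HasDerivAt (fun y : ℝ => 1 + y ^ 2) (2 * x) x :=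
      hasDerivAt_quadratic 1 0 1 (fun y => by ring) (by ring)
    refine (h1.sqrt (by positivity)).congr_deriv ?_
    field_simp
  obtain ⟨W, hWdef⟩ : ∃ W : ℝ → ℝ, W = fun x => (∫ s in (0 : ℝ)..x, p s) - δ * √(1 + x ^ 2) :=
    ⟨_, rfl⟩
  have hW : Continuous W := by
    rw [hWdef]
    exact (intervalIntegral.continuous_primitive (fun _ _ => hp.intervalIntegrable _ _) 0).sub
      (by fun_prop)
  have key := hsup.lower_bound hf hu hinit hW (C := C) (half_pos hδ) (μ := lam + ε / 4)
    (ν := lam + ε / 2) (fun x => by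
      have := hC x
      have := mul_le_mul_of_nonneg_left (hsqrt x) hδ.le
      rw [hWdef]; simp only; linarith) (fun x φ d hd hmax => by
      obtain ⟨a', b', ha', hb', hq⟩ := hs x
      have hmax' : IsLocalMax (fun y => (∫ s in (0 : ℝ)..y, p s) - (φ y + δ * √(1 + y ^ 2))) x := by
        convert hmax using 2
        rw [hWdef]; ring
      obtain ⟨h1, h2⟩ := slope_mem_of_isLocalMax (hp.hasDerivWithinAt_left ha')
        (hp.hasDerivWithinAt_right hb') (hd.add ((hsqrtd x).const_mul δ)) hmax'
      have hs1 : |x / √(1 + x ^ 2)| ≤ 1 := by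
        rw [abs_div, abs_of_nonneg (Real.sqrt_nonneg _)]
        exact div_le_one_of_le₀ (hsqrt x) (Real.sqrt_nonneg _)
      obtain ⟨hs2, hs3⟩ := abs_le.1 hs1
      have haK : a' ≤ K := le_of_tendsto ha' (Eventually.of_forall fun y => (abs_le.1 (hK y)).2)
      have hbK : -K ≤ b' := ge_of_tendsto hb' (Eventually.of_forall fun y => (abs_le.1 (hK y)).1)
      set s := x / √(1 + x ^ 2)
      have h3 := hq _ h1 h2
      have h4 : |δ * s| < ρ := by
        rw [abs_mul, abs_of_pos hδ]
        nlinarith [abs_nonneg s]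
      have h5 : |δ * s| ≤ 1 := by
        rw [abs_mul, abs_of_pos hδ]
        nlinarith [abs_nonneg s]
      have h6 := abs_le.1 h5
      have h7 := hgρ d ⟨by linarith, by linarith⟩ (d + δ * s) ⟨by linarith, by linarith⟩ (by
        rw [Real.dist_eq, sub_add_cancel_left, abs_neg]; exact h4)
      rw [Real.dist_eq] at h7
      linarith [(abs_lt.1 h7).2]) (by linarith)
  have hlim : Tendsto (fun t : ℝ => (δ + C) / t) atTop (𝓝 0) :=
    tendsto_const_nhds.div_atTop tendsto_id
  filter_upwards [eventually_gt_atTop 0, hlim.eventually (gt_mem_nhds (half_pos hε))] with t ht h2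
  have h1 := key t 0 ht.le
  rw [hWdef] at h1
  simp only [intervalIntegral.integral_same] at h1
  norm_num at h1
  rw [div_lt_iff₀ ht] at h2
  rw [div_le_iff₀ ht]
  linarith

theorem IsSubsolution.neg {g f : ℝ → ℝ} {u : ℝ × ℝ → ℝ}
    (h : IsSubsolution (fun p x => g p + f x) u) :
    IsSupersolution (fun p x => -g (-p) + -f x) (fun q => -u q) := by
  intro t x ht φ hφ hmin
  have := h t x ht (fun q => -φ q) hφ.neg (by
    filter_upwards [hmin] with q hq
    linarith)
  have e : fderiv ℝ (fun q => -φ q) (t, x) = -fderiv ℝ φ (t, x) := fderiv_fun_neg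
  rw [e] at this
  simp only [neg_apply] at this
  linarith

theorem SuperAt.eventually_ge {g f : ℝ → ℝ} {θ lam : ℝ} (h : SuperAt g f θ lam)
    (hg : Continuous g) (hf : UniformContinuous f) {u : ℝ × ℝ → ℝ}
    (hu : UniformContinuousOn u (Ici 0 ×ˢ univ))
    (hinit : ∀ x, u (0, x) = θ * x) (hsub : IsSubsolution (fun p x => g p + f x) u)
    {ε : ℝ} (hε : 0 < ε) : ∀ᶠ t in atTop, lam - ε ≤ -u (t, 0) / t := by
  have := h.neg.eventually_le (by fun_prop) hf.neg (u := fun q => -u q)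
    (uniformContinuous_neg.comp_uniformContinuousOn hu)
    (fun x => by rw [hinit]; ring) hsub.neg hε
  filter_upwards [this] with t ht
  rw [neg_neg] at ht
  rw [neg_div]
  linarith

end HJ

namespace HJ

/-! ### Existence of solutions by Perron's method -/

theorem le_of_hasDerivAt_of_le_right {φ : ℝ → ℝ} {d c t : ℝ} (h : HasDerivAt φ d t)
    (hc : ∀ᶠ s in 𝓝 t, t < s → c * (s - t) ≤ φ s - φ t) : c ≤ d := by
  have h1 := h.hasDerivWithinAt (s := Ioi t)
  rw [hasDerivWithinAt_iff_tendsto_slope' (by simp)] at h1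
  refine ge_of_tendsto h1 ?_
  filter_upwards [self_mem_nhdsWithin, hc.filter_mono nhdsWithin_le_nhds] with s hs hs2
  rw [slope_def_field, le_div_iff₀ (sub_pos.2 hs)]
  exact hs2 hs

theorem le_of_hasDerivAt_of_le_left {φ : ℝ → ℝ} {d c t : ℝ} (h : HasDerivAt φ d t)
    (hc : ∀ᶠ s in 𝓝 t, s < t → c * (s - t) ≤ φ s - φ t) : d ≤ c := by
  have h1 := h.hasDerivWithinAt (s := Iio t)
  rw [hasDerivWithinAt_iff_tendsto_slope' (by simp)] at h1
  refine le_of_tendsto h1 ?_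
  filter_upwards [self_mem_nhdsWithin, hc.filter_mono nhdsWithin_le_nhds] with s hs hs2
  rw [slope_def_field, div_le_iff_of_neg (sub_neg.2 hs)]
  exact hs2 hs

theorem eventually_slice_time {P : ℝ × ℝ → Prop} {t x : ℝ}
    (h : ∀ᶠ q in 𝓝 (t, x), P q) : ∀ᶠ s in 𝓝 t, P (s, x) :=
  (show ContinuousAt (fun s : ℝ => (s, x)) t by fun_prop).eventually h

theorem eventually_slice_space {P : ℝ × ℝ → Prop} {t x : ℝ}
    (h : ∀ᶠ q in 𝓝 (t, x), P q) : ∀ᶠ y in 𝓝 x, P (t, y) :=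
  (show ContinuousAt (fun y : ℝ => (t, y)) x by fun_prop).eventually h

/-- The class of Lipschitz subsolutions, lying between two affine barriers, over which the
supremum is taken in Perron's method. -/
structure PerronClass (G f : ℝ → ℝ) (θ C₁ C₀ K : ℝ) (w : ℝ × ℝ → ℝ) : Prop where
  lower : ∀ t x, 0 ≤ t → θ * x - C₁ * t ≤ w (t, x)
  upper : ∀ t x, 0 ≤ t → w (t, x) ≤ θ * x + C₁ * t
  lip : ∀ t x y, 0 ≤ t → w (t, x) ≤ w (t, y) + K * |x - y|
  dec : ∀ t h x, 0 ≤ t → 0 ≤ h → w (t, x) ≤ w (t + h, x) + (C₁ + 1) * h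
  inc : ∀ t h x, 0 ≤ t → 0 ≤ h → w (t + h, x) ≤ w (t, x) + C₀ * h
  sub : IsSubsolution (fun p x => G p + f x) w

/-- The constants in Perron's method are large enough. -/
structure PerronConst (G f : ℝ → ℝ) (θ F C₁ C₀ K : ℝ) : Prop where
  hf : ∀ x, |f x| ≤ F
  hC₁ : |G θ| + F ≤ C₁
  hC₀ : C₁ ≤ C₀
  hG : ∀ p, F - G p < C₀
  hK : ∀ p, K ≤ |p| → C₁ + F < G p

variable {G f : ℝ → ℝ} {θ F C₁ C₀ K : ℝ}

theorem PerronConst.nonneg (h : PerronConst G f θ F C₁ C₀ K) : 0 ≤ C₁ := by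
  have := (abs_nonneg _).trans (h.hf 0)
  have := abs_nonneg (G θ)
  linarith [h.hC₁]

theorem PerronConst.abs_le (h : PerronConst G f θ F C₁ C₀ K) (x : ℝ) : |G θ + f x| ≤ C₁ :=
  (abs_add_le _ _).trans ((add_le_add_right (h.hf x) _).trans h.hC₁)

theorem PerronConst.abs_lt (h : PerronConst G f θ F C₁ C₀ K) {p x : ℝ} (hp : G p + f x ≤ C₁) :
    |p| < K := by
  by_contra! hc
  have := h.hK p hc
  have := (_root_.abs_le.1 (h.hf x)).1
  linarith

theorem PerronConst.K_pos (h : PerronConst G f θ F C₁ C₀ K) : |θ| < K :=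
  h.abs_lt (x := 0) ((_root_.abs_le.1 (h.abs_le 0)).2)

theorem PerronClass.uniformContinuousOn {w : ℝ × ℝ → ℝ} (h : PerronClass G f θ C₁ C₀ K w) :
    UniformContinuousOn w (Ici 0 ×ˢ univ) := by
  obtain ⟨L, hL0, hL1, hL2, hL3⟩ : ∃ L, 0 ≤ L ∧ K ≤ L ∧ C₁ + 1 ≤ L ∧ C₀ ≤ L :=
    ⟨max (max 0 K) (max (C₁ + 1) C₀), by simp, by simp, by simp, by simp⟩
  have h1 : ∀ t x s y, 0 ≤ t → 0 ≤ s → w (t, x) ≤ w (s, y) + L * |t - s| + L * |x - y| := by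
    intro t x s y ht hs
    have h1 := h.lip t x y ht
    have h2 : K * |x - y| ≤ L * |x - y| := mul_le_mul_of_nonneg_right hL1 (abs_nonneg _)
    rcases le_total t s with hts | hts
    · have h3 := h.dec t (s - t) y ht (by linarith)
      have h4 := mul_le_mul_of_nonneg_right hL2 (sub_nonneg.2 hts)
      rw [add_sub_cancel] at h3
      rw [abs_sub_comm t, abs_of_nonneg (sub_nonneg.2 hts)]
      linarith
    · have h3 := h.inc s (t - s) y hs (by linarith)
      have h4 := mul_le_mul_of_nonneg_right hL3 (sub_nonneg.2 hts)
      rw [add_sub_cancel] at h3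
      rw [abs_of_nonneg (sub_nonneg.2 hts)]
      linarith
  have hLip : LipschitzOnWith (Real.toNNReal (2 * L)) w (Ici 0 ×ˢ univ) := by
    refine LipschitzOnWith.of_le_add_mul' _ ?_
    rintro ⟨t, x⟩ ⟨ht, -⟩ ⟨s, y⟩ ⟨hs, -⟩
    have := h1 t x s y ht hs
    rw [Prod.dist_eq, Real.dist_eq, Real.dist_eq]
    have h5 := mul_le_mul_of_nonneg_left (le_max_left |t - s| |x - y|) hL0
    have h6 := mul_le_mul_of_nonneg_left (le_max_right |t - s| |x - y|) hL0
    simp only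
    linarith
  exact hLip.uniformContinuousOn

/-- An affine function touching a test function from below. -/
theorem affine_touch {φ : ℝ × ℝ → ℝ} {t x a b : ℝ} (hφ : DifferentiableAt ℝ φ (t, x))
    (h : ∀ᶠ q in 𝓝 (t, x), a * (q.1 - t) + b * (q.2 - x) ≤ φ q - φ (t, x)) :
    fderiv ℝ φ (t, x) (1, 0) = a ∧ fderiv ℝ φ (t, x) (0, 1) = b := by
  have h1 := eventually_slice_time h
  have h2 := eventually_slice_space h
  simp only [sub_self, mul_zero, add_zero, zero_add] at h1 h2
  refine ⟨le_antisymm ?_ ?_, le_antisymm ?_ ?_⟩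
  · exact le_of_hasDerivAt_of_le_left (hasDerivAt_time hφ) (h1.mono fun s hs _ => hs)
  · exact le_of_hasDerivAt_of_le_right (hasDerivAt_time hφ) (h1.mono fun s hs _ => hs)
  · exact le_of_hasDerivAt_of_le_left (hasDerivAt_space hφ) (h2.mono fun s hs _ => hs)
  · exact le_of_hasDerivAt_of_le_right (hasDerivAt_space hφ) (h2.mono fun s hs _ => hs)

theorem PerronConst.affine_mem (h : PerronConst G f θ F C₁ C₀ K) :
    PerronClass G f θ C₁ C₀ K (fun q => θ * q.2 - C₁ * q.1) where
  lower t x _ := le_rfl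
  upper t x ht := by
    have := mul_nonneg h.nonneg ht
    simp only; linarith
  lip t x y _ := by
    have h1 : θ * (x - y) ≤ |θ| * |x - y| := by rw [← abs_mul]; exact le_abs_self _
    have h2 := mul_le_mul_of_nonneg_right h.K_pos.le (abs_nonneg (x - y))
    simp only; linarith
  dec t s x _ hs := by simp only; linarith
  inc t s x _ hs := by
    have := mul_nonneg h.nonneg hs
    have := mul_nonneg (h.nonneg.trans h.hC₀) hs
    simp only; linarith
  sub := by
    intro t x ht φ hφ hmax
    obtain ⟨e1, e2⟩ := affine_touch (hφ.differentiable one_ne_zero (t, x)) (a := -C₁) (b := θ) (by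
      filter_upwards [hmax] with q hq
      linarith)
    rw [e1, e2]
    have := (_root_.abs_le.1 (h.abs_le x)).2
    simp only; linarith

theorem PerronClass.shift (hc : PerronConst G f θ F C₁ C₀ K) {w : ℝ × ℝ → ℝ}
    (h : PerronClass G f θ C₁ C₀ K w) {r : ℝ} (hr : 0 ≤ r) :
    PerronClass G f θ C₁ C₀ K
      (fun q => if q.1 ≤ r then θ * q.2 - C₁ * q.1 else w (q.1 - r, q.2) - C₁ * r) := by
  have hA := hc.affine_mem
  have hC := hc.nonneg
  have hlow : ∀ t x, 0 ≤ t → θ * x - C₁ * t ≤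
      if t ≤ r then θ * x - C₁ * t else w (t - r, x) - C₁ * r := by
    intro t x ht
    split_ifs with h1
    · exact le_rfl
    · push Not at h1
      have := h.lower (t - r) x (by linarith)
      linarith
  refine ⟨hlow, fun t x ht => ?_, fun t x y ht => ?_, fun t s x ht hs => ?_,
    fun t s x ht hs => ?_, ?_⟩
  · simp only
    split_ifs with h1
    · exact hA.upper t x ht
    · push Not at h1
      have := h.upper (t - r) x (by linarith)
      have := mul_nonneg hC hr
      linarith
  · simp only
    split_ifs with h1
    · exact hA.lip t x y ht
    · push Not at h1
      have := h.lip (t - r) x y (by linarith)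
      linarith
  · simp only
    rcases le_or_gt t r with h1 | h1
    · rw [if_pos h1]
      have := hlow (t + s) x (by linarith)
      have := mul_nonneg hC hs
      linarith
    · rw [if_neg h1.not_ge, if_neg (by linarith)]
      have := h.dec (t - r) s x (by linarith) hs
      rw [show t - r + s = t + s - r by ring] at this
      linarith
  · simp only
    have hh := mul_le_mul_of_nonneg_right hc.hC₀ hs
    rcases le_or_gt t r with h1 | h1
    · rw [if_pos h1]
      split_ifs with h2
      · exact hA.inc t s x ht hs
      · push Not at h2
        have := h.upper (t + s - r) x (by linarith)
        have := mul_nonneg hC (sub_nonneg.2 h1)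
        linarith
    · rw [if_neg h1.not_ge, if_neg (by linarith)]
      have := h.inc (t - r) s x (by linarith) hs
      rw [show t - r + s = t + s - r by ring] at this
      linarith
  · intro t x ht φ hφ hmax
    rcases le_or_gt t r with h1 | h1
    · obtain ⟨e1, e2⟩ := affine_touch (hφ.differentiable one_ne_zero (t, x)) (a := -C₁) (b := θ)
        (by
          have hpos : ∀ᶠ q : ℝ × ℝ in 𝓝 (t, x), 0 < q.1 :=
            continuous_fst.continuousAt.eventually (lt_mem_nhds ht)
          filter_upwards [hmax, hpos] with q hq hq0
          rw [if_pos h1] at hq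
          have := hlow q.1 q.2 hq0.le
          linarith)
      rw [e1, e2]
      have := (_root_.abs_le.1 (hc.abs_le x)).2
      simp only; linarith
    · have hd := hφ.differentiable one_ne_zero (t, x)
      have hφ' : ContDiff ℝ 1 (fun q : ℝ × ℝ => φ (q.1 + r, q.2)) :=
        hφ.comp (by fun_prop : ContDiff ℝ 1 (fun q : ℝ × ℝ => (q.1 + r, q.2)))
      have hd' := hφ'.differentiable one_ne_zero (t - r, x)
      have key := h.sub (t - r) x (by linarith) _ hφ' (by
        have hpos : ∀ᶠ q : ℝ × ℝ in 𝓝 (t - r, x), 0 < q.1 :=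
          continuous_fst.continuousAt.eventually (lt_mem_nhds (by simpa using h1))
        have hT : Tendsto (fun q : ℝ × ℝ => (q.1 + r, q.2)) (𝓝 (t - r, x)) (𝓝 (t, x)) := by
          have : Continuous (fun q : ℝ × ℝ => (q.1 + r, q.2)) := by fun_prop
          simpa using this.tendsto (t - r, x)
        filter_upwards [hT.eventually hmax, hpos] with q hq hq0
        rw [if_neg h1.not_ge, if_neg (by linarith)] at hq
        simp only [add_sub_cancel_right, sub_add_cancel] at hq ⊢
        linarith)
      have e1 : fderiv ℝ (fun q : ℝ × ℝ => φ (q.1 + r, q.2)) (t - r, x) (1, 0) =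
          fderiv ℝ φ (t, x) (1, 0) := by
        refine (hasDerivAt_time hd').unique ?_
        have := (hasDerivAt_time hd)
        rw [show t = t - r + r by ring] at this
        simpa using this.comp_add_const (t - r) r
      have e2 : fderiv ℝ (fun q : ℝ × ℝ => φ (q.1 + r, q.2)) (t - r, x) (0, 1) =
          fderiv ℝ φ (t, x) (0, 1) := by
        refine (hasDerivAt_space hd').unique ?_
        simpa using hasDerivAt_space hd
      rw [e1, e2] at key
      exact key

/-- The supremum of the Perron class. -/
noncomputable def perronSup (G f : ℝ → ℝ) (θ C₁ C₀ K : ℝ) (q : ℝ × ℝ) : ℝ :=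
  ⨆ w : {w // PerronClass G f θ C₁ C₀ K w}, w.1 q

theorem PerronClass.le_perronSup {w : ℝ × ℝ → ℝ} (h : PerronClass G f θ C₁ C₀ K w) {t x : ℝ}
    (ht : 0 ≤ t) : w (t, x) ≤ perronSup G f θ C₁ C₀ K (t, x) :=
  le_ciSup (f := fun w : {w // PerronClass G f θ C₁ C₀ K w} => w.1 (t, x))
    ⟨θ * x + C₁ * t, by rintro _ ⟨v, rfl⟩; exact v.2.upper t x ht⟩ ⟨w, h⟩

theorem PerronConst.perronSup_le (hc : PerronConst G f θ F C₁ C₀ K) {t x c : ℝ}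
    (h : ∀ w, PerronClass G f θ C₁ C₀ K w → w (t, x) ≤ c) :
    perronSup G f θ C₁ C₀ K (t, x) ≤ c :=
  haveI : Nonempty {w // PerronClass G f θ C₁ C₀ K w} := ⟨⟨_, hc.affine_mem⟩⟩
  ciSup_le fun w => h w.1 w.2

theorem PerronConst.perronSup_sub (hc : PerronConst G f θ F C₁ C₀ K) (hG : Continuous G)
    (hf : Continuous f) :
    IsSubsolution (fun p x => G p + f x) (perronSup G f θ C₁ C₀ K) := by
  intro t₀ x₀ ht₀ φ hφ hmax
  by_contra! hcon
  set u := perronSup G f θ C₁ C₀ K with hu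
  have hd := hφ.differentiable one_ne_zero
  have hD : Continuous (fderiv ℝ φ) := hφ.continuous_fderiv one_ne_zero
  have hD1 : Continuous fun q => fderiv ℝ φ q (1, 0) := hD.clm_apply continuous_const
  have hD2 : Continuous fun q => fderiv ℝ φ q (0, 1) := hD.clm_apply continuous_const
  have hcont : Continuous fun q : ℝ × ℝ => (fderiv ℝ φ q (1, 0) + 2 * (q.1 - t₀)) +
      (G (fderiv ℝ φ q (0, 1) + 2 * (q.2 - x₀)) + f q.2) := by
    fun_prop
  have hev := (hcont.tendsto (t₀, x₀)).eventually (lt_mem_nhds (a := 0) (by simpa using hcon))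
  have hpos : ∀ᶠ q : ℝ × ℝ in 𝓝 (t₀, x₀), 0 < q.1 :=
    continuous_fst.continuousAt.eventually (lt_mem_nhds ht₀)
  obtain ⟨r, hr, hball⟩ := Metric.nhds_basis_closedBall.eventually_iff.1
    ((hev.and hpos).and hmax)
  obtain ⟨w, hw, hwlt⟩ : ∃ w, PerronClass G f θ C₁ C₀ K w ∧ u (t₀, x₀) - r ^ 2 < w (t₀, x₀) := by
    by_contra! hno
    have := hc.perronSup_le hno
    have := sq_pos_of_pos hr
    linarith
  set φ₂ : ℝ × ℝ → ℝ := fun q => φ q + ((q.1 - t₀) ^ 2 + (q.2 - x₀) ^ 2) with hφ₂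
  have hφ₂c : ContDiff ℝ 1 φ₂ := hφ.add (by fun_prop)
  have hwc : ContinuousOn w (Metric.closedBall (t₀, x₀) r) :=
    hw.uniformContinuousOn.continuousOn.mono fun q hq => ⟨(hball hq).1.2.le, trivial⟩
  obtain ⟨⟨t₁, x₁⟩, hmem, hmax₁⟩ := (isCompact_closedBall (t₀, x₀) r).exists_isMaxOn
    ⟨(t₀, x₀), Metric.mem_closedBall_self hr.le⟩ (hwc.sub hφ₂c.continuous.continuousOn)
  have hge := hmax₁ (Metric.mem_closedBall_self hr.le)
  simp only [hφ₂, mem_ofPred_eq, Pi.sub_apply, sub_self] at hge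
  obtain ⟨⟨hev₁, hpos₁⟩, hle₁⟩ := hball hmem
  have hwu := hw.le_perronSup hpos₁.le (x := x₁)
  have hlt : dist (t₁, x₁) (t₀, x₀) < r := by
    refine lt_of_le_of_ne hmem fun heq => ?_
    rw [Prod.dist_eq, Real.dist_eq, Real.dist_eq] at heq
    have : r ^ 2 ≤ (t₁ - t₀) ^ 2 + (x₁ - x₀) ^ 2 := by
      rcases max_choice |t₁ - t₀| |x₁ - x₀| with h1 | h1 <;> rw [h1] at heq <;>
        rw [← heq, sq_abs] <;> nlinarith [sq_nonneg (t₁ - t₀), sq_nonneg (x₁ - x₀)]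
    simp only [← hu] at hle₁ hwu
    linarith
  have hsub := hw.sub t₁ x₁ hpos₁ φ₂ hφ₂c
    (hmax₁.isLocalMax (mem_of_superset (Metric.isOpen_ball.mem_nhds hlt) Metric.ball_subset_closedBall))
  have hd₂ := hφ₂c.differentiable one_ne_zero (t₁, x₁)
  have e1 : fderiv ℝ φ₂ (t₁, x₁) (1, 0) = fderiv ℝ φ (t₁, x₁) (1, 0) + 2 * (t₁ - t₀) :=
    (hasDerivAt_time hd₂).unique ((hasDerivAt_time (hd _)).add
      (hasDerivAt_quadratic (t₀ ^ 2 + (x₁ - x₀) ^ 2) (-2 * t₀) 1 (fun s => by ring) (by ring)))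
  have e2 : fderiv ℝ φ₂ (t₁, x₁) (0, 1) = fderiv ℝ φ (t₁, x₁) (0, 1) + 2 * (x₁ - x₀) :=
    (hasDerivAt_space hd₂).unique ((hasDerivAt_space (hd _)).add
      (hasDerivAt_quadratic (x₀ ^ 2 + (t₁ - t₀) ^ 2) (-2 * x₀) 1 (fun s => by ring) (by ring)))
  rw [e1, e2] at hsub
  simp only at hev₁ hsub
  linarith

theorem PerronConst.perronSup_mem (hc : PerronConst G f θ F C₁ C₀ K) (hG : Continuous G)
    (hf : Continuous f) : PerronClass G f θ C₁ C₀ K (perronSup G f θ C₁ C₀ K) where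
  lower t x ht := hc.affine_mem.le_perronSup ht
  upper t x ht := hc.perronSup_le fun w hw => hw.upper t x ht
  lip t x y ht := hc.perronSup_le fun w hw =>
    (hw.lip t x y ht).trans (add_le_add_left (hw.le_perronSup ht) _)
  dec t s x ht hs := hc.perronSup_le fun w hw =>
    (hw.dec t s x ht hs).trans (add_le_add_left (hw.le_perronSup (by linarith)) _)
  inc t s x ht hs := hc.perronSup_le fun w hw =>
    (hw.inc t s x ht hs).trans (add_le_add_left (hw.le_perronSup ht) _)
  sub := hc.perronSup_sub hG hf

theorem PerronConst.perronSup_dec (hc : PerronConst G f θ F C₁ C₀ K) {t s x : ℝ} (ht : 0 ≤ t)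
    (hs : 0 ≤ s) :
    perronSup G f θ C₁ C₀ K (t, x) ≤ perronSup G f θ C₁ C₀ K (t + s, x) + C₁ * s := by
  refine hc.perronSup_le fun w hw => ?_
  have h1 := (hw.shift hc hs).le_perronSup (t := t + s) (x := x) (by linarith)
  simp only at h1
  split_ifs at h1 with h2
  · obtain rfl : t = 0 := by linarith
    have := hw.upper 0 x le_rfl
    simp only [zero_add, mul_zero, add_zero] at *
    linarith
  · rw [add_sub_cancel_right] at h1
    linarith


/-- A local modification of a member of the Perron class above a cone. -/
theorem PerronClass.bump {u : ℝ × ℝ → ℝ}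
    (hu : PerronClass G f θ C₁ C₀ K u) {t₀ x₀ a b c η r : ℝ} (hη : 0 ≤ η) (hr : 0 < r)
    (hrt : r < t₀) (ha : -(C₁ + 1) ≤ a - 2 * η) (ha' : a + 2 * η ≤ C₀) (hb : |b| + 2 * η ≤ K)
    (hH : ∀ a' b' x, |a' - a| ≤ 2 * η → |b' - b| ≤ 2 * η → |x - x₀| ≤ r → a' + (G b' + f x) ≤ 0)
    {ψ : ℝ × ℝ → ℝ}
    (hψ : ψ = fun q => c + a * (q.1 - t₀) + b * (q.2 - x₀) - 2 * η * (|q.1 - t₀| + |q.2 - x₀|))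
    (hψu : ∀ t x, |t - t₀| ≤ r → |x - x₀| ≤ r → r / 2 ≤ max |t - t₀| |x - x₀| →
      ψ (t, x) ≤ u (t, x))
    (hψb : ∀ t x, |t - t₀| ≤ r → |x - x₀| ≤ r → ψ (t, x) ≤ θ * x + C₁ * t) :
    PerronClass G f θ C₁ C₀ K
      (fun q => if |q.1 - t₀| ≤ r ∧ |q.2 - x₀| ≤ r then max (u q) (ψ q) else u q) := by
  set w : ℝ × ℝ → ℝ :=
    fun q => if |q.1 - t₀| ≤ r ∧ |q.2 - x₀| ≤ r then max (u q) (ψ q) else u q with hw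
  have hge : ∀ q, u q ≤ w q := fun q => by
    simp only [hw]; split_ifs
    · exact le_max_left _ _
    · exact le_rfl
  have hgeψ : ∀ t x, |t - t₀| ≤ r → |x - x₀| ≤ r → ψ (t, x) ≤ w (t, x) := fun t x h1 h2 => by
    simp only [hw]; rw [if_pos ⟨h1, h2⟩]; exact le_max_right _ _
  have halt : ∀ t x, w (t, x) = u (t, x) ∨
      (|t - t₀| < r / 2 ∧ |x - x₀| < r / 2 ∧ w (t, x) = ψ (t, x)) := by
    intro t x
    by_cases h : |t - t₀| ≤ r ∧ |x - x₀| ≤ r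
    · rcases lt_or_ge (max |t - t₀| |x - x₀|) (r / 2) with h1 | h1
      · simp only [hw]
        rw [if_pos h]
        rcases max_choice (u (t, x)) (ψ (t, x)) with h2 | h2
        · exact Or.inl h2
        · exact Or.inr ⟨(le_max_left _ _).trans_lt h1, (le_max_right _ _).trans_lt h1, h2⟩
      · left
        simp only [hw]
        rw [if_pos h]
        exact max_eq_left (hψu t x h.1 h.2 h1)
    · left
      simp only [hw]
      rw [if_neg h]
  have hψt : ∀ t s x, 0 ≤ s → ψ (t, x) ≤ ψ (t + s, x) + (C₁ + 1) * s ∧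
      ψ (t + s, x) ≤ ψ (t, x) + C₀ * s := by
    intro t s x hs
    have h1 := abs_sub_le (t + s) t t₀
    have h2 := abs_sub_le t (t + s) t₀
    rw [add_sub_cancel_left, abs_of_nonneg hs] at h1
    rw [sub_add_cancel_left, abs_neg, abs_of_nonneg hs] at h2
    have h3 := mul_le_mul_of_nonneg_left h1 hη
    have h4 := mul_le_mul_of_nonneg_left h2 hη
    have h5 := mul_le_mul_of_nonneg_right ha hs
    have h6 := mul_le_mul_of_nonneg_right ha' hs
    rw [hψ]
    constructor <;> simp only <;> linarith
  have hψx : ∀ t x y, ψ (t, x) ≤ ψ (t, y) + K * |x - y| := by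
    intro t x y
    have h1 := mul_le_mul_of_nonneg_left (abs_sub_le y x x₀) hη
    rw [abs_sub_comm y x] at h1
    have h2 : b * (x - y) ≤ |b| * |x - y| := by rw [← abs_mul]; exact le_abs_self _
    have h3 := mul_le_mul_of_nonneg_right hb (abs_nonneg (x - y))
    rw [hψ]
    simp only
    linarith
  refine ⟨fun t x ht => (hu.lower t x ht).trans (hge _), fun t x ht => ?_, fun t x y ht => ?_,
    fun t s x ht hs => ?_, fun t s x ht hs => ?_, fun t x ht φ hφ hmax => ?_⟩
  · rcases halt t x with h | ⟨h1, h2, h⟩ <;> rw [h]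
    · exact hu.upper t x ht
    · exact hψb t x (by linarith) (by linarith)
  · rcases halt t x with h | ⟨h1, h2, h⟩ <;> rw [h]
    · linarith [hu.lip t x y ht, hge (t, y)]
    · by_cases hy : |y - x₀| ≤ r
      · linarith [hψx t x y, hgeψ t y (by linarith) hy]
      · push Not at hy
        obtain ⟨h2a, h2b⟩ := abs_lt.1 h2
        obtain ⟨e, he, hxy⟩ : ∃ e, |e - x₀| = r ∧ |x - e| + |e - y| = |x - y| := by
          rcases lt_abs.1 hy with h3 | h3
          · refine ⟨x₀ + r, by rw [add_sub_cancel_left, abs_of_pos hr], ?_⟩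
            rw [abs_of_nonpos, abs_of_nonpos, abs_of_nonpos] <;> linarith
          · refine ⟨x₀ - r, by rw [sub_sub_cancel_left, abs_neg, abs_of_pos hr], ?_⟩
            rw [abs_of_nonneg, abs_of_nonneg, abs_of_nonneg] <;> linarith
        have h4 := hψu t e (by linarith) he.le (by rw [he]; exact le_max_of_le_right (by linarith))
        have h5 := hψx t x e
        have h6 := hu.lip t e y ht
        rw [← hxy, mul_add]
        linarith [hge (t, y)]
  · rcases halt t x with h | ⟨h1, h2, h⟩ <;> rw [h]
    · linarith [hu.dec t s x ht hs, hge (t + s, x)]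
    · by_cases hy : |t + s - t₀| ≤ r
      · linarith [(hψt t s x hs).1, hgeψ (t + s) x hy (by linarith)]
      · obtain ⟨h2a, h2b⟩ := abs_lt.1 h1
        have h3 : t₀ + r < t + s := by
          rcases lt_abs.1 (not_le.1 hy) with h3 | h3 <;> linarith
        have he : |t₀ + r - t₀| = r := by rw [add_sub_cancel_left, abs_of_pos hr]
        have h4 := hψu (t₀ + r) x he.le (by linarith)
          (by rw [he]; exact le_max_of_le_left (by linarith))
        have h5 := (hψt t (t₀ + r - t) x (by linarith)).1
        have h6 := hu.dec (t₀ + r) (t + s - (t₀ + r)) x (by linarith) (by linarith)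
        rw [add_sub_cancel] at h5 h6
        linarith [hge (t + s, x)]
  · rcases halt (t + s) x with h | ⟨h1, h2, h⟩ <;> rw [h]
    · linarith [hu.inc t s x ht hs, hge (t, x)]
    · by_cases hy : |t - t₀| ≤ r
      · linarith [(hψt t s x hs).2, hgeψ t x hy (by linarith)]
      · obtain ⟨h2a, h2b⟩ := abs_lt.1 h1
        have h3 : t < t₀ - r := by
          rcases lt_abs.1 (not_le.1 hy) with h3 | h3 <;> linarith
        have he : |t₀ - r - t₀| = r := by rw [sub_sub_cancel_left, abs_neg, abs_of_pos hr]
        have h4 := hψu (t₀ - r) x he.le (by linarith)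
          (by rw [he]; exact le_max_of_le_left (by linarith))
        have h5 := (hψt (t₀ - r) (t + s - (t₀ - r)) x (by linarith)).2
        have h6 := hu.inc t (t₀ - r - t) x ht (by linarith)
        rw [add_sub_cancel] at h5 h6
        linarith [hge (t, x)]
  · rcases halt t x with h | ⟨h1, h2, h⟩
    · refine hu.sub t x ht φ hφ ?_
      filter_upwards [hmax] with q hq
      rw [h] at hq
      linarith [hge q]
    · have hd := hφ.differentiable one_ne_zero (t, x)
      have hev : ∀ᶠ q : ℝ × ℝ in 𝓝 (t, x), ψ q - ψ (t, x) ≤ φ q - φ (t, x) := by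
        have n1 : ∀ᶠ q : ℝ × ℝ in 𝓝 (t, x), |q.1 - t₀| < r :=
          (show Continuous fun q : ℝ × ℝ => |q.1 - t₀| by fun_prop).continuousAt.eventually
            (gt_mem_nhds (by simp only; linarith))
        have n2 : ∀ᶠ q : ℝ × ℝ in 𝓝 (t, x), |q.2 - x₀| < r :=
          (show Continuous fun q : ℝ × ℝ => |q.2 - x₀| by fun_prop).continuousAt.eventually
            (gt_mem_nhds (by simp only; linarith))
        filter_upwards [hmax, n1, n2] with q hq hq1 hq2
        rw [h] at hq
        linarith [hgeψ q.1 q.2 hq1.le hq2.le]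
      have hevt := eventually_slice_time hev
      have hevx := eventually_slice_space hev
      have bt : ∀ s, a * (s - t) - 2 * η * |s - t| ≤ ψ (s, x) - ψ (t, x) := fun s => by
        have := mul_le_mul_of_nonneg_left (abs_sub_le s t t₀) hη
        rw [hψ]; simp only; linarith
      have bx : ∀ y, b * (y - x) - 2 * η * |y - x| ≤ ψ (t, y) - ψ (t, x) := fun y => by
        have := mul_le_mul_of_nonneg_left (abs_sub_le y x x₀) hη
        rw [hψ]; simp only; linarith
      have g1 : a - 2 * η ≤ fderiv ℝ φ (t, x) (1, 0) :=
        le_of_hasDerivAt_of_le_right (hasDerivAt_time hd) (hevt.mono fun s hs hst => by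
          have := bt s
          rw [abs_of_pos (sub_pos.2 hst)] at this
          linarith)
      have g2 : fderiv ℝ φ (t, x) (1, 0) ≤ a + 2 * η :=
        le_of_hasDerivAt_of_le_left (hasDerivAt_time hd) (hevt.mono fun s hs hst => by
          have := bt s
          rw [abs_of_neg (sub_neg.2 hst)] at this
          linarith)
      have g3 : b - 2 * η ≤ fderiv ℝ φ (t, x) (0, 1) :=
        le_of_hasDerivAt_of_le_right (hasDerivAt_space hd) (hevx.mono fun s hs hst => by
          have := bx s
          rw [abs_of_pos (sub_pos.2 hst)] at this
          linarith)
      have g4 : fderiv ℝ φ (t, x) (0, 1) ≤ b + 2 * η :=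
        le_of_hasDerivAt_of_le_left (hasDerivAt_space hd) (hevx.mono fun s hs hst => by
          have := bx s
          rw [abs_of_neg (sub_neg.2 hst)] at this
          linarith)
      exact hH _ _ _ (_root_.abs_le.2 ⟨by linarith, by linarith⟩)
        (_root_.abs_le.2 ⟨by linarith, by linarith⟩) (by linarith)

theorem PerronConst.perronSup_super (hc : PerronConst G f θ F C₁ C₀ K) (hG : Continuous G)
    (hf : Continuous f) :
    IsSupersolution (fun p x => G p + f x) (perronSup G f θ C₁ C₀ K) := by
  intro t₀ x₀ ht₀ φ hφ hmin
  by_contra! hcon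
  have hu := hc.perronSup_mem hG hf
  have hudec := fun t s x => hc.perronSup_dec (t := t) (s := s) (x := x)
  have hmaxi := fun w (hw : PerronClass G f θ C₁ C₀ K w) => hw.le_perronSup ht₀.le (x := x₀)
  generalize perronSup G f θ C₁ C₀ K = u at hmin hu hudec hmaxi
  have hd := hφ.differentiable one_ne_zero (t₀, x₀)
  obtain ⟨a, ha⟩ : ∃ a, a = fderiv ℝ φ (t₀, x₀) (1, 0) := ⟨_, rfl⟩
  obtain ⟨b, hb⟩ : ∃ b, b = fderiv ℝ φ (t₀, x₀) (0, 1) := ⟨_, rfl⟩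
  have hfd : ∀ q : ℝ × ℝ, fderiv ℝ φ (t₀, x₀) q = a * q.1 + b * q.2 := fun q => by
    have : q = q.1 • ((1 : ℝ), (0 : ℝ)) + q.2 • ((0 : ℝ), (1 : ℝ)) := by ext <;> simp
    conv_lhs => rw [this]
    rw [map_add, map_smul, map_smul, ← ha, ← hb]
    simp only [smul_eq_mul]; ring
  rw [← ha, ← hb] at hcon
  have hpos : ∀ᶠ q : ℝ × ℝ in 𝓝 (t₀, x₀), 0 < q.1 :=
    continuous_fst.continuousAt.eventually (lt_mem_nhds ht₀)
  have hage : -C₁ ≤ a := by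
    refine neg_le.1 ?_
    have h1 : HasDerivAt (fun s => -φ (s, x₀)) (-a) t₀ := ha ▸ (hasDerivAt_time hd).neg
    refine le_of_hasDerivAt_of_le_left h1 ?_
    filter_upwards [eventually_slice_time hmin, eventually_slice_time hpos]
      with s hs hs0 hst
    have := hudec s (t₀ - s) x₀ hs0.le (by linarith)
    rw [add_sub_cancel] at this
    linarith
  have hbK : |b| < K := hc.abs_lt (x := x₀) (by linarith)
  have haC : a < C₀ := by
    have := hc.hG b
    have := (_root_.abs_le.1 (hc.hf x₀)).1
    linarith
  have hgap : u (t₀, x₀) < θ * x₀ + C₁ * t₀ := by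
    refine lt_of_le_of_ne (hu.upper _ _ ht₀.le) fun heq => ?_
    obtain ⟨e1, e2⟩ := affine_touch (φ := fun q => -φ q) (a := -C₁) (b := -θ) hd.neg (by
      filter_upwards [hmin, hpos] with q hq hq0
      have := hu.upper q.1 q.2 hq0.le
      rw [heq] at hq
      linarith)
    have e : fderiv ℝ (fun q => -φ q) (t₀, x₀) = -fderiv ℝ φ (t₀, x₀) := fderiv_fun_neg
    rw [e, neg_apply] at e1 e2
    rw [← ha] at e1
    rw [← hb] at e2
    obtain rfl : b = θ := by linarith
    have := (_root_.abs_le.1 (hc.abs_le x₀)).1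
    linarith
  have hHc : Continuous fun z : ℝ × ℝ × ℝ => z.1 + (G z.2.1 + f z.2.2) := by fun_prop
  obtain ⟨ρ, hρ, hHρ⟩ := Metric.eventually_nhds_iff_ball.1
    ((hHc.tendsto (a, b, x₀)).eventually (gt_mem_nhds hcon))
  obtain ⟨η, hη, hη1, hη2, hη3, hη4⟩ : ∃ η : ℝ, 0 < η ∧ 2 * η < ρ ∧ 2 * η ≤ 1 ∧
      2 * η ≤ C₀ - a ∧ 2 * η ≤ K - |b| := by
    have h1 : 0 < C₀ - a := by linarith
    have h2 : 0 < K - |b| := by linarith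
    refine ⟨min (min (ρ / 2) 1) (min (C₀ - a) (K - |b|)) / 2, by positivity, ?_, ?_, ?_, ?_⟩ <;>
      rw [mul_div_cancel₀ _ (two_ne_zero)]
    · exact ((min_le_left _ _).trans (min_le_left _ _)).trans_lt (by linarith)
    · exact (min_le_left _ _).trans (min_le_right _ _)
    · exact (min_le_right _ _).trans (min_le_left _ _)
    · exact (min_le_right _ _).trans (min_le_right _ _)
  have hlin := (hd.hasFDerivAt.isLittleO.def hη)
  have hbar : ∀ᶠ q : ℝ × ℝ in 𝓝 (t₀, x₀), u (t₀, x₀) + (θ * x₀ + C₁ * t₀ - u (t₀, x₀)) / 2 +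
      a * (q.1 - t₀) + b * (q.2 - x₀) < θ * q.2 + C₁ * q.1 := by
    have : Continuous fun q : ℝ × ℝ => θ * q.2 + C₁ * q.1 - (u (t₀, x₀) +
      (θ * x₀ + C₁ * t₀ - u (t₀, x₀)) / 2 + a * (q.1 - t₀) + b * (q.2 - x₀)) := by fun_prop
    filter_upwards [(this.tendsto (t₀, x₀)).eventually (lt_mem_nhds (a := 0) (by
      simp only [sub_self]; linarith))] with q hq
    linarith
  obtain ⟨r', hr', hball⟩ := Metric.eventually_nhds_iff_ball.1 ((hlin.and hbar).and hmin)
  obtain ⟨r, hr, hr1, hr2, hr3⟩ : ∃ r : ℝ, 0 < r ∧ r < r' ∧ r < t₀ ∧ r < ρ := by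
    refine ⟨min r' (min t₀ ρ) / 2, by positivity, ?_, ?_, ?_⟩
    · linarith [min_le_left r' (min t₀ ρ)]
    · linarith [min_le_right r' (min t₀ ρ), min_le_left t₀ ρ]
    · linarith [min_le_right r' (min t₀ ρ), min_le_right t₀ ρ]
  obtain ⟨δ, hδ, hδ1, hδ2⟩ : ∃ δ : ℝ, 0 < δ ∧ δ ≤ η * r / 2 ∧
      δ ≤ (θ * x₀ + C₁ * t₀ - u (t₀, x₀)) / 2 := by
    have : 0 < θ * x₀ + C₁ * t₀ - u (t₀, x₀) := by linarith
    exact ⟨min (η * r / 2) ((θ * x₀ + C₁ * t₀ - u (t₀, x₀)) / 2), by positivity,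
      min_le_left _ _, min_le_right _ _⟩
  have hmemball : ∀ t x, |t - t₀| ≤ r → |x - x₀| ≤ r → (t, x) ∈ Metric.ball (t₀, x₀) r' := by
    intro t x h1 h2
    rw [Metric.mem_ball, Prod.dist_eq, Real.dist_eq, Real.dist_eq]
    exact max_lt (by simp only; linarith) (by simp only; linarith)
  have hbump := hu.bump (t₀ := t₀) (x₀ := x₀) (a := a) (b := b) (c := u (t₀, x₀) + δ)
    hη.le hr hr2 (by linarith) (by linarith) (by linarith) (fun a' b' x h1 h2 h3 => by
      refine (hHρ (a', b', x) ?_).le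
      rw [Metric.mem_ball, Prod.dist_eq, Prod.dist_eq, Real.dist_eq, Real.dist_eq, Real.dist_eq]
      exact max_lt (by simp only; linarith) (max_lt (by simp only; linarith)
        (by simp only; linarith))) rfl (fun t x h1 h2 h3 => by
      obtain ⟨⟨hl, -⟩, hm⟩ := hball _ (hmemball t x h1 h2)
      rw [hfd, Real.norm_eq_abs, Prod.norm_def] at hl
      simp only [Prod.mk_sub_mk, Real.norm_eq_abs] at hl
      have hl2 := (_root_.abs_le.1 hl).1
      have h4 : max |t - t₀| |x - x₀| ≤ |t - t₀| + |x - x₀| :=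
        max_le (by linarith [abs_nonneg (x - x₀)]) (by linarith [abs_nonneg (t - t₀)])
      have h5 := mul_le_mul_of_nonneg_left h4 hη.le
      have h6 := mul_le_mul_of_nonneg_left h3 hη.le
      simp only
      linarith) (fun t x h1 h2 => by
      obtain ⟨⟨-, hl⟩, -⟩ := hball _ (hmemball t x h1 h2)
      have : 0 ≤ 2 * η * (|t - t₀| + |x - x₀|) := by positivity
      simp only at hl ⊢
      linarith)
  have := hmaxi _ hbump
  simp only [sub_self, abs_zero, hr.le, and_self, if_true, mul_zero, add_zero, sub_zero] at this
  have := (le_max_right _ _).trans this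
  linarith

/-- Existence of a viscosity solution with linear initial datum. -/
theorem exists_isSolution {G f : ℝ → ℝ} (hG : Continuous G) (hGc : Coercive G)
    (hf : Continuous f) (hfb : ∃ F, ∀ x, |f x| ≤ F) (θ : ℝ) :
    ∃ u, IsSolution (fun p x => G p + f x) (fun x => θ * x) u := by
  obtain ⟨F, hF⟩ := hfb
  obtain ⟨p₀, hp₀⟩ := hG.exists_forall_le (by
    rw [cocompact_eq_atBot_atTop]
    exact Tendsto.sup hGc.2 hGc.1)
  obtain ⟨R, hR⟩ := eventually_atTop.1 (hGc.1.eventually_gt_atTop (|G θ| + F + F))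
  obtain ⟨L, hL⟩ := eventually_atBot.1 (hGc.2.eventually_gt_atTop (|G θ| + F + F))
  have hc : PerronConst G f θ F (|G θ| + F) (max (|G θ| + F) (F - G p₀ + 1)) (max R (-L)) := by
    refine ⟨hF, le_rfl, le_max_left _ _, fun p => ?_, fun p hp => ?_⟩
    · exact lt_of_lt_of_le (by linarith [hp₀ p]) (le_max_right _ _)
    · rcases le_abs.1 hp with h | h
      · exact hR p ((le_max_left _ _).trans h)
      · exact hL p (by linarith [(le_max_right R (-L)).trans h])
  have hm := hc.perronSup_mem hG hf
  refine ⟨_, hm.uniformContinuousOn, fun x => ?_, hm.sub, hc.perronSup_super hG hf⟩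
  have h1 := hm.lower 0 x le_rfl
  have h2 := hm.upper 0 x le_rfl
  linarith

end HJ

namespace HJ

/-! ### The pointwise ergodic theorem for stationary processes -/

theorem sum_ge_of_blocks {b : ℕ → ℝ} {c K : ℝ} {N : ℕ} (hK : 0 ≤ K) (hb : ∀ i, -K ≤ b i)
    (h : ∀ j, ∃ n, 1 ≤ n ∧ n ≤ N ∧ c * n ≤ ∑ i ∈ Finset.range n, b (j + i)) (L j : ℕ) :
    c * L - N * (K + |c|) ≤ ∑ i ∈ Finset.range L, b (j + i) := by
  induction L using Nat.strong_induction_on generalizing j with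
  | _ L ih =>
    rcases le_or_gt L N with hL | hL
    · have h1 : ∑ _i ∈ Finset.range L, (-K) ≤ ∑ i ∈ Finset.range L, b (j + i) :=
        Finset.sum_le_sum fun i _ => hb _
      rw [Finset.sum_const, Finset.card_range, nsmul_eq_mul] at h1
      have h2 : (L : ℝ) ≤ N := by exact_mod_cast hL
      have h3 := mul_le_mul_of_nonneg_right h2 (show 0 ≤ K + |c| by positivity)
      have h4 := mul_le_mul_of_nonneg_right (le_abs_self c) (Nat.cast_nonneg (α := ℝ) L)
      linarith
    · obtain ⟨n, hn1, hnN, hn⟩ := h j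
      obtain ⟨l, rfl⟩ := Nat.exists_eq_add_of_le (hnN.trans hL.le)
      have := ih l (by omega) (j + n)
      rw [Finset.sum_range_add]
      simp only [add_assoc] at this ⊢
      push_cast
      linarith

section Ergodic

variable {Ω : Type*} [MeasurableSpace Ω] {P : Measure Ω} {τ : ℝ → Ω → Ω}

/-- A bounded measurable stationary process. -/
structure IsStationary (τ : ℝ → Ω → Ω) (F : ℝ → Ω → ℝ) : Prop where
  meas : Measurable (fun q : ℝ × Ω => F q.1 q.2)
  stat : ∀ x ω, F x ω = F 0 (τ x ω)
  bdd : ∃ K, ∀ x ω, |F x ω| ≤ K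

theorem IsStationary.neg {F : ℝ → Ω → ℝ} (hF : IsStationary τ F) :
    IsStationary τ (fun x ω => -F x ω) :=
  ⟨hF.meas.neg, fun x ω => by rw [hF.stat], hF.bdd.imp fun K hK x ω => by
    simpa using hK x ω⟩

theorem IsStationary.isBddMeas {F : ℝ → Ω → ℝ} (hF : IsStationary τ F) (ω : Ω) :
    IsBddMeas (fun x => F x ω) :=
  ⟨hF.meas.comp (measurable_id.prodMk measurable_const), hF.bdd.imp fun _ hK x => hK x ω⟩

theorem IsStationary.meas_zero {F : ℝ → Ω → ℝ} (hF : IsStationary τ F) : Measurable (F 0) :=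
  hF.meas.comp (measurable_const.prodMk measurable_id)

theorem IsStationary.shift (hτ : IsErgodicFlow P τ) {F : ℝ → Ω → ℝ} (hF : IsStationary τ F)
    (x y : ℝ) (ω : Ω) : F x (τ y ω) = F (x + y) ω := by
  rw [hF.stat, hF.stat (x + y), hτ.add]; rfl

theorem IsStationary.integral_shift (hτ : IsErgodicFlow P τ) {F : ℝ → Ω → ℝ}
    (hF : IsStationary τ F) (a b y : ℝ) (ω : Ω) :
    ∫ s in a..b, F s (τ y ω) = ∫ s in (a + y)..(b + y), F s ω := by
  simp only [hF.shift hτ]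
  rw [intervalIntegral.integral_comp_add_right (fun s => F s ω)]

theorem IsStationary.measurable_integral {F : ℝ → Ω → ℝ} (hF : IsStationary τ F) (a b : ℝ) :
    Measurable (fun ω => ∫ s in a..b, F s ω) := by
  have h : StronglyMeasurable (fun q : Ω × ℝ => F q.2 q.1) :=
    (hF.meas.comp measurable_swap).stronglyMeasurable
  simp only [intervalIntegral]
  exact (h.integral_prod_right (ν := volume.restrict (Ioc a b))).measurable.sub
    (h.integral_prod_right (ν := volume.restrict (Ioc b a))).measurable

theorem IsBddMeas.abs_integral_le {p : ℝ → ℝ} {K : ℝ} (hK : ∀ x, |p x| ≤ K)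
    (a b : ℝ) : |∫ s in a..b, p s| ≤ K * |b - a| := by
  have := intervalIntegral.norm_integral_le_of_norm_le_const (a := a) (b := b) (f := p) (C := K)
    (fun s _ => hK s)
  simpa using this

theorem IsStationary.integral_mean [IsProbabilityMeasure P] (hτ : IsErgodicFlow P τ)
    {F : ℝ → Ω → ℝ} (hF : IsStationary τ F) (x : ℝ) : ∫ ω, F x ω ∂P = ∫ ω, F 0 ω ∂P := by
  have h := hτ.measurePreserving x
  calc ∫ ω, F x ω ∂P = ∫ ω, F 0 (τ x ω) ∂P := by simp only [← hF.stat]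
    _ = ∫ ω, F 0 ω ∂(P.map (τ x)) :=
      (integral_map h.measurable.aemeasurable hF.meas_zero.aestronglyMeasurable).symm
    _ = _ := by rw [h.map_eq]

theorem IsStationary.integral_unit [IsProbabilityMeasure P] (hτ : IsErgodicFlow P τ)
    {F : ℝ → Ω → ℝ} (hF : IsStationary τ F) :
    ∫ ω, (∫ s in (0 : ℝ)..1, F s ω) ∂P = ∫ ω, F 0 ω ∂P := by
  obtain ⟨K, hK⟩ := hF.bdd
  have hint : Integrable (Function.uncurry fun ω s => F s ω)
      (P.prod (volume.restrict (Ioc (0 : ℝ) 1))) := by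
    refine Integrable.of_bound (C := K)
      (hF.meas.comp measurable_swap).aestronglyMeasurable ?_
    exact Eventually.of_forall fun q => hK _ _
  simp only [intervalIntegral.integral_of_le zero_le_one]
  rw [integral_integral_swap hint]
  simp only [hF.integral_mean hτ]
  simp

theorem IsStationary.integrable [IsProbabilityMeasure P] {F : ℝ → Ω → ℝ} (hF : IsStationary τ F) :
    Integrable (F 0) P := by
  obtain ⟨K, hK⟩ := hF.bdd
  exact Integrable.of_bound (C := K) hF.meas_zero.aestronglyMeasurable
    (Eventually.of_forall fun ω => hK 0 ω)

/-- The maximal inequality. -/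
theorem IsStationary.le_mean_of_maximal [IsProbabilityMeasure P] (hτ : IsErgodicFlow P τ)
    {F : ℝ → Ω → ℝ} (hF : IsStationary τ F) {c : ℝ}
    (h : ∀ᵐ ω ∂P, ∃ n : ℕ, 1 ≤ n ∧ c * n ≤ ∫ s in (0 : ℝ)..n, F s ω) :
    c ≤ ∫ ω, F 0 ω ∂P := by
  obtain ⟨K, hK⟩ := hF.bdd
  have hΩ : Nonempty Ω := P.nonempty_of_neZero
  have hK0 : 0 ≤ K := (abs_nonneg _).trans (hK 0 hΩ.some)
  set bad : ℕ → Set Ω :=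
    fun N => {ω | ∀ n : ℕ, 1 ≤ n → n ≤ N → ∫ s in (0 : ℝ)..n, F s ω < c * n} with hbad
  have hbadm : ∀ N, MeasurableSet (bad N) := by
    intro N
    have : bad N = ⋂ n : ℕ, ⋂ _ : 1 ≤ n, ⋂ _ : n ≤ N,
        {ω | ∫ s in (0 : ℝ)..n, F s ω < c * n} := by ext; simp [hbad]
    rw [this]
    exact MeasurableSet.iInter fun n => MeasurableSet.iInter fun _ => MeasurableSet.iInter fun _ =>
      measurableSet_lt (hF.measurable_integral 0 n) measurable_const
  have hlim : Tendsto (fun N => P.real (bad N)) atTop (𝓝 0) := by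
    have h0 : P (⋂ N, bad N) = 0 := by
      refine measure_mono_null (fun ω hω => ?_) h
      simp only [mem_iInter, hbad] at hω
      rintro ⟨n, hn, hc⟩
      exact absurd (hω n n hn le_rfl) (not_lt.2 hc)
    have h1 := tendsto_measure_iInter_atTop (μ := P) (s := bad)
      (fun N => (hbadm N).nullMeasurableSet)
      (fun i j hij ω hω n hn hni => hω n hn (hni.trans hij)) ⟨0, measure_ne_top _ _⟩
    rw [h0] at h1
    have := (ENNReal.tendsto_toReal ENNReal.zero_ne_top).comp h1
    simpa [Measure.real, Function.comp_def] using this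
  have hI : ∀ ω, -K ≤ ∫ s in (0 : ℝ)..1, F s ω := fun ω => by
    have := (abs_le.1 (IsBddMeas.abs_integral_le (fun x => hK x ω) 0 1)).1
    simpa using this
  have key : ∀ N : ℕ, c ≤ (∫ ω, F 0 ω ∂P) + (|c| + K) * P.real (bad N) := by
    intro N
    set b : Ω → ℝ := fun ω => (∫ s in (0 : ℝ)..1, F s ω) + (bad N).indicator (fun _ => |c| + K) ω
      with hb
    have hbm : Measurable b :=
      (hF.measurable_integral 0 1).add (measurable_const.indicator (hbadm N))
    have hind : ∀ ω, 0 ≤ (bad N).indicator (fun _ => |c| + K) ω := fun ω =>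
      indicator_nonneg (fun _ _ => by positivity) ω
    have hIi : Integrable (fun ω => ∫ s in (0 : ℝ)..1, F s ω) P :=
      Integrable.of_bound (C := K) (hF.measurable_integral 0 1).aestronglyMeasurable
        (Eventually.of_forall fun ω => by
          simpa using IsBddMeas.abs_integral_le (fun x => hK x ω) 0 1)
    have hindi : Integrable ((bad N).indicator (fun _ => |c| + K)) P :=
      (integrable_const _).indicator (hbadm N)
    have hbi : Integrable b P := hIi.add hindi
    have hbE : ∫ ω, b ω ∂P = (∫ ω, F 0 ω ∂P) + (|c| + K) * P.real (bad N) := by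
      simp only [hb]
      rw [integral_add hIi hindi, hF.integral_unit hτ, integral_indicator_const _ (hbadm N),
        smul_eq_mul, mul_comm]
    rw [← hbE]
    have hcomp : ∀ i : ℕ, Integrable (fun ω => b (τ i ω)) P ∧
        ∫ ω, b (τ i ω) ∂P = ∫ ω, b ω ∂P := by
      intro i
      have hp := hτ.measurePreserving i
      refine ⟨hp.integrable_comp_of_integrable hbi, ?_⟩
      rw [← integral_map hp.measurable.aemeasurable hbm.aestronglyMeasurable, hp.map_eq]
    have hsum : ∀ ω (n : ℕ), ∫ s in (0 : ℝ)..n, F s ω ≤ ∑ i ∈ Finset.range n, b (τ i ω) := by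
      intro ω n
      have h1 := intervalIntegral.sum_integral_adjacent_intervals (f := fun s => F s ω)
        (μ := volume) (a := fun k : ℕ => (k : ℝ)) (n := n)
        (fun k _ => (hF.isBddMeas ω).intervalIntegrable _ _)
      rw [Nat.cast_zero] at h1
      rw [← h1]
      refine Finset.sum_le_sum fun i _ => ?_
      have h2 := hF.integral_shift hτ 0 1 i ω
      simp only [hb]
      rw [h2, zero_add, Nat.cast_succ, add_comm (1 : ℝ)]
      linarith [hind (τ i ω)]
    have hpt : ∀ ω (L : ℕ), c * L - N.succ * (K + |c|) ≤ ∑ i ∈ Finset.range L, b (τ i ω) := by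
      intro ω L
      have := sum_ge_of_blocks (b := fun i : ℕ => b (τ i ω)) (c := c) (N := N.succ) hK0
        (fun i => by simp only [hb]; linarith [hI (τ i ω), hind (τ i ω)]) (fun j => ?_) L 0
      · simpa using this
      · have hsh : ∀ i : ℕ, τ ((j + i : ℕ) : ℝ) ω = τ i (τ j ω) := fun i => by
          rw [Nat.cast_add, add_comm, hτ.add]; rfl
        simp only [hsh]
        by_cases hbj : τ j ω ∈ bad N
        · refine ⟨1, le_rfl, by simp, ?_⟩
          simp only [hb, Finset.range_one, Finset.sum_singleton, Nat.cast_one, Nat.cast_zero,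
            hτ.zero, id, indicator_of_mem hbj]
          linarith [hI (τ j ω), le_abs_self c]
        · simp only [hbad, mem_ofPred_eq] at hbj
          push Not at hbj
          obtain ⟨n, hn1, hnN, hn⟩ := hbj
          exact ⟨n, hn1, by omega, hn.trans (hsum _ n)⟩
    have hL : ∀ L : ℕ, c * L - N.succ * (K + |c|) ≤ L * ∫ ω, b ω ∂P := by
      intro L
      have h1 := integral_mono (μ := P) (integrable_const _)
        (integrable_finsetSum (Finset.range L) fun i _ => (hcomp i).1) (fun ω => hpt ω L)
      rw [integral_finsetSum _ fun i _ => (hcomp i).1] at h1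
      simpa [(hcomp _).2] using h1
    by_contra! hlt
    obtain ⟨L, hLbig⟩ := exists_nat_gt (N.succ * (K + |c|) / (c - ∫ ω, b ω ∂P))
    rw [div_lt_iff₀ (by linarith)] at hLbig
    linarith [hL L]
  have := (hlim.const_mul (|c| + K)).const_add (∫ ω, F 0 ω ∂P)
  rw [mul_zero, add_zero] at this
  exact ge_of_tendsto' this key

theorem IsStationary.ae_eventually_le [IsProbabilityMeasure P] (hτ : IsErgodicFlow P τ)
    {F : ℝ → Ω → ℝ} (hF : IsStationary τ F) {c : ℝ} (hc : ∫ ω, F 0 ω ∂P < c) :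
    ∀ᵐ ω ∂P, ∀ᶠ n : ℕ in atTop, ∫ s in (0 : ℝ)..n, F s ω ≤ c * n := by
  obtain ⟨K, hK⟩ := hF.bdd
  set A : Set Ω :=
    {ω | ∀ k : ℕ, ∃ᶠ n : ℕ in atTop, (c - 1 / (k + 1)) * n < ∫ s in (0 : ℝ)..n, F s ω} with hA
  have hAm : MeasurableSet A := by
    have : A = ⋂ k : ℕ, ⋂ N : ℕ, ⋃ n : ℕ, ⋃ _ : N ≤ n,
        {ω | (c - 1 / (k + 1)) * n < ∫ s in (0 : ℝ)..n, F s ω} := by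
      ext; simp [hA, frequently_atTop]
    rw [this]
    exact MeasurableSet.iInter fun k => MeasurableSet.iInter fun N => MeasurableSet.iUnion fun n =>
      MeasurableSet.iUnion fun _ => measurableSet_lt measurable_const (hF.measurable_integral 0 n)
  have hsub : ∀ y ω, ω ∈ A → τ y ω ∈ A := by
    intro y ω hω k
    have hk : (1 : ℝ) / ((k + 1 : ℕ) + 1) < 1 / (k + 1) :=
      one_div_lt_one_div_of_lt (by positivity) (by push_cast; linarith)
    have hN : ∀ᶠ n : ℕ in atTop,
        2 * K * |y| / (1 / (k + 1) - 1 / ((k + 1 : ℕ) + 1) : ℝ) < n :=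
      tendsto_natCast_atTop_atTop.eventually_gt_atTop _
    refine ((hω (k + 1)).and_eventually hN).mono fun n hn => ?_
    obtain ⟨hn1, hn2⟩ := hn
    rw [div_lt_iff₀ (by linarith)] at hn2
    rw [hF.integral_shift hτ, zero_add]
    have hi := fun a b => (hF.isBddMeas ω).intervalIntegrable a b
    have e1 := intervalIntegral.integral_add_adjacent_intervals (hi 0 y) (hi y (n + y))
    have e2 := intervalIntegral.integral_add_adjacent_intervals (hi 0 n) (hi n (n + y))
    have b1 := (abs_le.1 (IsBddMeas.abs_integral_le (fun x => hK x ω) 0 y)).2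
    have b2 := (abs_le.1 (IsBddMeas.abs_integral_le (fun x => hK x ω) n (n + y))).1
    rw [sub_zero] at b1
    rw [add_sub_cancel_left] at b2
    linarith
  have hinv : ∀ y, τ y ⁻¹' A = A := by
    intro y
    refine Subset.antisymm (fun ω hω => ?_) (fun ω hω => hsub y ω hω)
    have := hsub (-y) _ hω
    have e : τ (-y) (τ y ω) = ω := by
      have := congrFun (hτ.add (-y) y) ω
      rw [neg_add_cancel, hτ.zero] at this
      exact this.symm
    rwa [e] at this
  rcases hτ.ergodic A hAm hinv with h0 | h1
  · have : ∀ᵐ ω ∂P, ω ∉ A := measure_eq_zero_iff_ae_notMem.1 h0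
    filter_upwards [this] with ω hω
    simp only [hA, mem_ofPred_eq] at hω
    push Not at hω
    obtain ⟨k, hk⟩ := hω
    filter_upwards [hk] with n hn
    have : 0 ≤ 1 / ((k : ℝ) + 1) * n := by positivity
    linarith
  · exfalso
    have hae : ∀ᵐ ω ∂P, ω ∈ A := by
      rw [← prob_compl_eq_zero_iff hAm] at h1
      exact h1
    obtain ⟨k, hk⟩ := exists_nat_one_div_lt (sub_pos.2 hc)
    have := hF.le_mean_of_maximal hτ (c := c - 1 / (k + 1)) (by
      filter_upwards [hae] with ω hω
      obtain ⟨n, hn, hn1⟩ := ((hω k).and_eventually (eventually_ge_atTop 1)).exists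
      exact ⟨n, hn1, hn.le⟩)
    linarith

theorem IsStationary.ae_tendsto_atTop [IsProbabilityMeasure P] (hτ : IsErgodicFlow P τ)
    {F : ℝ → Ω → ℝ} (hF : IsStationary τ F) :
    ∀ᵐ ω ∂P, Tendsto (fun x => (∫ s in (0 : ℝ)..x, F s ω) / x) atTop (𝓝 (∫ ω, F 0 ω ∂P)) := by
  obtain ⟨K, hK⟩ := hF.bdd
  set E := ∫ ω, F 0 ω ∂P with hE
  have h1 : ∀ᵐ ω ∂P, ∀ k : ℕ, ∀ᶠ n : ℕ in atTop,
      ∫ s in (0 : ℝ)..n, F s ω ≤ (E + 1 / (k + 1)) * n :=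
    ae_all_iff.2 fun k => hF.ae_eventually_le hτ (by
      have : 0 < 1 / ((k : ℝ) + 1) := by positivity
      linarith)
  have h2 : ∀ᵐ ω ∂P, ∀ k : ℕ, ∀ᶠ n : ℕ in atTop,
      ∫ s in (0 : ℝ)..n, -F s ω ≤ (-E + 1 / (k + 1)) * n :=
    ae_all_iff.2 fun k => hF.neg.ae_eventually_le hτ (by
      have : 0 < 1 / ((k : ℝ) + 1) := by positivity
      rw [integral_neg]; linarith)
  filter_upwards [h1, h2] with ω hω1 hω2
  rw [Metric.tendsto_atTop']
  intro ε hε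
  obtain ⟨k, hk⟩ := exists_nat_one_div_lt (half_pos hε)
  obtain ⟨N, hN⟩ := eventually_atTop.1 ((hω1 k).and (hω2 k))
  have hK0 : 0 ≤ K := (abs_nonneg _).trans (hK 0 ω)
  refine ⟨max (N + 1) (2 * (K + |E| + 1) / ε), fun x hx => ?_⟩
  have hx1 : (N : ℝ) + 1 < x := (le_max_left _ _).trans_lt hx
  have hx2 : 2 * (K + |E| + 1) / ε < x := (le_max_right _ _).trans_lt hx
  have hx0 : 0 < x := by linarith [Nat.cast_nonneg (α := ℝ) N]
  rw [div_lt_iff₀ hε] at hx2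
  set n := ⌊x⌋₊ with hn
  have hn1 : (n : ℝ) ≤ x := Nat.floor_le hx0.le
  have hn2 : x < n + 1 := Nat.lt_floor_add_one x
  have hNn : N ≤ n := Nat.le_floor (by linarith)
  obtain ⟨g1, g2⟩ := hN n hNn
  rw [intervalIntegral.integral_neg] at g2
  have hi := fun a b => (hF.isBddMeas ω).intervalIntegrable a b
  have e := intervalIntegral.integral_add_adjacent_intervals (hi 0 n) (hi n x)
  have b1 := (IsBddMeas.abs_integral_le (fun x => hK x ω) n x)
  rw [abs_of_nonneg (by linarith : 0 ≤ x - n)] at b1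
  obtain ⟨b2, b3⟩ := abs_le.1 b1
  have b4 : K * (x - n) ≤ K := by nlinarith
  have hEx : |E| * (x - n) ≤ |E| := by nlinarith [abs_nonneg E]
  have hE1 := mul_le_mul_of_nonneg_right (le_abs_self E) (sub_nonneg.2 hn1)
  have hE2 := mul_le_mul_of_nonneg_right (neg_abs_le E) (sub_nonneg.2 hn1)
  have hkn : 1 / ((k : ℝ) + 1) * n ≤ ε / 2 * x :=
    mul_le_mul hk.le hn1 (by positivity) (by positivity)
  rw [Real.dist_eq, abs_lt]
  constructor
  · rw [lt_sub_iff_add_lt, lt_div_iff₀ hx0]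
    linarith
  · rw [sub_lt_iff_lt_add, div_lt_iff₀ hx0]
    linarith

theorem IsErgodicFlow.reverse (hτ : IsErgodicFlow P τ) : IsErgodicFlow P (fun x => τ (-x)) where
  measurePreserving x := hτ.measurePreserving (-x)
  zero := by rw [neg_zero]; exact hτ.zero
  add x y := by rw [neg_add]; exact hτ.add _ _
  ergodic A hA h := hτ.ergodic A hA fun x => by simpa using h (-x)

theorem IsStationary.ae_tendsto_atBot [IsProbabilityMeasure P] (hτ : IsErgodicFlow P τ)
    {F : ℝ → Ω → ℝ} (hF : IsStationary τ F) :
    ∀ᵐ ω ∂P, Tendsto (fun x => (∫ s in (0 : ℝ)..x, F s ω) / x) atBot (𝓝 (∫ ω, F 0 ω ∂P)) := by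
  have hF' : IsStationary (fun x => τ (-x)) (fun x ω => F (-x) ω) :=
    ⟨hF.meas.comp (measurable_fst.neg.prodMk measurable_snd), fun x ω => by
      rw [neg_zero]; exact hF.stat _ _, hF.bdd.imp fun K hK x ω => hK _ _⟩
  filter_upwards [hF'.ae_tendsto_atTop hτ.reverse] with ω hω
  have := hω.comp tendsto_neg_atBot_atTop
  rw [neg_zero] at this
  refine this.congr fun x => ?_
  simp only [Function.comp]
  rw [intervalIntegral.integral_comp_neg (fun s => F s ω), neg_neg, neg_zero,
    intervalIntegral.integral_symm, neg_div_neg_eq]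

end Ergodic

end HJ

namespace HJ

/-! ### The inverse branches of a double-well function -/

theorem continuous_of_strictMonoOn {G r : ℝ → ℝ} {s : Set ℝ} [hs : OrdConnected s]
    (hG : StrictMonoOn G s) (hr : ∀ x, r x ∈ s) (hGr : Monotone fun x => G (r x))
    (hsurj : ∀ p ∈ s, ∃ x, r x = p) : Continuous r := by
  have hmono : Monotone (fun x => (⟨r x, hr x⟩ : s)) := fun x y hxy =>
    Subtype.mk_le_mk.2 ((hG.le_iff_le (hr x) (hr y)).1 (hGr hxy))
  have := hmono.continuous_of_surjective fun p => (hsurj p.1 p.2).imp fun x hx => Subtype.ext hx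
  exact continuous_subtype_val.comp this

theorem continuous_of_strictAntiOn {G r : ℝ → ℝ} {s : Set ℝ} [hs : OrdConnected s]
    (hG : StrictAntiOn G s) (hr : ∀ x, r x ∈ s) (hGr : Monotone fun x => G (r x))
    (hsurj : ∀ p ∈ s, ∃ x, r x = p) : Continuous r := by
  have h := continuous_of_strictMonoOn (G := fun p => -G p) (r := fun x => r (-x)) (s := s)
    (fun x hx y hy hxy => neg_lt_neg (hG hx hy hxy)) (fun x => hr _)
    (fun x y hxy => neg_le_neg (hGr (neg_le_neg hxy)))
    (fun p hp => by
      obtain ⟨x, hx⟩ := hsurj p hp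
      exact ⟨-x, by simpa using hx⟩)
  have := h.comp continuous_neg
  simpa [Function.comp_def] using this

/-- The inverse of `G` on `(-∞, pm]`, extended by a constant. -/
noncomputable def br₁ (G : ℝ → ℝ) (m pm s : ℝ) : ℝ := Function.invFunOn G (Iic pm) (max s m)

/-- The inverse of `G` on `[pm, pM]`, extended by constants. -/
noncomputable def br₂ (G : ℝ → ℝ) (m M pm pM s : ℝ) : ℝ :=
  Function.invFunOn G (Icc pm pM) (min (max s m) M)

/-- The inverse of `G` on `[pM, 0]`, extended by constants. -/
noncomputable def br₃ (G : ℝ → ℝ) (M pM s : ℝ) : ℝ :=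
  Function.invFunOn G (Icc pM 0) (min (max s 0) M)

/-- The inverse of `G` on `[0, ∞)`, extended by a constant. -/
noncomputable def br₄ (G : ℝ → ℝ) (s : ℝ) : ℝ := Function.invFunOn G (Ici 0) (max s 0)

namespace IsDoubleWell

variable {G : ℝ → ℝ} {m M pm pM : ℝ} (hG : IsDoubleWell G m M pm pM)
include hG

theorem M_pos : 0 < M := hG.m_nonneg.trans_lt hG.m_lt_M

theorem surj₁ {y : ℝ} (hy : m ≤ y) : ∃ p ∈ Iic pm, G p = y := by
  obtain ⟨L, hL1, hL2⟩ := ((hG.coercive.2.eventually_ge_atTop y).and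
    (eventually_le_atBot pm)).exists
  obtain ⟨p, hp, h⟩ := intermediate_value_Icc' hL2 hG.continuous.continuousOn
    (show y ∈ Icc (G pm) (G L) from ⟨by rw [hG.map_pm]; exact hy, hL1⟩)
  exact ⟨p, hp.2, h⟩

theorem surj₂ {y : ℝ} (hy : m ≤ y) (hy' : y ≤ M) : ∃ p ∈ Icc pm pM, G p = y :=
  intermediate_value_Icc hG.pm_lt_pM.le hG.continuous.continuousOn
    (show y ∈ Icc (G pm) (G pM) from ⟨by rwa [hG.map_pm], by rwa [hG.map_pM]⟩)

theorem surj₃ {y : ℝ} (hy : 0 ≤ y) (hy' : y ≤ M) : ∃ p ∈ Icc pM 0, G p = y :=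
  intermediate_value_Icc' hG.pM_neg.le hG.continuous.continuousOn
    (show y ∈ Icc (G 0) (G pM) from ⟨by rwa [hG.map_zero], by rwa [hG.map_pM]⟩)

theorem surj₄ {y : ℝ} (hy : 0 ≤ y) : ∃ p ∈ Ici 0, G p = y := by
  obtain ⟨L, hL1, hL2⟩ := ((hG.coercive.1.eventually_ge_atTop y).and
    (eventually_ge_atTop 0)).exists
  obtain ⟨p, hp, h⟩ := intermediate_value_Icc hL2 hG.continuous.continuousOn
    (show y ∈ Icc (G 0) (G L) from ⟨by rw [hG.map_zero]; exact hy, hL1⟩)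
  exact ⟨p, hp.1, h⟩

theorem clamp₂ (s : ℝ) : m ≤ min (max s m) M ∧ min (max s m) M ≤ M :=
  ⟨le_min (le_max_right _ _) hG.m_lt_M.le, min_le_right _ _⟩

theorem clamp₃ (s : ℝ) : 0 ≤ min (max s 0) M ∧ min (max s 0) M ≤ M :=
  ⟨le_min (le_max_right _ _) hG.M_pos.le, min_le_right _ _⟩

theorem br₁_mem (s : ℝ) : br₁ G m pm s ≤ pm :=
  Function.invFunOn_mem (hG.surj₁ (le_max_right s m))

theorem br₂_mem (s : ℝ) : br₂ G m M pm pM s ∈ Icc pm pM :=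
  Function.invFunOn_mem (hG.surj₂ (hG.clamp₂ s).1 (hG.clamp₂ s).2)

theorem br₃_mem (s : ℝ) : br₃ G M pM s ∈ Icc pM 0 :=
  Function.invFunOn_mem (hG.surj₃ (hG.clamp₃ s).1 (hG.clamp₃ s).2)

theorem br₄_mem (s : ℝ) : 0 ≤ br₄ G s :=
  Function.invFunOn_mem (hG.surj₄ (le_max_right s 0))

theorem map_br₁' (s : ℝ) : G (br₁ G m pm s) = max s m :=
  Function.invFunOn_eq (hG.surj₁ (le_max_right s m))

theorem map_br₂' (s : ℝ) : G (br₂ G m M pm pM s) = min (max s m) M :=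
  Function.invFunOn_eq (hG.surj₂ (hG.clamp₂ s).1 (hG.clamp₂ s).2)

theorem map_br₃' (s : ℝ) : G (br₃ G M pM s) = min (max s 0) M :=
  Function.invFunOn_eq (hG.surj₃ (hG.clamp₃ s).1 (hG.clamp₃ s).2)

theorem map_br₄' (s : ℝ) : G (br₄ G s) = max s 0 :=
  Function.invFunOn_eq (hG.surj₄ (le_max_right s 0))

theorem map_br₁ {s : ℝ} (hs : m ≤ s) : G (br₁ G m pm s) = s := by
  rw [hG.map_br₁', max_eq_left hs]

theorem map_br₂ {s : ℝ} (hs : m ≤ s) (hs' : s ≤ M) : G (br₂ G m M pm pM s) = s := by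
  rw [hG.map_br₂', max_eq_left hs, min_eq_left hs']

theorem map_br₃ {s : ℝ} (hs : 0 ≤ s) (hs' : s ≤ M) : G (br₃ G M pM s) = s := by
  rw [hG.map_br₃', max_eq_left hs, min_eq_left hs']

theorem map_br₄ {s : ℝ} (hs : 0 ≤ s) : G (br₄ G s) = s := by
  rw [hG.map_br₄', max_eq_left hs]

theorem continuous_br₁ : Continuous (br₁ G m pm) := by
  refine continuous_of_strictAntiOn hG.anti₁ hG.br₁_mem ?_ fun p hp => ⟨G p, ?_⟩
  · simp only [hG.map_br₁']
    exact fun x y h => max_le_max_right _ h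
  · have hp' : m ≤ G p := hG.map_pm ▸ hG.anti₁.antitoneOn hp self_mem_Iic hp
    exact hG.anti₁.injOn (hG.br₁_mem _) hp (hG.map_br₁ hp')

theorem continuous_br₂ : Continuous (br₂ G m M pm pM) := by
  refine continuous_of_strictMonoOn hG.mono₂ hG.br₂_mem ?_ fun p hp => ⟨G p, ?_⟩
  · simp only [hG.map_br₂']
    exact fun x y h => min_le_min_right _ (max_le_max_right _ h)
  · have h1 : m ≤ G p := hG.map_pm ▸
      hG.mono₂.monotoneOn (left_mem_Icc.2 hG.pm_lt_pM.le) hp hp.1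
    have h2 : G p ≤ M := hG.map_pM ▸
      hG.mono₂.monotoneOn hp (right_mem_Icc.2 hG.pm_lt_pM.le) hp.2
    exact hG.mono₂.injOn (hG.br₂_mem _) hp (hG.map_br₂ h1 h2)

theorem continuous_br₃ : Continuous (br₃ G M pM) := by
  refine continuous_of_strictAntiOn hG.anti₃ hG.br₃_mem ?_ fun p hp => ⟨G p, ?_⟩
  · simp only [hG.map_br₃']
    exact fun x y h => min_le_min_right _ (max_le_max_right _ h)
  · have h1 : 0 ≤ G p := hG.map_zero ▸
      hG.anti₃.antitoneOn hp (right_mem_Icc.2 hG.pM_neg.le) hp.2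
    have h2 : G p ≤ M := hG.map_pM ▸
      hG.anti₃.antitoneOn (left_mem_Icc.2 hG.pM_neg.le) hp hp.1
    exact hG.anti₃.injOn (hG.br₃_mem _) hp (hG.map_br₃ h1 h2)

theorem continuous_br₄ : Continuous (br₄ G) := by
  refine continuous_of_strictMonoOn hG.mono₄ hG.br₄_mem ?_ fun p hp => ⟨G p, ?_⟩
  · simp only [hG.map_br₄']
    exact fun x y h => max_le_max_right _ h
  · have hp' : 0 ≤ G p := hG.map_zero ▸ hG.mono₄.monotoneOn self_mem_Ici hp hp
    exact hG.mono₄.injOn (hG.br₄_mem _) hp (hG.map_br₄ hp')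

theorem antitone_br₁ : Antitone (br₁ G m pm) := fun x y h =>
  (hG.anti₁.le_iff_ge (hG.br₁_mem _) (hG.br₁_mem _)).1 (by
    rw [hG.map_br₁', hG.map_br₁']; exact max_le_max_right _ h)

theorem antitone_br₃ : Antitone (br₃ G M pM) := fun x y h =>
  (hG.anti₃.le_iff_ge (hG.br₃_mem _) (hG.br₃_mem _)).1 (by
    rw [hG.map_br₃', hG.map_br₃']; exact min_le_min_right _ (max_le_max_right _ h))

theorem monotone_br₄ : Monotone (br₄ G) := fun x y h =>
  (hG.mono₄.le_iff_le (hG.br₄_mem _) (hG.br₄_mem _)).1 (by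
    rw [hG.map_br₄', hG.map_br₄']; exact max_le_max_right _ h)

theorem br₁_lt_br₃ (s s' : ℝ) : br₁ G m pm s < br₃ G M pM s' :=
  ((hG.br₁_mem s).trans_lt hG.pm_lt_pM).trans_le (hG.br₃_mem s').1

theorem br₃_le_br₄ (s s' : ℝ) : br₃ G M pM s ≤ br₄ G s' := (hG.br₃_mem s).2.trans (hG.br₄_mem s')

theorem m_le_of_le_pM {q : ℝ} (hq : q ≤ pM) : m ≤ G q := by
  rcases le_total q pm with h | h
  · exact hG.map_pm ▸ hG.anti₁.antitoneOn h self_mem_Iic h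
  · exact hG.map_pm ▸ hG.mono₂.monotoneOn (left_mem_Icc.2 hG.pm_lt_pM.le) ⟨h, hq⟩ h

theorem nonneg (q : ℝ) : 0 ≤ G q := by
  rcases le_total q pM with h | h
  · exact hG.m_nonneg.trans (hG.m_le_of_le_pM h)
  rcases le_total q 0 with h' | h'
  · exact hG.map_zero ▸ hG.anti₃.antitoneOn ⟨h, h'⟩ (right_mem_Icc.2 hG.pM_neg.le) h'
  · exact hG.map_zero ▸ hG.mono₄.monotoneOn self_mem_Ici h' h'

theorem le_of_br₁_le {q s : ℝ} (hs : m ≤ s) (h : br₁ G m pm s ≤ q) (hq : q ≤ pm) : G q ≤ s :=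
  hG.map_br₁ hs ▸ hG.anti₁.antitoneOn (hG.br₁_mem s) hq h

theorem le_of_le_br₄ {q s : ℝ} (hs : 0 ≤ s) (h : q ≤ br₄ G s) (hq : 0 ≤ q) : G q ≤ s :=
  hG.map_br₄ hs ▸ hG.mono₄.monotoneOn hq (hG.br₄_mem s) h

theorem le_of_mem_br₁_br₄ {q s : ℝ} (hs : M ≤ s) (h1 : br₁ G m pm s ≤ q) (h4 : q ≤ br₄ G s) :
    G q ≤ s := by
  rcases le_total q pm with h | h
  · exact hG.le_of_br₁_le (hG.m_lt_M.le.trans hs) h1 h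
  rcases le_total q pM with h' | h'
  · exact (hG.map_pM ▸ hG.mono₂.monotoneOn ⟨h, h'⟩ (right_mem_Icc.2 hG.pm_lt_pM.le) h').trans hs
  rcases le_total q 0 with h'' | h''
  · exact (hG.map_pM ▸ hG.anti₃.antitoneOn (left_mem_Icc.2 hG.pM_neg.le) ⟨h', h''⟩ h').trans hs
  · exact hG.le_of_le_br₄ (hG.M_pos.le.trans hs) h4 h''

theorem le_of_mem_br₃_br₄ {q s : ℝ} (hs : 0 ≤ s) (hs' : s ≤ M) (h1 : br₃ G M pM s ≤ q)
    (h4 : q ≤ br₄ G s) : G q ≤ s := by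
  rcases le_total q 0 with h | h
  · exact hG.map_br₃ hs hs' ▸
      hG.anti₃.antitoneOn (hG.br₃_mem s) ⟨(hG.br₃_mem s).1.trans h1, h⟩ h1
  · exact hG.le_of_le_br₄ hs h4 h

theorem le_of_mem_br₁_br₂ {q s : ℝ} (hs : m ≤ s) (hs' : s ≤ M) (h1 : br₁ G m pm s ≤ q)
    (h4 : q ≤ br₂ G m M pm pM s) : G q ≤ s := by
  rcases le_total q pm with h | h
  · exact hG.le_of_br₁_le hs h1 h
  · exact hG.map_br₂ hs hs' ▸
      hG.mono₂.monotoneOn ⟨h, h4.trans (hG.br₂_mem s).2⟩ (hG.br₂_mem s) h4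

theorem ge_of_mem_br₂_br₃ {q s : ℝ} (hs : m ≤ s) (hs' : s ≤ M) (h1 : br₂ G m M pm pM s ≤ q)
    (h4 : q ≤ br₃ G M pM s) : s ≤ G q := by
  rcases le_total q pM with h | h
  · exact (hG.map_br₂ hs hs').symm.trans_le
      (hG.mono₂.monotoneOn (hG.br₂_mem s) ⟨(hG.br₂_mem s).1.trans h1, h⟩ h1)
  · exact (hG.map_br₃ (hG.m_nonneg.trans hs) hs').symm.trans_le
      (hG.anti₃.antitoneOn ⟨h, h4.trans (hG.br₃_mem s).2⟩ (hG.br₃_mem s) h4)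

theorem ge_of_le_br₁ {q s : ℝ} (hs : m ≤ s) (h : q ≤ br₁ G m pm s) : s ≤ G q :=
  (hG.map_br₁ hs).symm.trans_le
    (hG.anti₁.antitoneOn (h.trans (hG.br₁_mem s)) (hG.br₁_mem s) h)

theorem ge_of_br₄_le {q s : ℝ} (hs : 0 ≤ s) (h : br₄ G s ≤ q) : s ≤ G q :=
  (hG.map_br₄ hs).symm.trans_le
    (hG.mono₄.monotoneOn (hG.br₄_mem s) ((hG.br₄_mem s).trans h) h)

theorem ge_of_le_br₃ {q s : ℝ} (hs : 0 ≤ s) (hs' : s ≤ m) (h : q ≤ br₃ G M pM s) : s ≤ G q := by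
  rcases le_total q pM with h' | h'
  · exact hs'.trans (hG.m_le_of_le_pM h')
  · exact (hG.map_br₃ hs (hs'.trans hG.m_lt_M.le)).symm.trans_le
      (hG.anti₃.antitoneOn ⟨h', h.trans (hG.br₃_mem s).2⟩ (hG.br₃_mem s) h)

theorem exists_large (θ lam : ℝ) : ∃ c, |θ| ≤ c ∧ lam ≤ G c ∧ lam ≤ G (-c) := by
  have h2 := hG.coercive.2.comp tendsto_neg_atTop_atBot
  obtain ⟨c, h⟩ := ((eventually_ge_atTop |θ|).and ((hG.coercive.1.eventually_ge_atTop lam).and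
    (h2.eventually_ge_atTop lam))).exists
  exact ⟨c, h.1, h.2.1, h.2.2⟩

end IsDoubleWell

end HJ

namespace HJ

/-! ### Gluing slopes -/

/-- The function equal to `pL` to the left of `x₀` and to `pR` to the right. -/
noncomputable def glue (x₀ : ℝ) (pL pR : ℝ → ℝ) (x : ℝ) : ℝ := if x < x₀ then pL x else pR x

section Glue

variable {x₀ : ℝ} {pL pR : ℝ → ℝ}

theorem glue_eq_left {x : ℝ} (h : x < x₀) : glue x₀ pL pR x = pL x := if_pos h

theorem glue_eq_right {x : ℝ} (h : x₀ ≤ x) : glue x₀ pL pR x = pR x := if_neg h.not_gt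

theorem IsBddMeas.glue (hL : IsBddMeas pL) (hR : IsBddMeas pR) : IsBddMeas (glue x₀ pL pR) := by
  refine ⟨hL.meas.ite measurableSet_Iio hR.meas, ?_⟩
  obtain ⟨K, hK⟩ := hL.bdd
  obtain ⟨K', hK'⟩ := hR.bdd
  refine ⟨max K K', fun x => ?_⟩
  simp only [HJ.glue]
  split_ifs
  · exact (hK x).trans (le_max_left _ _)
  · exact (hK' x).trans (le_max_right _ _)

theorem glue_tendsto_left {x a : ℝ} (hx : x ≤ x₀) (h : Tendsto pL (𝓝[<] x) (𝓝 a)) :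
    Tendsto (glue x₀ pL pR) (𝓝[<] x) (𝓝 a) :=
  h.congr' (by
    filter_upwards [self_mem_nhdsWithin] with y hy
    exact (glue_eq_left (lt_of_lt_of_le hy hx)).symm)

theorem glue_tendsto_right {x b : ℝ} (hx : x₀ ≤ x) (h : Tendsto pR (𝓝[>] x) (𝓝 b)) :
    Tendsto (glue x₀ pL pR) (𝓝[>] x) (𝓝 b) :=
  h.congr' (by
    filter_upwards [self_mem_nhdsWithin] with y hy
    exact (glue_eq_right (hx.trans (le_of_lt hy))).symm)

theorem glue_tendsto_left' {x a : ℝ} (hx : x₀ < x) (h : Tendsto pR (𝓝[<] x) (𝓝 a)) :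
    Tendsto (glue x₀ pL pR) (𝓝[<] x) (𝓝 a) :=
  h.congr' (by
    filter_upwards [(lt_mem_nhds hx).filter_mono nhdsWithin_le_nhds] with y hy
    exact (glue_eq_right hy.le).symm)

theorem glue_tendsto_right' {x b : ℝ} (hx : x < x₀) (h : Tendsto pL (𝓝[>] x) (𝓝 b)) :
    Tendsto (glue x₀ pL pR) (𝓝[>] x) (𝓝 b) :=
  h.congr' (by
    filter_upwards [(gt_mem_nhds hx).filter_mono nhdsWithin_le_nhds] with y hy
    exact (glue_eq_left hy).symm)

theorem tendsto_mean_of_eventually {p q : ℝ → ℝ} {l : Filter ℝ} {μ C : ℝ}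
    (hl : Tendsto (fun x : ℝ => C / x) l (𝓝 0))
    (hp : Tendsto (fun x => (∫ s in (0 : ℝ)..x, p s) / x) l (𝓝 μ))
    (h : ∀ᶠ x in l, ∫ s in (0 : ℝ)..x, q s = C + ∫ s in (0 : ℝ)..x, p s) :
    Tendsto (fun x => (∫ s in (0 : ℝ)..x, q s) / x) l (𝓝 μ) := by
  have := hl.add hp
  rw [zero_add] at this
  refine this.congr' ?_
  filter_upwards [h] with x hx
  rw [hx, add_div]

theorem glue_mean_top (hL : IsBddMeas pL) (hR : IsBddMeas pR) {μ : ℝ}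
    (h : Tendsto (fun x => (∫ s in (0 : ℝ)..x, pR s) / x) atTop (𝓝 μ)) :
    Tendsto (fun x => (∫ s in (0 : ℝ)..x, glue x₀ pL pR s) / x) atTop (𝓝 μ) := by
  have hg : IsBddMeas (glue x₀ pL pR) := hL.glue hR
  refine tendsto_mean_of_eventually
    (C := (∫ s in (0 : ℝ)..x₀, glue x₀ pL pR s) - ∫ s in (0 : ℝ)..x₀, pR s)
    (tendsto_const_nhds.div_atTop tendsto_id) h ?_
  filter_upwards [eventually_ge_atTop x₀] with x hx
  have e1 := intervalIntegral.integral_add_adjacent_intervals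
    (hg.intervalIntegrable 0 x₀) (hg.intervalIntegrable x₀ x)
  have e2 := intervalIntegral.integral_add_adjacent_intervals
    (hR.intervalIntegrable 0 x₀) (hR.intervalIntegrable x₀ x)
  have e3 : ∫ s in x₀..x, glue x₀ pL pR s = ∫ s in x₀..x, pR s := by
    refine intervalIntegral.integral_congr fun s hs => ?_
    rw [uIcc_of_le hx] at hs
    exact glue_eq_right hs.1
  linarith

theorem glue_mean_bot (hL : IsBddMeas pL) (hR : IsBddMeas pR) {μ : ℝ}
    (h : Tendsto (fun x => (∫ s in (0 : ℝ)..x, pL s) / x) atBot (𝓝 μ)) :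
    Tendsto (fun x => (∫ s in (0 : ℝ)..x, glue x₀ pL pR s) / x) atBot (𝓝 μ) := by
  have hg : IsBddMeas (glue x₀ pL pR) := hL.glue hR
  refine tendsto_mean_of_eventually
    (C := (∫ s in (0 : ℝ)..x₀, glue x₀ pL pR s) - ∫ s in (0 : ℝ)..x₀, pL s)
    (tendsto_const_nhds.div_atBot tendsto_id) h ?_
  filter_upwards [eventually_le_atBot x₀] with x hx
  have e1 := intervalIntegral.integral_add_adjacent_intervals
    (hg.intervalIntegrable 0 x₀) (hg.intervalIntegrable x₀ x)
  have e2 := intervalIntegral.integral_add_adjacent_intervals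
    (hL.intervalIntegrable 0 x₀) (hL.intervalIntegrable x₀ x)
  have e3 : ∫ s in x₀..x, glue x₀ pL pR s = ∫ s in x₀..x, pL s := by
    refine intervalIntegral.integral_congr_ae ?_
    have : ∀ᵐ s : ℝ, s ≠ x₀ := by simp [ae_iff]
    filter_upwards [this] with s hs hs'
    rw [uIoc_of_ge hx] at hs'
    exact glue_eq_left (lt_of_le_of_ne hs'.2 hs)
  linarith

theorem SubAt.of_glue {g f : ℝ → ℝ} {θ lam a b μL μR : ℝ} (hL : IsBddMeas pL) (hR : IsBddMeas pR)
    (hsL : IsSubSlope g f lam pL) (hsR : IsSubSlope g f lam pR)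
    (ha : Tendsto pL (𝓝[<] x₀) (𝓝 a)) (hb : Tendsto pR (𝓝[>] x₀) (𝓝 b))
    (hq : ∀ q, b ≤ q → q ≤ a → g q + f x₀ ≤ lam) (hθL : θ ≤ μL) (hθR : μR ≤ θ)
    (hμL : Tendsto (fun x => (∫ s in (0 : ℝ)..x, pL s) / x) atBot (𝓝 μL))
    (hμR : Tendsto (fun x => (∫ s in (0 : ℝ)..x, pR s) / x) atTop (𝓝 μR)) : SubAt g f θ lam := by
  refine ⟨glue x₀ pL pR, hL.glue hR, fun x => ?_, μL, μR, hθL, hθR, glue_mean_bot hL hR hμL,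
    glue_mean_top hL hR hμR⟩
  rcases lt_trichotomy x x₀ with h | rfl | h
  · obtain ⟨a, b, ha, hb, hq⟩ := hsL x
    exact ⟨a, b, glue_tendsto_left h.le ha, glue_tendsto_right' h hb, hq⟩
  · exact ⟨a, b, glue_tendsto_left le_rfl ha, glue_tendsto_right le_rfl hb, hq⟩
  · obtain ⟨a, b, ha, hb, hq⟩ := hsR x
    exact ⟨a, b, glue_tendsto_left' h ha, glue_tendsto_right h.le hb, hq⟩

theorem SuperAt.of_glue {g f : ℝ → ℝ} {θ lam a b μL μR : ℝ} (hL : IsBddMeas pL)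
    (hR : IsBddMeas pR) (hsL : IsSuperSlope g f lam pL) (hsR : IsSuperSlope g f lam pR)
    (ha : Tendsto pL (𝓝[<] x₀) (𝓝 a)) (hb : Tendsto pR (𝓝[>] x₀) (𝓝 b))
    (hq : ∀ q, a ≤ q → q ≤ b → lam ≤ g q + f x₀) (hθL : μL ≤ θ) (hθR : θ ≤ μR)
    (hμL : Tendsto (fun x => (∫ s in (0 : ℝ)..x, pL s) / x) atBot (𝓝 μL))
    (hμR : Tendsto (fun x => (∫ s in (0 : ℝ)..x, pR s) / x) atTop (𝓝 μR)) : SuperAt g f θ lam := by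
  refine ⟨glue x₀ pL pR, hL.glue hR, fun x => ?_, μL, μR, hθL, hθR, glue_mean_bot hL hR hμL,
    glue_mean_top hL hR hμR⟩
  rcases lt_trichotomy x x₀ with h | rfl | h
  · obtain ⟨a, b, ha, hb, hq⟩ := hsL x
    exact ⟨a, b, glue_tendsto_left h.le ha, glue_tendsto_right' h hb, hq⟩
  · exact ⟨a, b, glue_tendsto_left le_rfl ha, glue_tendsto_right le_rfl hb, hq⟩
  · obtain ⟨a, b, ha, hb, hq⟩ := hsR x
    exact ⟨a, b, glue_tendsto_left' h ha, glue_tendsto_right h.le hb, hq⟩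

end Glue

theorem IsSubSlope.of_continuous {g f p : ℝ → ℝ} {lam : ℝ} (hp : Continuous p)
    (h : ∀ x, g (p x) + f x ≤ lam) : IsSubSlope g f lam p := fun x =>
  ⟨p x, p x, hp.continuousWithinAt, hp.continuousWithinAt, fun q h1 h2 => by
    rw [le_antisymm h2 h1]; exact h x⟩

theorem IsSuperSlope.of_continuous {g f p : ℝ → ℝ} {lam : ℝ} (hp : Continuous p)
    (h : ∀ x, lam ≤ g (p x) + f x) : IsSuperSlope g f lam p := fun x =>
  ⟨p x, p x, hp.continuousWithinAt, hp.continuousWithinAt, fun q h1 h2 => by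
    rw [le_antisymm h2 h1]; exact h x⟩

/-- `p` is bounded and has mean `μ` at both ends. -/
structure HasMean (p : ℝ → ℝ) (μ : ℝ) : Prop extends IsBddMeas p where
  bot : Tendsto (fun x => (∫ s in (0 : ℝ)..x, p s) / x) atBot (𝓝 μ)
  top : Tendsto (fun x => (∫ s in (0 : ℝ)..x, p s) / x) atTop (𝓝 μ)

theorem hasMean_const (c : ℝ) : HasMean (fun _ => c) c where
  meas := measurable_const
  bdd := ⟨|c|, fun _ => le_rfl⟩
  bot := by
    refine tendsto_const_nhds.congr' ?_
    filter_upwards [eventually_lt_atBot 0] with x hx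
    rw [intervalIntegral.integral_const, sub_zero, smul_eq_mul, mul_div_cancel_left₀ _ hx.ne]
  top := by
    refine tendsto_const_nhds.congr' ?_
    filter_upwards [eventually_gt_atTop 0] with x hx
    rw [intervalIntegral.integral_const, sub_zero, smul_eq_mul, mul_div_cancel_left₀ _ hx.ne']

/-! ### The hysteresis process -/

/-- Since its last visit to `[b, ∞)`, the function `f` has visited `(-∞, a]`. -/
def LowState (a b : ℝ) (f : ℝ → ℝ) (x : ℝ) : Prop :=
  ∃ y ≤ x, f y ≤ a ∧ ∀ z ∈ Icc y x, f z < b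

section LowState

variable {a b : ℝ} {f : ℝ → ℝ} {x : ℝ}

theorem LowState.lt (h : LowState a b f x) : f x < b := by
  obtain ⟨y, hy, -, h⟩ := h
  exact h x ⟨hy, le_rfl⟩

theorem LowState.mono {a' b' : ℝ} (h : LowState a b f x) (ha : a ≤ a') (hb : b ≤ b') :
    LowState a' b' f x := by
  obtain ⟨y, hy, h1, h2⟩ := h
  exact ⟨y, hy, h1.trans ha, fun z hz => (h2 z hz).trans_le hb⟩

theorem LowState.extend {x' : ℝ} (h : LowState a b f x) (hx : x ≤ x')
    (hf : ∀ z ∈ Icc x x', f z < b) : LowState a b f x' := by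
  obtain ⟨y, hy, h1, h2⟩ := h
  refine ⟨y, hy.trans hx, h1, fun z hz => ?_⟩
  rcases le_total z x with h | h
  · exact h2 z ⟨hz.1, h⟩
  · exact hf z ⟨h, hz.2⟩

theorem lowState_of_le (hab : a < b) (h : f x ≤ a) : LowState a b f x :=
  ⟨x, le_rfl, h, fun z hz => by
    rw [le_antisymm hz.2 hz.1]; exact h.trans_lt hab⟩

theorem LowState.eventually_right (hf : Continuous f) (h : LowState a b f x) :
    ∀ᶠ y in 𝓝[>] x, LowState a b f y := by
  obtain ⟨r, hr, hball⟩ := Metric.eventually_nhds_iff_ball.1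
    (hf.continuousAt.eventually (gt_mem_nhds h.lt))
  filter_upwards [Ioo_mem_nhdsGT (show x < x + r by linarith)] with y hy
  refine h.extend hy.1.le fun z hz => hball z ?_
  rw [Metric.mem_ball, Real.dist_eq, abs_of_nonneg] <;> linarith [hz.1, hz.2, hy.2]

theorem eventually_right_not_lowState (hf : Continuous f) (hab : a < b)
    (h : ¬LowState a b f x) : ∀ᶠ y in 𝓝[>] x, ¬LowState a b f y := by
  have hx : a < f x := not_le.1 fun hle => h (lowState_of_le hab hle)
  obtain ⟨r, hr, hball⟩ := Metric.eventually_nhds_iff_ball.1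
    (hf.continuousAt.eventually (lt_mem_nhds hx))
  filter_upwards [Ioo_mem_nhdsGT (show x < x + r by linarith)] with y hy
  rintro ⟨y', hy', h1, h2⟩
  rcases le_or_gt y' x with hle | hlt
  · exact h ⟨y', hle, h1, fun z hz => h2 z ⟨hz.1, hz.2.trans hy.1.le⟩⟩
  · refine absurd (hball y' ?_) h1.not_gt
    rw [Metric.mem_ball, Real.dist_eq, abs_of_nonneg] <;> linarith [hy.2]

theorem eventually_left_lowState_or (hf : Continuous f) (hab : a < b) (x : ℝ) :
    (∀ᶠ y in 𝓝[<] x, LowState a b f y) ∨ ∀ᶠ y in 𝓝[<] x, ¬LowState a b f y := by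
  rcases lt_or_ge (f x) b with hx | hx
  · obtain ⟨r, hr, hball⟩ := Metric.eventually_nhds_iff_ball.1
      (hf.continuousAt.eventually (gt_mem_nhds hx))
    by_cases h : ∃ y ∈ Ioo (x - r) x, LowState a b f y
    · obtain ⟨y, hy, hy1⟩ := h
      left
      filter_upwards [Ioo_mem_nhdsLT hy.2] with y' hy'
      refine hy1.extend hy'.1.le fun z hz => hball z ?_
      rw [Metric.mem_ball, Real.dist_eq, abs_of_nonpos] <;> linarith [hz.1, hz.2, hy'.2, hy.1]
    · push Not at h
      right
      filter_upwards [Ioo_mem_nhdsLT (show x - r < x by linarith)] with y hy using h y hy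
  · obtain ⟨r, hr, hball⟩ := Metric.eventually_nhds_iff_ball.1
      (hf.continuousAt.eventually (lt_mem_nhds (hab.trans_le hx)))
    by_cases h : ∃ᶠ y in 𝓝[<] x, LowState a b f y
    · left
      filter_upwards [Ioo_mem_nhdsLT (show x - r < x by linarith)] with y hy
      obtain ⟨y₂, ⟨w, hw, h1, h2⟩, hy₂⟩ := (h.and_eventually (Ioo_mem_nhdsLT hy.2)).exists
      refine ⟨w, ?_, h1, fun z hz => h2 z ⟨hz.1, hz.2.trans hy₂.1.le⟩⟩
      by_contra! hwy
      refine absurd (hball w ?_) h1.not_gt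
      rw [Metric.mem_ball, Real.dist_eq, abs_of_nonpos] <;> linarith [hy.1, hy₂.2]
    · exact Or.inr (not_frequently.1 h)

theorem lowState_of_eventually_left (hf : Continuous f) (hx : f x < b)
    (h : ∀ᶠ y in 𝓝[<] x, LowState a b f y) : LowState a b f x := by
  obtain ⟨r, hr, hball⟩ := Metric.eventually_nhds_iff_ball.1
    (hf.continuousAt.eventually (gt_mem_nhds hx))
  obtain ⟨y, hy, hy'⟩ := (h.and (Ioo_mem_nhdsLT (show x - r < x by linarith))).exists
  refine hy.extend hy'.2.le fun z hz => hball z ?_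
  rw [Metric.mem_ball, Real.dist_eq, abs_of_nonpos] <;> linarith [hz.1, hz.2, hy'.1]

theorem LowState.le_of_eventually_left (h : LowState a b f x)
    (hl : ∀ᶠ y in 𝓝[<] x, ¬LowState a b f y) : f x ≤ a := by
  obtain ⟨y, hy, h1, h2⟩ := h
  rcases hy.lt_or_eq with hlt | rfl
  · obtain ⟨z, hz, hz'⟩ := (hl.and (Ioo_mem_nhdsLT hlt)).exists
    exact absurd ⟨y, hz'.1.le, h1, fun w hw => h2 w ⟨hw.1, hw.2.trans hz'.2.le⟩⟩ hz
  · exact h1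

end LowState

open Classical in
/-- The slope that follows the third branch until `f` decreases to `lam - M`, then the first branch
until `f` increases to `lam - m`, and so on. -/
noncomputable def hyst (G : ℝ → ℝ) (m M pm pM : ℝ) (lam : ℝ) (f : ℝ → ℝ) (x : ℝ) : ℝ :=
  if LowState (lam - M) (lam - m) f x then br₁ G m pm (lam - f x) else br₃ G M pM (lam - f x)

section Path

variable {G : ℝ → ℝ} {m M pm pM : ℝ} (hG : IsDoubleWell G m M pm pM) {f : ℝ → ℝ}
  (hf : Continuous f) {lam : ℝ}
include hG hf

theorem tendsto_br₁ (x : ℝ) : Tendsto (fun y => br₁ G m pm (lam - f y)) (𝓝 x)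
    (𝓝 (br₁ G m pm (lam - f x))) :=
  (hG.continuous_br₁.comp (continuous_const.sub hf)).tendsto x

theorem tendsto_br₃ (x : ℝ) : Tendsto (fun y => br₃ G M pM (lam - f y)) (𝓝 x)
    (𝓝 (br₃ G M pM (lam - f x))) :=
  (hG.continuous_br₃.comp (continuous_const.sub hf)).tendsto x

theorem hyst_tendsto_right_of_not {x : ℝ} (h : ¬LowState (lam - M) (lam - m) f x) :
    Tendsto (hyst G m M pm pM lam f) (𝓝[>] x) (𝓝 (br₃ G M pM (lam - f x))) := by
  refine ((tendsto_br₃ hG hf x).mono_left nhdsWithin_le_nhds).congr' ?_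
  filter_upwards [eventually_right_not_lowState hf (by linarith [hG.m_lt_M]) h] with y hy
  exact (if_neg hy).symm

theorem hyst_limits (h0 : ∀ x, 0 ≤ lam - f x) (x : ℝ) :
    ∃ a b, Tendsto (hyst G m M pm pM lam f) (𝓝[<] x) (𝓝 a) ∧
      Tendsto (hyst G m M pm pM lam f) (𝓝[>] x) (𝓝 b) ∧
      ((a = b ∧ G a = lam - f x) ∨
        (a = br₃ G M pM (lam - f x) ∧ b = br₁ G m pm (lam - f x) ∧ M ≤ lam - f x) ∨
        (a = br₁ G m pm (lam - f x) ∧ b = br₃ G M pM (lam - f x) ∧ lam - f x ≤ m)) := by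
  have hab : lam - M < lam - m := by linarith [hG.m_lt_M]
  have hleft : ((∀ᶠ y in 𝓝[<] x, LowState (lam - M) (lam - m) f y) ∧
      Tendsto (hyst G m M pm pM lam f) (𝓝[<] x) (𝓝 (br₁ G m pm (lam - f x)))) ∨
      ((∀ᶠ y in 𝓝[<] x, ¬LowState (lam - M) (lam - m) f y) ∧
      Tendsto (hyst G m M pm pM lam f) (𝓝[<] x) (𝓝 (br₃ G M pM (lam - f x)))) := by
    rcases eventually_left_lowState_or hf hab x with h | h
    · refine Or.inl ⟨h, ((tendsto_br₁ hG hf x).mono_left nhdsWithin_le_nhds).congr' ?_⟩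
      filter_upwards [h] with y hy using (if_pos hy).symm
    · refine Or.inr ⟨h, ((tendsto_br₃ hG hf x).mono_left nhdsWithin_le_nhds).congr' ?_⟩
      filter_upwards [h] with y hy using (if_neg hy).symm
  by_cases hx : LowState (lam - M) (lam - m) f x
  · have hr : Tendsto (hyst G m M pm pM lam f) (𝓝[>] x) (𝓝 (br₁ G m pm (lam - f x))) := by
      refine ((tendsto_br₁ hG hf x).mono_left nhdsWithin_le_nhds).congr' ?_
      filter_upwards [hx.eventually_right hf] with y hy using (if_pos hy).symm
    rcases hleft with ⟨h, hl⟩ | ⟨h, hl⟩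
    · exact ⟨_, _, hl, hr, Or.inl ⟨rfl, hG.map_br₁ (by linarith [hx.lt])⟩⟩
    · exact ⟨_, _, hl, hr, Or.inr (Or.inl ⟨rfl, rfl, by linarith [hx.le_of_eventually_left h]⟩)⟩
  · have hr := hyst_tendsto_right_of_not hG hf hx
    rcases hleft with ⟨h, hl⟩ | ⟨h, hl⟩
    · refine ⟨_, _, hl, hr, Or.inr (Or.inr ⟨rfl, rfl, ?_⟩)⟩
      by_contra! hlt
      exact hx (lowState_of_eventually_left hf (by linarith) h)
    · refine ⟨_, _, hl, hr, Or.inl ⟨rfl, hG.map_br₃ (h0 x) ?_⟩⟩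
      by_contra! hlt
      exact hx (lowState_of_le hab (by linarith))

theorem isSubSlope_hyst (h0 : ∀ x, 0 ≤ lam - f x) :
    IsSubSlope G f lam (hyst G m M pm pM lam f) := fun x => by
  obtain ⟨a, b, ha, hb, h⟩ := hyst_limits hG hf h0 x
  refine ⟨a, b, ha, hb, fun q hq1 hq2 => ?_⟩
  rcases h with ⟨rfl, h⟩ | ⟨rfl, rfl, h⟩ | ⟨rfl, rfl, h⟩
  · rw [le_antisymm hq2 hq1, h]; linarith
  · linarith [hG.le_of_mem_br₁_br₄ h hq1 (hq2.trans (hG.br₃_le_br₄ _ _))]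
  · exact absurd (hq1.trans hq2) (hG.br₁_lt_br₃ _ _).not_ge

theorem isSuperSlope_hyst (h0 : ∀ x, 0 ≤ lam - f x) :
    IsSuperSlope G f lam (hyst G m M pm pM lam f) := fun x => by
  obtain ⟨a, b, ha, hb, h⟩ := hyst_limits hG hf h0 x
  refine ⟨a, b, ha, hb, fun q hq1 hq2 => ?_⟩
  rcases h with ⟨rfl, h⟩ | ⟨rfl, rfl, h⟩ | ⟨rfl, rfl, h⟩
  · rw [le_antisymm hq2 hq1, h]; linarith
  · exact absurd (hq1.trans hq2) (hG.br₁_lt_br₃ _ _).not_ge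
  · linarith [hG.ge_of_le_br₃ (h0 x) h hq2]

theorem br₄_slope (h0 : ∀ x, 0 ≤ lam - f x) :
    IsSubSlope G f lam (fun x => br₄ G (lam - f x)) ∧
      IsSuperSlope G f lam (fun x => br₄ G (lam - f x)) := by
  have hc := hG.continuous_br₄.comp (continuous_const (y := lam) |>.sub hf)
  have e : ∀ x, G (br₄ G (lam - f x)) + f x = lam := fun x => by rw [hG.map_br₄ (h0 x)]; ring
  exact ⟨.of_continuous hc fun x => (e x).le, .of_continuous hc fun x => (e x).ge⟩

theorem br₁_slope (h0 : ∀ x, m ≤ lam - f x) :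
    IsSubSlope G f lam (fun x => br₁ G m pm (lam - f x)) ∧
      IsSuperSlope G f lam (fun x => br₁ G m pm (lam - f x)) := by
  have hc := hG.continuous_br₁.comp (continuous_const (y := lam) |>.sub hf)
  have e : ∀ x, G (br₁ G m pm (lam - f x)) + f x = lam := fun x => by
    rw [hG.map_br₁ (h0 x)]; ring
  exact ⟨.of_continuous hc fun x => (e x).le, .of_continuous hc fun x => (e x).ge⟩

theorem br₂_slope (h0 : ∀ x, m ≤ lam - f x) (h1 : ∀ x, lam - f x ≤ M) :
    IsSubSlope G f lam (fun x => br₂ G m M pm pM (lam - f x)) ∧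
      IsSuperSlope G f lam (fun x => br₂ G m M pm pM (lam - f x)) := by
  have hc := hG.continuous_br₂.comp (continuous_const (y := lam) |>.sub hf)
  have e : ∀ x, G (br₂ G m M pm pM (lam - f x)) + f x = lam := fun x => by
    rw [hG.map_br₂ (h0 x) (h1 x)]; ring
  exact ⟨.of_continuous hc fun x => (e x).le, .of_continuous hc fun x => (e x).ge⟩

theorem br₃_slope (h0 : ∀ x, 0 ≤ lam - f x) (h1 : ∀ x, lam - f x ≤ M) :
    IsSubSlope G f lam (fun x => br₃ G M pM (lam - f x)) ∧
      IsSuperSlope G f lam (fun x => br₃ G M pM (lam - f x)) := by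
  have hc := hG.continuous_br₃.comp (continuous_const (y := lam) |>.sub hf)
  have e : ∀ x, G (br₃ G M pM (lam - f x)) + f x = lam := fun x => by
    rw [hG.map_br₃ (h0 x) (h1 x)]; ring
  exact ⟨.of_continuous hc fun x => (e x).le, .of_continuous hc fun x => (e x).ge⟩

variable {θ μ μ' β : ℝ}

/-! ### Sub- and supersolutions with prescribed slopes at both ends -/

theorem subAt_hyst (hfβ : ∀ x, f x ≤ β) (hhi : ∀ c < β, ∃ x, c < f x) (hβ : β ≤ lam)
    (hlam : lam < m + β) (h : HasMean (hyst G m M pm pM lam f) μ)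
    (h4 : HasMean (fun x => br₄ G (lam - f x)) μ') (hθ : μ ≤ θ) (hθ' : θ ≤ μ') :
    SubAt G f θ lam := by
  have h0 : ∀ x, 0 ≤ lam - f x := fun x => by linarith [hfβ x]
  obtain ⟨x₀, hx₀⟩ := hhi (lam - m) (by linarith)
  have hc := hG.continuous_br₄.comp (continuous_const (y := lam) |>.sub hf)
  refine SubAt.of_glue h4.toIsBddMeas h.toIsBddMeas (br₄_slope hG hf h0).1
    (isSubSlope_hyst hG hf h0) hc.continuousWithinAt
    (hyst_tendsto_right_of_not hG hf (x := x₀) fun hl => absurd hl.lt hx₀.not_gt)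
    (fun q hq1 hq2 => ?_) hθ' hθ h4.bot h.top
  linarith [hG.le_of_mem_br₃_br₄ (h0 x₀) (by linarith [hG.m_lt_M]) hq1 hq2]

theorem superAt_hyst (hf0 : ∀ x, 0 ≤ f x) (hfβ : ∀ x, f x ≤ β) (hhi : ∀ c < β, ∃ x, c < f x)
    (hβ : β ≤ lam) (hlam : lam < m + β) (h : HasMean (hyst G m M pm pM lam f) μ) (hθ : θ ≤ μ) :
    SuperAt G f θ lam := by
  have h0 : ∀ x, 0 ≤ lam - f x := fun x => by linarith [hfβ x]
  obtain ⟨x₀, hx₀⟩ := hhi (lam - m) (by linarith)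
  obtain ⟨c, hc1, -, hc3⟩ := hG.exists_large θ lam
  refine SuperAt.of_glue (hasMean_const (-c)).toIsBddMeas h.toIsBddMeas
    (.of_continuous continuous_const fun x => by linarith [hf0 x])
    (isSuperSlope_hyst hG hf h0) tendsto_const_nhds
    (hyst_tendsto_right_of_not hG hf (x := x₀) fun hl => absurd hl.lt hx₀.not_gt)
    (fun q hq1 hq2 => ?_) (by linarith [neg_abs_le θ]) hθ (hasMean_const (-c)).bot h.top
  linarith [hG.ge_of_le_br₃ (h0 x₀) (by linarith) hq2]

theorem subAt_four_one (hfβ : ∀ x, f x ≤ β) (hlo : ∀ c > 0, ∃ x, f x < c) (hM : M < lam)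
    (hlam : m + β ≤ lam) (h1 : HasMean (fun x => br₁ G m pm (lam - f x)) μ)
    (h4 : HasMean (fun x => br₄ G (lam - f x)) μ') (hθ : μ ≤ θ) (hθ' : θ ≤ μ') :
    SubAt G f θ lam := by
  have h0 : ∀ x, m ≤ lam - f x := fun x => by linarith [hfβ x]
  obtain ⟨x₀, hx₀⟩ := hlo (lam - M) (by linarith)
  have hc := hG.continuous_br₄.comp (continuous_const (y := lam) |>.sub hf)
  refine SubAt.of_glue (x₀ := x₀) h4.toIsBddMeas h1.toIsBddMeas
    (br₄_slope hG hf fun x => hG.m_nonneg.trans (h0 x)).1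
    (br₁_slope hG hf h0).1 hc.continuousWithinAt
    ((tendsto_br₁ hG hf x₀).mono_left nhdsWithin_le_nhds)
    (fun q hq1 hq2 => ?_) hθ' hθ h4.bot h1.top
  linarith [hG.le_of_mem_br₁_br₄ (by linarith) hq1 hq2]

theorem superAt_one (hf0 : ∀ x, 0 ≤ f x) (hfβ : ∀ x, f x ≤ β) (hlam : m + β ≤ lam)
    (h1 : HasMean (fun x => br₁ G m pm (lam - f x)) μ) (hθ : θ ≤ μ) : SuperAt G f θ lam := by
  have h0 : ∀ x, m ≤ lam - f x := fun x => by linarith [hfβ x]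
  obtain ⟨c, hc1, -, hc3⟩ := hG.exists_large θ lam
  refine SuperAt.of_glue (x₀ := 0) (hasMean_const (-c)).toIsBddMeas h1.toIsBddMeas
    (.of_continuous continuous_const fun x => by linarith [hf0 x])
    (br₁_slope hG hf h0).2 tendsto_const_nhds
    ((tendsto_br₁ hG hf 0).mono_left nhdsWithin_le_nhds)
    (fun q hq1 hq2 => ?_) (by linarith [neg_abs_le θ]) hθ (hasMean_const (-c)).bot h1.top
  linarith [hG.ge_of_le_br₁ (h0 0) hq2]

theorem superAt_four (hf0 : ∀ x, 0 ≤ f x) (hfβ : ∀ x, f x ≤ β) (hlam : β ≤ lam)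
    (h4 : HasMean (fun x => br₄ G (lam - f x)) μ) (hθ : μ ≤ θ) : SuperAt G f θ lam := by
  have h0 : ∀ x, 0 ≤ lam - f x := fun x => by linarith [hfβ x]
  obtain ⟨c, hc1, hc2, -⟩ := hG.exists_large θ lam
  have hc := hG.continuous_br₄.comp (continuous_const (y := lam) |>.sub hf)
  refine SuperAt.of_glue (x₀ := 0) h4.toIsBddMeas (hasMean_const c).toIsBddMeas
    (br₄_slope hG hf h0).2 (.of_continuous continuous_const fun x => by linarith [hf0 x])
    hc.continuousWithinAt tendsto_const_nhds
    (fun q hq1 hq2 => ?_) hθ (by linarith [le_abs_self θ]) h4.bot (hasMean_const c).top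
  have := hG.ge_of_br₄_le (h0 0) hq1
  linarith

theorem subAt_four_three (hf0 : ∀ x, 0 ≤ f x) (hfβ : ∀ x, f x ≤ β) (hβ : β ≤ lam) (hlam : lam ≤ M)
    (h3 : HasMean (fun x => br₃ G M pM (lam - f x)) μ)
    (h4 : HasMean (fun x => br₄ G (lam - f x)) μ') (hθ : μ ≤ θ) (hθ' : θ ≤ μ') :
    SubAt G f θ lam := by
  have h0 : ∀ x, 0 ≤ lam - f x := fun x => by linarith [hfβ x]
  have h1 : ∀ x, lam - f x ≤ M := fun x => by linarith [hf0 x]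
  have hc := hG.continuous_br₄.comp (continuous_const (y := lam) |>.sub hf)
  refine SubAt.of_glue (x₀ := 0) h4.toIsBddMeas h3.toIsBddMeas
    (br₄_slope hG hf h0).1 (br₃_slope hG hf h0 h1).1 hc.continuousWithinAt
    ((tendsto_br₃ hG hf 0).mono_left nhdsWithin_le_nhds)
    (fun q hq1 hq2 => ?_) hθ' hθ h4.bot h3.top
  have := hG.le_of_mem_br₃_br₄ (h0 0) (h1 0) hq1 hq2
  linarith

theorem subAt_two_one (hf0 : ∀ x, 0 ≤ f x) (hfβ : ∀ x, f x ≤ β) (hβ : m + β ≤ lam) (hlam : lam ≤ M)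
    (h1 : HasMean (fun x => br₁ G m pm (lam - f x)) μ)
    (h2 : HasMean (fun x => br₂ G m M pm pM (lam - f x)) μ') (hθ : μ ≤ θ) (hθ' : θ ≤ μ') :
    SubAt G f θ lam := by
  have h0 : ∀ x, m ≤ lam - f x := fun x => by linarith [hfβ x]
  have h0' : ∀ x, lam - f x ≤ M := fun x => by linarith [hf0 x]
  have hc := hG.continuous_br₂.comp (continuous_const (y := lam) |>.sub hf)
  refine SubAt.of_glue (x₀ := 0) h2.toIsBddMeas h1.toIsBddMeas
    (br₂_slope hG hf h0 h0').1 (br₁_slope hG hf h0).1 hc.continuousWithinAt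
    ((tendsto_br₁ hG hf 0).mono_left nhdsWithin_le_nhds)
    (fun q hq1 hq2 => ?_) hθ' hθ h2.bot h1.top
  have := hG.le_of_mem_br₁_br₂ (h0 0) (h0' 0) hq1 hq2
  linarith

theorem superAt_two_three (hf0 : ∀ x, 0 ≤ f x) (hfβ : ∀ x, f x ≤ β) (hβ : m + β ≤ lam)
    (hlam : lam ≤ M) (h2 : HasMean (fun x => br₂ G m M pm pM (lam - f x)) μ)
    (h3 : HasMean (fun x => br₃ G M pM (lam - f x)) μ') (hθ : μ ≤ θ) (hθ' : θ ≤ μ') :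
    SuperAt G f θ lam := by
  have h0 : ∀ x, m ≤ lam - f x := fun x => by linarith [hfβ x]
  have h0' : ∀ x, lam - f x ≤ M := fun x => by linarith [hf0 x]
  have hc := hG.continuous_br₂.comp (continuous_const (y := lam) |>.sub hf)
  refine SuperAt.of_glue (x₀ := 0) h2.toIsBddMeas h3.toIsBddMeas
    (br₂_slope hG hf h0 h0').2 (br₃_slope hG hf (fun x => hG.m_nonneg.trans (h0 x)) h0').2
    hc.continuousWithinAt ((tendsto_br₃ hG hf 0).mono_left nhdsWithin_le_nhds)
    (fun q hq1 hq2 => ?_) hθ hθ' h2.bot h3.top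
  have := hG.ge_of_mem_br₂_br₃ (h0 0) (h0' 0) hq1 hq2
  linarith

omit hf in
theorem superAt_of_lt (hf0 : ∀ x, 0 ≤ f x) (hhi : ∀ c < β, ∃ x, c < f x) (hlam : lam < β) :
    SuperAt G f θ lam := by
  obtain ⟨x₀, hx₀⟩ := hhi lam hlam
  obtain ⟨c, hc1, hc2, hc3⟩ := hG.exists_large θ lam
  refine SuperAt.of_glue (x₀ := x₀) (hasMean_const (-c)).toIsBddMeas (hasMean_const c).toIsBddMeas
    (.of_continuous continuous_const fun x => by linarith [hf0 x])
    (.of_continuous continuous_const fun x => by linarith [hf0 x])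
    tendsto_const_nhds tendsto_const_nhds (fun q _ _ => by linarith [hG.nonneg q])
    (by linarith [neg_abs_le θ]) (by linarith [le_abs_self θ])
    (hasMean_const (-c)).bot (hasMean_const c).top

omit hG hf in
theorem subAt_const (hfβ : ∀ x, f x ≤ β) : SubAt G f θ (G θ + β) :=
  ⟨fun _ => θ, (hasMean_const θ).toIsBddMeas,
    .of_continuous continuous_const fun x => by linarith [hfβ x], θ, θ, le_rfl, le_rfl,
    (hasMean_const θ).bot, (hasMean_const θ).top⟩

end Path

end HJ

namespace HJ

/-! ### Scaling and uniqueness of the effective Hamiltonian -/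

theorem affine_touch_above {φ : ℝ × ℝ → ℝ} {t x a b : ℝ} (hφ : DifferentiableAt ℝ φ (t, x))
    (h : ∀ᶠ q in 𝓝 (t, x), φ q - φ (t, x) ≤ a * (q.1 - t) + b * (q.2 - x)) :
    fderiv ℝ φ (t, x) (1, 0) = a ∧ fderiv ℝ φ (t, x) (0, 1) = b := by
  obtain ⟨e1, e2⟩ := affine_touch (φ := fun q => -φ q) (a := -a) (b := -b) hφ.neg (by
    filter_upwards [h] with q hq
    linarith)
  have e : fderiv ℝ (fun q => -φ q) (t, x) = -fderiv ℝ φ (t, x) := fderiv_fun_neg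
  rw [e, neg_apply] at e1 e2
  exact ⟨neg_injective e1, neg_injective e2⟩

theorem isSolution_affine (H : ℝ → ℝ) (θ : ℝ) :
    IsSolution (fun p _ => H p) (fun x => θ * x) (fun q => θ * q.2 - H θ * q.1) where
  uniformContinuousOn := by
    have h1 : UniformContinuous fun q : ℝ × ℝ => θ * q.2 :=
      (Real.uniformContinuous_const_mul (x := θ)).comp uniformContinuous_snd
    have h2 : UniformContinuous fun q : ℝ × ℝ => H θ * q.1 :=
      (Real.uniformContinuous_const_mul (x := H θ)).comp uniformContinuous_fst
    exact (h1.sub h2).uniformContinuousOn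
  initial x := by simp
  sub t x _ φ hφ hmax := by
    obtain ⟨e1, e2⟩ := affine_touch (hφ.differentiable one_ne_zero (t, x)) (a := -H θ) (b := θ) (by
      filter_upwards [hmax] with q hq
      linarith)
    rw [e1, e2]; simp
  super t x _ φ hφ hmin := by
    obtain ⟨e1, e2⟩ := affine_touch_above (hφ.differentiable one_ne_zero (t, x)) (a := -H θ)
      (b := θ) (by
        filter_upwards [hmin] with q hq
        linarith)
    rw [e1, e2]; simp

theorem fderiv_rescale {φ : ℝ × ℝ → ℝ} (hφ : ContDiff ℝ 1 φ) {ε : ℝ} (hε : ε ≠ 0) (t x : ℝ) :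
    fderiv ℝ (fun q : ℝ × ℝ => ε⁻¹ * φ (ε * q.1, ε * q.2)) (t / ε, x / ε) (1, 0) =
        fderiv ℝ φ (t, x) (1, 0) ∧
      fderiv ℝ (fun q : ℝ × ℝ => ε⁻¹ * φ (ε * q.1, ε * q.2)) (t / ε, x / ε) (0, 1) =
        fderiv ℝ φ (t, x) (0, 1) := by
  have hφ' : ContDiff ℝ 1 (fun q : ℝ × ℝ => ε⁻¹ * φ (ε * q.1, ε * q.2)) :=
    contDiff_const.mul (hφ.comp (by fun_prop : ContDiff ℝ 1 fun q : ℝ × ℝ => (ε * q.1, ε * q.2)))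
  have hd := hφ.differentiable one_ne_zero (t, x)
  have hd' := hφ'.differentiable one_ne_zero (t / ε, x / ε)
  have et : ε * (t / ε) = t := mul_div_cancel₀ t hε
  have ex : ε * (x / ε) = x := mul_div_cancel₀ x hε
  constructor
  · refine (hasDerivAt_time hd').unique ?_
    have h1 : HasDerivAt (fun s => φ (s, x)) (fderiv ℝ φ (t, x) (1, 0)) (ε * (t / ε)) := by
      rw [et]; exact hasDerivAt_time hd
    have h2 := (h1.comp (t / ε) ((hasDerivAt_id (t / ε)).const_mul ε)).const_mul ε⁻¹
    simp only [ex]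
    refine h2.congr_deriv ?_
    field_simp
  · refine (hasDerivAt_space hd').unique ?_
    have h1 : HasDerivAt (fun y => φ (t, y)) (fderiv ℝ φ (t, x) (0, 1)) (ε * (x / ε)) := by
      rw [ex]; exact hasDerivAt_space hd
    have h2 := (h1.comp (x / ε) ((hasDerivAt_id (x / ε)).const_mul ε)).const_mul ε⁻¹
    simp only [et]
    refine h2.congr_deriv ?_
    field_simp

theorem tendsto_rescale {ε : ℝ} (hε : ε ≠ 0) (t x : ℝ) :
    Tendsto (fun q : ℝ × ℝ => (ε * q.1, ε * q.2)) (𝓝 (t / ε, x / ε)) (𝓝 (t, x)) := by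
  have : Continuous fun q : ℝ × ℝ => (ε * q.1, ε * q.2) := by fun_prop
  have h := this.tendsto (t / ε, x / ε)
  simp only [mul_div_cancel₀ _ hε] at h
  exact h

theorem IsSolution.rescale {G f : ℝ → ℝ} {θ : ℝ} {u : ℝ × ℝ → ℝ}
    (h : IsSolution (fun p x => G p + f x) (fun x => θ * x) u) {ε : ℝ} (hε : 0 < ε) :
    IsSolution (fun p x => G p + f (x / ε)) (fun x => θ * x)
      (fun q => ε * u (q.1 / ε, q.2 / ε)) where
  uniformContinuousOn := by
    have hε' : UniformContinuous fun s : ℝ => s / ε := by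
      simpa only [div_eq_inv_mul] using Real.uniformContinuous_const_mul (x := ε⁻¹)
    have h1 : UniformContinuous fun q : ℝ × ℝ => (q.1 / ε, q.2 / ε) :=
      (hε'.comp uniformContinuous_fst).prodMk (hε'.comp uniformContinuous_snd)
    refine (Real.uniformContinuous_const_mul (x := ε)).comp_uniformContinuousOn
      (h.uniformContinuousOn.comp h1.uniformContinuousOn fun q hq => ⟨?_, trivial⟩)
    exact div_nonneg hq.1 hε.le
  initial x := by
    simp only [zero_div, h.initial]
    field_simp
  sub t x ht φ hφ hmax := by
    obtain ⟨e1, e2⟩ := fderiv_rescale hφ hε.ne' t x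
    have key := h.sub (t / ε) (x / ε) (by positivity)
      (fun q : ℝ × ℝ => ε⁻¹ * φ (ε * q.1, ε * q.2))
      (contDiff_const.mul (hφ.comp (by fun_prop : ContDiff ℝ 1 fun q : ℝ × ℝ =>
        (ε * q.1, ε * q.2)))) (by
      filter_upwards [(tendsto_rescale hε.ne' t x).eventually hmax] with q hq
      simp only [mul_div_cancel_left₀ _ hε.ne', mul_div_cancel₀ _ hε.ne'] at hq ⊢
      have := mul_le_mul_of_nonneg_left hq (inv_nonneg.2 hε.le)
      rw [mul_sub, mul_sub, inv_mul_cancel_left₀ hε.ne', inv_mul_cancel_left₀ hε.ne'] at this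
      exact this)
    rw [e1, e2] at key
    exact key
  super t x ht φ hφ hmin := by
    obtain ⟨e1, e2⟩ := fderiv_rescale hφ hε.ne' t x
    have key := h.super (t / ε) (x / ε) (by positivity)
      (fun q : ℝ × ℝ => ε⁻¹ * φ (ε * q.1, ε * q.2))
      (contDiff_const.mul (hφ.comp (by fun_prop : ContDiff ℝ 1 fun q : ℝ × ℝ =>
        (ε * q.1, ε * q.2)))) (by
      filter_upwards [(tendsto_rescale hε.ne' t x).eventually hmin] with q hq
      simp only [mul_div_cancel_left₀ _ hε.ne', mul_div_cancel₀ _ hε.ne'] at hq ⊢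
      have := mul_le_mul_of_nonneg_left hq (inv_nonneg.2 hε.le)
      rw [mul_sub, mul_sub, inv_mul_cancel_left₀ hε.ne', inv_mul_cancel_left₀ hε.ne'] at this
      exact this)
    rw [e1, e2] at key
    exact key

section Stochastic

variable {Ω : Type*} [MeasurableSpace Ω] {P : Measure Ω} {τ : ℝ → Ω → Ω} {V : ℝ → Ω → ℝ}
  {G : ℝ → ℝ} {m M pm pM β : ℝ}

theorem HomogenizesTo.eq [IsProbabilityMeasure P] {H' Hbar : ℝ → ℝ}
    (hH : HomogenizesTo P G β V H') (hb : IsEffectiveHamiltonian P G β V Hbar) : H' = Hbar := by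
  funext θ
  obtain ⟨-, -, hH⟩ := hH
  obtain ⟨ω, hω1, ⟨u, hu⟩, hω2⟩ := (hH.and (hb θ)).exists
  have hlim := hω2 u hu
  have hloc := hω1 (fun x => θ * x) (Real.uniformContinuous_const_mul (x := θ))
    (fun ε q => ε * u (q.1 / ε, q.2 / ε)) (fun ε hε => hu.rescale (f := fun x => β * V x ω) hε)
    _ (isSolution_affine H' θ)
  have h1 := hloc.tendsto_at (show ((1 : ℝ), (0 : ℝ)) ∈ Ici (0 : ℝ) ×ˢ univ from
    ⟨mem_Ici.2 zero_le_one, trivial⟩)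
  simp only [mul_zero, mul_one, zero_sub, zero_div] at h1
  have h2 := (hlim.comp tendsto_inv_nhdsGT_zero).neg
  have h3 : Tendsto (fun ε : ℝ => ε * u (1 / ε, 0)) (𝓝[>] 0) (𝓝 (-Hbar θ)) := by
    refine h2.congr' ?_
    filter_upwards [self_mem_nhdsWithin] with ε hε
    have : ε ≠ 0 := ne_of_gt hε
    simp only [Function.comp, one_div]
    field_simp
  exact neg_injective (tendsto_nhds_unique h1 h3)

/-! ### The truncated potential -/

/-- The potential `β V`, truncated to `[0, β]`. -/
noncomputable def pot (β : ℝ) (V : ℝ → Ω → ℝ) (x : ℝ) (ω : Ω) : ℝ := β * max 0 (min 1 (V x ω))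

omit [MeasurableSpace Ω] in
theorem pot_nonneg (hβ : 0 < β) (x : ℝ) (ω : Ω) : 0 ≤ pot β V x ω :=
  mul_nonneg hβ.le (le_max_left _ _)

omit [MeasurableSpace Ω] in
theorem pot_le (hβ : 0 < β) (x : ℝ) (ω : Ω) : pot β V x ω ≤ β :=
  mul_le_of_le_one_right hβ.le (max_le zero_le_one (min_le_left _ _))

theorem IsPotential.continuous_pot (hV : IsPotential P τ V) (ω : Ω) :
    Continuous fun x => pot β V x ω := by
  have := (hV.uniformContinuous ω).continuous
  unfold pot
  fun_prop

theorem IsPotential.measurable_pot (hV : IsPotential P τ V) :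
    Measurable fun q : ℝ × Ω => pot β V q.1 q.2 :=
  measurable_const.mul (measurable_const.max (measurable_const.min hV.measurable))

theorem IsPotential.pot_shift (hτ : IsErgodicFlow P τ) (hV : IsPotential P τ V) (x y : ℝ) (ω : Ω) :
    pot β V x (τ y ω) = pot β V (x + y) ω := by
  have : V x (τ y ω) = V (x + y) ω := by
    rw [hV.stationary, hV.stationary (x + y), hτ.add]; rfl
  unfold pot
  rw [this]

theorem IsPotential.ae_pot (hV : IsPotential P τ V) (hβ : 0 < β) :
    ∀ᵐ ω ∂P, (∀ x, pot β V x ω = β * V x ω) ∧ (∀ c > 0, ∃ x, pot β V x ω < c) ∧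
      ∀ c < β, ∃ x, c < pot β V x ω := by
  filter_upwards [hV.normalized] with ω ⟨h0, h1⟩
  have hmem : ∀ x, pot β V x ω = β * V x ω := fun x => by
    have g0 : 0 ≤ V x ω := h0.1 ⟨x, rfl⟩
    have g1 : V x ω ≤ 1 := h1.1 ⟨x, rfl⟩
    unfold pot
    rw [min_eq_right g1, max_eq_right g0]
  refine ⟨hmem, fun c hc => ?_, fun c hc => ?_⟩
  · obtain ⟨_, ⟨x, rfl⟩, -, hx⟩ := h0.exists_between (show (0 : ℝ) < c / β by positivity)
    refine ⟨x, ?_⟩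
    rw [hmem]
    rw [lt_div_iff₀ hβ] at hx
    linarith
  · obtain ⟨_, ⟨x, rfl⟩, hx, -⟩ := h1.exists_between (show c / β < 1 by rwa [div_lt_one hβ])
    refine ⟨x, ?_⟩
    rw [hmem]
    rw [div_lt_iff₀ hβ] at hx
    linarith

theorem IsPotential.isStationary_comp (hV : IsPotential P τ V)
    (hτ : IsErgodicFlow P τ) (hβ : 0 < β) {Φ : ℝ → ℝ} (hΦ : Continuous Φ) :
    IsStationary τ fun x ω => Φ (pot β V x ω) := by
  refine ⟨hΦ.measurable.comp hV.measurable_pot, fun x ω => ?_, ?_⟩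
  · rw [hV.pot_shift hτ, zero_add]
  · obtain ⟨K, hK⟩ := (isCompact_Icc (a := 0) (b := β)).exists_bound_of_continuousOn
      hΦ.continuousOn
    exact ⟨K, fun x ω => hK _ ⟨pot_nonneg hβ x ω, pot_le hβ x ω⟩⟩

theorem lowState_iff_rat {a b : ℝ} (hab : a < b) {f : ℝ → ℝ} (hf : Continuous f) (x : ℝ) :
    LowState a b f x ↔ ∃ j n : ℕ, ∀ k : ℕ, ∃ s : ℚ, (0 ≤ s ∧ (s : ℝ) ≤ n) ∧
      f (x - s) < a + 1 / (k + 1) ∧ ∀ t : ℚ, 0 ≤ t ∧ t ≤ s → f (x - t) ≤ b - 1 / (j + 1) := by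
  constructor
  · rintro ⟨y, hyx, hya, hyb⟩
    obtain ⟨z, hz, hmax⟩ := isCompact_Icc.exists_isMaxOn (nonempty_Icc.2 hyx) hf.continuousOn
    obtain ⟨j, hj⟩ := exists_nat_one_div_lt (sub_pos.2 (hyb z hz))
    obtain ⟨n, hn⟩ := exists_nat_ge (x - y)
    refine ⟨j, n, fun k => ?_⟩
    have hk : f y < a + 1 / (k + 1) := by
      have : (0 : ℝ) < 1 / (k + 1) := by positivity
      linarith
    obtain ⟨s, hs0, hsy, hs⟩ : ∃ s : ℚ, 0 ≤ s ∧ (s : ℝ) ≤ x - y ∧ f (x - s) < a + 1 / (k + 1) := by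
      rcases hyx.lt_or_eq with hlt | rfl
      · have hev : ∀ᶠ s : ℝ in 𝓝[<] (x - y), f (x - s) < a + 1 / (k + 1) := by
          have : Tendsto (fun s => f (x - s)) (𝓝 (x - y)) (𝓝 (f y)) := by
            have hc : Continuous fun s => f (x - s) := by fun_prop
            simpa using hc.tendsto (x - y)
          exact (this.eventually (gt_mem_nhds hk)).filter_mono nhdsWithin_le_nhds
        obtain ⟨l, hl, hlI⟩ := (mem_nhdsLT_iff_exists_Ioo_subset' (sub_pos.2 hlt)).1 hev
        obtain ⟨s, hs1, hs2⟩ := exists_rat_btwn (max_lt hl (sub_pos.2 hlt))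
        refine ⟨s, ?_, hs2.le, hlI ⟨(le_max_left _ _).trans_lt hs1, hs2⟩⟩
        exact_mod_cast ((le_max_right l 0).trans_lt hs1).le
      · exact ⟨0, le_rfl, by simp, by simpa using hk⟩
    refine ⟨s, ⟨hs0, hsy.trans hn⟩, hs, fun t ht => ?_⟩
    have ht0 : (0 : ℝ) ≤ t := by exact_mod_cast ht.1
    have hts : (t : ℝ) ≤ s := by exact_mod_cast ht.2
    have hle : f (x - t) ≤ f z := hmax (show x - (t : ℝ) ∈ Icc y x from ⟨by linarith, by linarith⟩)
    linarith
  · rintro ⟨j, n, h⟩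
    choose s hs hsa hsb using h
    have hmem : ∀ k, (s k : ℝ) ∈ Icc (0 : ℝ) n := fun k =>
      ⟨by exact_mod_cast (hs k).1, (hs k).2⟩
    obtain ⟨σ, hσ, ψ, hψ, hlim⟩ := isCompact_Icc.tendsto_subseq hmem
    have hc : Continuous fun r => f (x - r) := by fun_prop
    have hσa : f (x - σ) ≤ a := by
      have h1 : Tendsto (fun i : ℕ => a + 1 / (((ψ i : ℕ) : ℝ) + 1)) atTop (𝓝 (a + 0)) :=
        (tendsto_one_div_add_atTop_nhds_zero_nat.comp hψ.tendsto_atTop).const_add a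
      rw [add_zero] at h1
      exact le_of_tendsto_of_tendsto ((hc.tendsto σ).comp hlim) h1
        (Eventually.of_forall fun i => (hsa (ψ i)).le)
    refine ⟨x - σ, by linarith [hσ.1], hσa, fun z hz => ?_⟩
    rcases hz.1.lt_or_eq with hlt | heq
    · obtain ⟨i, hi⟩ := (hlim.eventually (lt_mem_nhds (show x - z < σ by linarith))).exists
      have hj : (0 : ℝ) < 1 / (j + 1) := by positivity
      by_contra! hbz
      have hev : ∀ᶠ r : ℝ in 𝓝[>] (x - z), b - 1 / (j + 1) < f (x - r) := by
        have : Tendsto (fun r => f (x - r)) (𝓝 (x - z)) (𝓝 (f z)) := by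
          simpa using hc.tendsto (x - z)
        exact (this.eventually (lt_mem_nhds (by linarith))).filter_mono nhdsWithin_le_nhds
      obtain ⟨l, hl, hlI⟩ := (mem_nhdsGT_iff_exists_Ioo_subset' hi).1 hev
      obtain ⟨t, ht1, ht2⟩ := exists_rat_btwn (lt_min hl hi)
      have h1 : b - 1 / (j + 1) < f (x - t) := hlI ⟨ht1, ht2.trans_le (min_le_left _ _)⟩
      have h2 := hsb (ψ i) t ⟨by
        have : (0 : ℝ) ≤ t := by linarith [hz.2]
        exact_mod_cast this, by
        have : (t : ℝ) ≤ s (ψ i) := (ht2.trans_le (min_le_right _ _)).le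
        exact_mod_cast this⟩
      linarith
    · rw [← heq]; exact hσa.trans_lt hab

theorem IsPotential.measurableSet_lowState (hV : IsPotential P τ V) {a b : ℝ} (hab : a < b) :
    MeasurableSet {q : ℝ × Ω | LowState a b (fun y => pot β V y q.2) q.1} := by
  have hm : ∀ r : ℝ, Measurable fun q : ℝ × Ω => pot β V (q.1 - r) q.2 := fun r =>
    hV.measurable_pot.comp ((measurable_fst.sub_const r).prodMk measurable_snd)
  have : {q : ℝ × Ω | LowState a b (fun y => pot β V y q.2) q.1} =
      ⋃ j : ℕ, ⋃ n : ℕ, ⋂ k : ℕ, ⋃ s : ℚ, ⋃ _ : 0 ≤ s ∧ (s : ℝ) ≤ n,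
        ({q | pot β V (q.1 - s) q.2 < a + 1 / (k + 1)} ∩ ⋂ t : ℚ, ⋂ _ : 0 ≤ t ∧ t ≤ s,
          {q | pot β V (q.1 - t) q.2 ≤ b - 1 / (j + 1)}) := by
    ext q
    simp only [mem_ofPred_eq, lowState_iff_rat hab (hV.continuous_pot q.2), mem_iUnion, mem_iInter,
      mem_inter_iff, exists_prop]
  rw [this]
  refine MeasurableSet.iUnion fun j => MeasurableSet.iUnion fun n => MeasurableSet.iInter fun k =>
    MeasurableSet.iUnion fun s => MeasurableSet.iUnion fun _ =>
      (measurableSet_lt (hm s) measurable_const).inter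
        (MeasurableSet.iInter fun t => MeasurableSet.iInter fun _ =>
          measurableSet_le (hm t) measurable_const)

theorem IsPotential.lowState_shift (hV : IsPotential P τ V) (hτ : IsErgodicFlow P τ) {a b : ℝ}
    (x : ℝ) (ω : Ω) : LowState a b (fun y => pot β V y (τ x ω)) 0 ↔
      LowState a b (fun y => pot β V y ω) x := by
  simp only [LowState, hV.pot_shift hτ]
  constructor
  · rintro ⟨y, hy, h1, h2⟩
    refine ⟨y + x, by linarith, h1, fun z hz => ?_⟩
    simpa using h2 (z - x) ⟨by linarith [hz.1], by linarith [hz.2]⟩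
  · rintro ⟨y, hy, h1, h2⟩
    refine ⟨y - x, by linarith, by simpa using h1, fun z hz => ?_⟩
    exact h2 (z + x) ⟨by linarith [hz.1], by linarith [hz.2]⟩

theorem IsPotential.isStationary_hyst (hV : IsPotential P τ V) (hτ : IsErgodicFlow P τ)
    (hβ : 0 < β) (hG : IsDoubleWell G m M pm pM) (lam : ℝ) :
    IsStationary τ fun x ω => hyst G m M pm pM lam (fun y => pot β V y ω) x := by
  have h1 : IsStationary τ fun x ω => br₁ G m pm (lam - pot β V x ω) :=
    hV.isStationary_comp hτ hβ
      (hG.continuous_br₁.comp (continuous_const (y := lam) |>.sub continuous_id))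
  have h3 : IsStationary τ fun x ω => br₃ G M pM (lam - pot β V x ω) :=
    hV.isStationary_comp hτ hβ
      (hG.continuous_br₃.comp (continuous_const (y := lam) |>.sub continuous_id))
  refine ⟨?_, fun x ω => ?_, ?_⟩
  · exact Measurable.ite (hV.measurableSet_lowState (by linarith [hG.m_lt_M])) h1.meas h3.meas
  · have e := hV.pot_shift hτ (β := β) 0 x ω
    rw [zero_add] at e
    simp only [hyst, e]
    by_cases hL : LowState (lam - M) (lam - m) (fun y => pot β V y ω) x
    · rw [if_pos hL, if_pos ((hV.lowState_shift hτ x ω).2 hL)]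
    · rw [if_neg hL, if_neg fun h => hL ((hV.lowState_shift hτ x ω).1 h)]
  · obtain ⟨K, hK⟩ := h1.bdd
    obtain ⟨K', hK'⟩ := h3.bdd
    refine ⟨max K K', fun x ω => ?_⟩
    simp only [hyst]
    split_ifs
    · exact (hK x ω).trans (le_max_left _ _)
    · exact (hK' x ω).trans (le_max_right _ _)

theorem IsStationary.ae_hasMean [IsProbabilityMeasure P] (hτ : IsErgodicFlow P τ)
    {F : ℝ → Ω → ℝ} (hF : IsStationary τ F) :
    ∀ᵐ ω ∂P, HasMean (fun x => F x ω) (∫ ω, F 0 ω ∂P) := by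
  filter_upwards [hF.ae_tendsto_atTop hτ, hF.ae_tendsto_atBot hτ] with ω h1 h2
  exact { hF.isBddMeas ω with bot := h2, top := h1 }

/-- The mean of a function of `lam - β V`. -/
noncomputable def meanBr (P : Measure Ω) (β : ℝ) (V : ℝ → Ω → ℝ) (r : ℝ → ℝ) (lam : ℝ) : ℝ :=
  ∫ ω, r (lam - pot β V 0 ω) ∂P

/-- The mean of the hysteresis process. -/
noncomputable def meanHyst (P : Measure Ω) (β : ℝ) (V : ℝ → Ω → ℝ) (G : ℝ → ℝ) (m M pm pM : ℝ)
    (lam : ℝ) : ℝ :=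
  ∫ ω, hyst G m M pm pM lam (fun y => pot β V y ω) 0 ∂P

/-- Almost surely, `lam` bounds the effective Hamiltonian at `θ` from above. -/
def UpperAt (P : Measure Ω) (β : ℝ) (V : ℝ → Ω → ℝ) (G : ℝ → ℝ) (θ lam : ℝ) : Prop :=
  ∀ᵐ ω ∂P, SubAt G (fun x => β * V x ω) θ lam

/-- Almost surely, `lam` bounds the effective Hamiltonian at `θ` from below. -/
def LowerAt (P : Measure Ω) (β : ℝ) (V : ℝ → Ω → ℝ) (G : ℝ → ℝ) (θ lam : ℝ) : Prop :=
  ∀ᵐ ω ∂P, SuperAt G (fun x => β * V x ω) θ lam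

/-- The standing assumptions. -/
structure Standing (P : Measure Ω) (τ : ℝ → Ω → Ω) (V : ℝ → Ω → ℝ) (G : ℝ → ℝ)
    (m M pm pM β : ℝ) : Prop where
  prob : IsProbabilityMeasure P
  flow : IsErgodicFlow P τ
  pot : IsPotential P τ V
  well : IsDoubleWell G m M pm pM
  pos : 0 < β

namespace Standing

variable (S : Standing P τ V G m M pm pM β) {θ lam : ℝ}
include S

theorem ae_pot_eq : ∀ᵐ ω ∂P, (fun x => β * V x ω) = fun x => HJ.pot β V x ω := by
  filter_upwards [S.pot.ae_pot S.pos] with ω h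
  exact funext fun x => (h.1 x).symm

theorem isStationary_br {r : ℝ → ℝ} (hr : Continuous r) (lam : ℝ) :
    IsStationary τ fun x ω => r (lam - HJ.pot β V x ω) :=
  S.pot.isStationary_comp S.flow S.pos (hr.comp (continuous_const (y := lam) |>.sub continuous_id))

theorem ae_hasMean_br {r : ℝ → ℝ} (hr : Continuous r) (lam : ℝ) :
    ∀ᵐ ω ∂P, HasMean (fun x => r (lam - HJ.pot β V x ω)) (meanBr P β V r lam) :=
  have := S.prob
  (S.isStationary_br hr lam).ae_hasMean S.flow

theorem ae_hasMean_hyst (lam : ℝ) : ∀ᵐ ω ∂P,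
    HasMean (hyst G m M pm pM lam (fun y => HJ.pot β V y ω)) (meanHyst P β V G m M pm pM lam) :=
  have := S.prob
  (S.pot.isStationary_hyst S.flow S.pos S.well lam).ae_hasMean S.flow

theorem upperAt_hyst (hβ : β ≤ lam) (hlam : lam < m + β)
    (hθ : meanHyst P β V G m M pm pM lam ≤ θ) (hθ' : θ ≤ meanBr P β V (br₄ G) lam) :
    UpperAt P β V G θ lam := by
  filter_upwards [S.ae_pot_eq, S.pot.ae_pot S.pos, S.ae_hasMean_hyst lam,
    S.ae_hasMean_br S.well.continuous_br₄ lam] with ω e h1 h2 h3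
  rw [e]
  exact subAt_hyst S.well (S.pot.continuous_pot ω) (fun x => pot_le S.pos x ω) h1.2.2 hβ hlam
    h2 h3 hθ hθ'

theorem lowerAt_hyst (hβ : β ≤ lam) (hlam : lam < m + β)
    (hθ : θ ≤ meanHyst P β V G m M pm pM lam) : LowerAt P β V G θ lam := by
  filter_upwards [S.ae_pot_eq, S.pot.ae_pot S.pos, S.ae_hasMean_hyst lam] with ω e h1 h2
  rw [e]
  exact superAt_hyst S.well (S.pot.continuous_pot ω) (fun x => pot_nonneg S.pos x ω)
    (fun x => pot_le S.pos x ω) h1.2.2 hβ hlam h2 hθ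

theorem upperAt_four_one (hM : M < lam) (hlam : m + β ≤ lam)
    (hθ : meanBr P β V (br₁ G m pm) lam ≤ θ) (hθ' : θ ≤ meanBr P β V (br₄ G) lam) :
    UpperAt P β V G θ lam := by
  filter_upwards [S.ae_pot_eq, S.pot.ae_pot S.pos, S.ae_hasMean_br S.well.continuous_br₁ lam,
    S.ae_hasMean_br S.well.continuous_br₄ lam] with ω e h1 h2 h3
  rw [e]
  exact subAt_four_one S.well (S.pot.continuous_pot ω) (fun x => pot_le S.pos x ω) h1.2.1 hM hlam
    h2 h3 hθ hθ'

theorem lowerAt_one (hlam : m + β ≤ lam) (hθ : θ ≤ meanBr P β V (br₁ G m pm) lam) :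
    LowerAt P β V G θ lam := by
  filter_upwards [S.ae_pot_eq, S.ae_hasMean_br S.well.continuous_br₁ lam] with ω e h2
  rw [e]
  exact superAt_one S.well (S.pot.continuous_pot ω) (fun x => pot_nonneg S.pos x ω)
    (fun x => pot_le S.pos x ω) hlam h2 hθ

theorem lowerAt_four (hlam : β ≤ lam) (hθ : meanBr P β V (br₄ G) lam ≤ θ) :
    LowerAt P β V G θ lam := by
  filter_upwards [S.ae_pot_eq, S.ae_hasMean_br S.well.continuous_br₄ lam] with ω e h2
  rw [e]
  exact superAt_four S.well (S.pot.continuous_pot ω) (fun x => pot_nonneg S.pos x ω)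
    (fun x => pot_le S.pos x ω) hlam h2 hθ

theorem upperAt_four_three (hβ : β ≤ lam) (hlam : lam ≤ M)
    (hθ : meanBr P β V (br₃ G M pM) lam ≤ θ) (hθ' : θ ≤ meanBr P β V (br₄ G) lam) :
    UpperAt P β V G θ lam := by
  filter_upwards [S.ae_pot_eq, S.ae_hasMean_br S.well.continuous_br₃ lam,
    S.ae_hasMean_br S.well.continuous_br₄ lam] with ω e h2 h3
  rw [e]
  exact subAt_four_three S.well (S.pot.continuous_pot ω) (fun x => pot_nonneg S.pos x ω)
    (fun x => pot_le S.pos x ω) hβ hlam h2 h3 hθ hθ'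

theorem upperAt_two_one (hβ : m + β ≤ lam) (hlam : lam ≤ M)
    (hθ : meanBr P β V (br₁ G m pm) lam ≤ θ) (hθ' : θ ≤ meanBr P β V (br₂ G m M pm pM) lam) :
    UpperAt P β V G θ lam := by
  filter_upwards [S.ae_pot_eq, S.ae_hasMean_br S.well.continuous_br₁ lam,
    S.ae_hasMean_br S.well.continuous_br₂ lam] with ω e h2 h3
  rw [e]
  exact subAt_two_one S.well (S.pot.continuous_pot ω) (fun x => pot_nonneg S.pos x ω)
    (fun x => pot_le S.pos x ω) hβ hlam h2 h3 hθ hθ'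

theorem lowerAt_two_three (hβ : m + β ≤ lam) (hlam : lam ≤ M)
    (hθ : meanBr P β V (br₂ G m M pm pM) lam ≤ θ) (hθ' : θ ≤ meanBr P β V (br₃ G M pM) lam) :
    LowerAt P β V G θ lam := by
  filter_upwards [S.ae_pot_eq, S.ae_hasMean_br S.well.continuous_br₂ lam,
    S.ae_hasMean_br S.well.continuous_br₃ lam] with ω e h2 h3
  rw [e]
  exact superAt_two_three S.well (S.pot.continuous_pot ω) (fun x => pot_nonneg S.pos x ω)
    (fun x => pot_le S.pos x ω) hβ hlam h2 h3 hθ hθ'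

theorem lowerAt_of_lt (hlam : lam < β) : LowerAt P β V G θ lam := by
  filter_upwards [S.ae_pot_eq, S.pot.ae_pot S.pos] with ω e h1
  rw [e]
  exact superAt_of_lt S.well (fun x => pot_nonneg S.pos x ω) h1.2.2 hlam

theorem upperAt_const (θ : ℝ) : UpperAt P β V G θ (G θ + β) := by
  filter_upwards [S.ae_pot_eq] with ω e
  rw [e]
  exact subAt_const fun x => pot_le S.pos x ω

theorem upperAt_or_lowerAt (h1 : lam ≠ β) (h2 : lam ≠ M) (h3 : lam ≠ m + β) (θ : ℝ) :
    UpperAt P β V G θ lam ∨ LowerAt P β V G θ lam := by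
  rcases lt_or_gt_of_ne h1 with hβ | hβ
  · exact Or.inr (S.lowerAt_of_lt hβ)
  rcases le_total (meanBr P β V (br₄ G) lam) θ with h4 | h4
  · exact Or.inr (S.lowerAt_four hβ.le h4)
  rcases lt_or_gt_of_ne h3 with hm | hm
  · rcases le_total (meanHyst P β V G m M pm pM lam) θ with hh | hh
    · exact Or.inl (S.upperAt_hyst hβ.le hm hh h4)
    · exact Or.inr (S.lowerAt_hyst hβ.le hm hh)
  rcases le_total θ (meanBr P β V (br₁ G m pm) lam) with hθ1 | hθ1
  · exact Or.inr (S.lowerAt_one hm.le hθ1)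
  rcases lt_or_gt_of_ne h2 with hM | hM
  · rcases le_total (meanBr P β V (br₃ G M pM) lam) θ with hθ3 | hθ3
    · exact Or.inl (S.upperAt_four_three hβ.le hM.le hθ3 h4)
    rcases le_total (meanBr P β V (br₂ G m M pm pM) lam) θ with hθ2 | hθ2
    · exact Or.inr (S.lowerAt_two_three hm.le hM.le hθ2 hθ3)
    · exact Or.inl (S.upperAt_two_one hm.le hM.le hθ1 hθ2)
  · exact Or.inl (S.upperAt_four_one hM hm.le hθ1 h4)

theorem uniformContinuous_pot (ω : Ω) : UniformContinuous fun x => β * V x ω :=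
  (Real.uniformContinuous_const_mul (x := β)).comp (S.pot.uniformContinuous ω)

theorem exists_solution (ω : Ω) (θ : ℝ) :
    ∃ u, IsSolution (fun p x => G p + β * V x ω) (fun x => θ * x) u := by
  refine exists_isSolution S.well.continuous S.well.coercive (S.uniformContinuous_pot ω).continuous
    ?_ θ
  obtain ⟨C, hC⟩ := S.pot.bounded ω
  refine ⟨β * C, fun x => ?_⟩
  rw [abs_mul, abs_of_pos S.pos]
  exact mul_le_mul_of_nonneg_left (hC x) S.pos.le

theorem le_of_lowerAt_upperAt {lam' : ℝ} (h : LowerAt P β V G θ lam') (h' : UpperAt P β V G θ lam) :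
    lam' ≤ lam := by
  have := S.prob
  obtain ⟨ω, h1, h2⟩ := (h.and h').exists
  obtain ⟨u, hu⟩ := S.exists_solution ω θ
  refine le_of_forall_pos_le_add fun ε hε => ?_
  have e1 := h1.eventually_ge S.well.continuous (S.uniformContinuous_pot ω)
    hu.uniformContinuousOn hu.initial hu.sub (half_pos hε)
  have e2 := h2.eventually_le S.well.continuous (S.uniformContinuous_pot ω)
    hu.uniformContinuousOn hu.initial hu.super (half_pos hε)
  obtain ⟨t, ht1, ht2⟩ := (e1.and e2).exists
  linarith

end Standing

/-- The effective Hamiltonian. -/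
noncomputable def effHam (P : Measure Ω) (β : ℝ) (V : ℝ → Ω → ℝ) (G : ℝ → ℝ) (θ : ℝ) : ℝ :=
  sInf {lam | UpperAt P β V G θ lam}

namespace Standing

variable (S : Standing P τ V G m M pm pM β) {θ lam : ℝ}
include S

theorem effHam_le (h : UpperAt P β V G θ lam) : effHam P β V G θ ≤ lam :=
  csInf_le ⟨β - 1, fun _ h' => S.le_of_lowerAt_upperAt (S.lowerAt_of_lt (by linarith)) h'⟩ h

theorem le_effHam (h : LowerAt P β V G θ lam) : lam ≤ effHam P β V G θ :=
  le_csInf ⟨_, S.upperAt_const θ⟩ fun _ h' => S.le_of_lowerAt_upperAt h h'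

theorem isEffectiveHamiltonian : IsEffectiveHamiltonian P G β V (effHam P β V G) := by
  intro θ
  have hup : ∀ k : ℕ, ∃ lam, lam < effHam P β V G θ + 1 / (k + 1) ∧ UpperAt P β V G θ lam := by
    intro k
    have : (0 : ℝ) < 1 / (k + 1) := by positivity
    obtain ⟨lam, h1, h2⟩ := exists_lt_of_csInf_lt (s := {lam | UpperAt P β V G θ lam})
      ⟨_, S.upperAt_const θ⟩ (show effHam P β V G θ < effHam P β V G θ + 1 / (k + 1) by linarith)
    exact ⟨lam, h2, h1⟩
  have hlo : ∀ k : ℕ, ∃ lam, effHam P β V G θ - 1 / (k + 1) < lam ∧ LowerAt P β V G θ lam := by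
    intro k
    have : (0 : ℝ) < 1 / (k + 1) := by positivity
    have hinf : (Ioo (effHam P β V G θ - 1 / (k + 1)) (effHam P β V G θ)).Infinite :=
      Ioo_infinite (by linarith)
    obtain ⟨lam, hlam, hne⟩ := (hinf.sdiff (toFinite {β, M, m + β})).nonempty
    simp only [mem_insert_iff, mem_singleton_iff, not_or] at hne
    refine ⟨lam, hlam.1, (S.upperAt_or_lowerAt hne.1 hne.2.1 hne.2.2 θ).resolve_left fun h => ?_⟩
    exact absurd (S.effHam_le h) hlam.2.not_ge
  choose a ha ha' using hup
  choose b hb hb' using hlo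
  filter_upwards [ae_all_iff.2 ha', ae_all_iff.2 hb'] with ω h1 h2
  refine ⟨S.exists_solution ω θ, fun u hu => ?_⟩
  rw [Metric.tendsto_nhds]
  intro ε hε
  obtain ⟨k, hk⟩ := exists_nat_one_div_lt (half_pos hε)
  have e1 := (h1 k).eventually_le S.well.continuous (S.uniformContinuous_pot ω)
    hu.uniformContinuousOn hu.initial hu.super (half_pos hε)
  have e2 := (h2 k).eventually_ge S.well.continuous (S.uniformContinuous_pot ω)
    hu.uniformContinuousOn hu.initial hu.sub (half_pos hε)
  filter_upwards [e1, e2] with t ht1 ht2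
  rw [Real.dist_eq, abs_lt]
  constructor <;> linarith [ha k, hb k]

end Standing

end Stochastic

end HJ

namespace HJ

section HystBounds

variable {G : ℝ → ℝ} {m M pm pM : ℝ} (hG : IsDoubleWell G m M pm pM) {f : ℝ → ℝ} {lam lam' x : ℝ}
include hG

theorem hyst_le_br₃ : hyst G m M pm pM lam f x ≤ br₃ G M pM (lam - f x) := by
  unfold hyst
  split_ifs
  · exact (hG.br₁_lt_br₃ _ _).le
  · exact le_rfl

theorem br₁_le_hyst : br₁ G m pm (lam - f x) ≤ hyst G m M pm pM lam f x := by
  unfold hyst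
  split_ifs
  · exact le_rfl
  · exact (hG.br₁_lt_br₃ _ _).le

theorem hyst_anti (h : lam ≤ lam') :
    hyst G m M pm pM lam' f x ≤ hyst G m M pm pM lam f x := by
  by_cases h1 : LowState (lam - M) (lam - m) f x
  · have h2 : LowState (lam' - M) (lam' - m) f x := h1.mono (by linarith) (by linarith)
    unfold hyst
    rw [if_pos h1, if_pos h2]
    exact hG.antitone_br₁ (by linarith)
  · refine (hyst_le_br₃ hG).trans ?_
    unfold hyst
    rw [if_neg h1]
    exact hG.antitone_br₃ (by linarith)

omit hG in
theorem hyst_of_lt (hf : ∀ x, 0 ≤ f x) (h : lam < M) :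
    hyst G m M pm pM lam f x = br₃ G M pM (lam - f x) :=
  if_neg fun ⟨y, _, hy, _⟩ => by linarith [hf y]

theorem abs_hyst_le (hf : ∀ x, 0 ≤ f x) (h : lam ≤ lam') :
    |hyst G m M pm pM lam f x| ≤ -br₁ G m pm lam' := by
  have h1 := br₁_le_hyst hG (f := f) (lam := lam) (x := x)
  have h2 := hyst_le_br₃ hG (f := f) (lam := lam) (x := x)
  have h3 := hG.antitone_br₁ (show lam - f x ≤ lam' by linarith [hf x])
  have h4 := (hG.br₃_mem (lam - f x)).2
  rw [abs_le]
  constructor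
  · linarith
  · linarith [hG.br₁_mem lam', hG.pm_lt_pM, hG.pM_neg]

end HystBounds

theorem not_hasFlatPiece {H : ℝ → ℝ} {h x₁ x₂ : ℝ} (hH : ∀ θ, θ ≠ x₁ → θ ≠ x₂ → H θ ≠ h) :
    ¬HasFlatPiece H h := by
  rintro ⟨a, b, hab, hflat⟩
  obtain ⟨θ, hθ, hne⟩ := ((Ioo_infinite hab).sdiff (toFinite {x₁, x₂})).nonempty
  simp only [mem_insert_iff, mem_singleton_iff, not_or] at hne
  exact hH θ hne.1 hne.2 (hflat θ hθ)

theorem exists_eq_iff_rat {f : ℝ → ℝ} (hf : Continuous f) (c : ℝ) :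
    (∃ x, f x = c) ↔
      ∃ N : ℕ, ∀ k : ℕ, ∃ s : ℚ, |(s : ℝ)| ≤ N ∧ |f s - c| < 1 / ((k : ℝ) + 1) := by
  constructor
  · rintro ⟨x, hx⟩
    obtain ⟨N, hN⟩ := exists_nat_gt |x|
    refine ⟨N, fun k => ?_⟩
    have h1 : ∀ᶠ y : ℝ in 𝓝 x, |f y - c| < 1 / ((k : ℝ) + 1) := by
      have : Continuous fun y => |f y - c| := by fun_prop
      exact (this.tendsto x).eventually (gt_mem_nhds (by simp only [hx, sub_self, abs_zero]; positivity))
    have h2 : ∀ᶠ y : ℝ in 𝓝 x, |y| < (N : ℝ) := continuous_abs.continuousAt.eventually (gt_mem_nhds hN)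
    obtain ⟨s, hs1, hs2⟩ := Rat.denseRange_cast.exists_mem_open isOpen_interior
      ⟨x, mem_interior_iff_mem_nhds.2 (h1.and h2)⟩ |>.imp fun s hs => interior_subset hs
    exact ⟨s, hs2.le, hs1⟩
  · rintro ⟨N, h⟩
    choose s hs1 hs2 using h
    obtain ⟨x, -, ψ, hψ, hlim⟩ := (isCompact_Icc (a := -(N : ℝ)) (b := N)).tendsto_subseq
      (fun k => abs_le.1 (hs1 k))
    refine ⟨x, ?_⟩
    have hc : Continuous fun y => |f y - c| := by fun_prop
    have h1 : |f x - c| ≤ 0 :=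
      le_of_tendsto_of_tendsto ((hc.tendsto x).comp hlim)
        (tendsto_one_div_add_atTop_nhds_zero_nat.comp hψ.tendsto_atTop)
        (Eventually.of_forall fun i => (hs2 (ψ i)).le)
    exact sub_eq_zero.1 (abs_eq_zero.1 (le_antisymm h1 (abs_nonneg _)))

section Stochastic

variable {Ω : Type*} [MeasurableSpace Ω] {P : Measure Ω} {τ : ℝ → Ω → Ω} {V : ℝ → Ω → ℝ}
  {G : ℝ → ℝ} {m M pm pM β : ℝ}

theorem exists_mem_of_ae {A : Set Ω} (hA : P A = 1) {Q : Ω → Prop} (hQ : ∀ᵐ ω ∂P, Q ω) :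
    ∃ ω ∈ A, Q ω := by
  by_contra! h
  have : P A = 0 := measure_mono_null (fun ω hω => h ω hω) (ae_iff.1 hQ)
  rw [this] at hA
  exact zero_ne_one hA

namespace Standing

variable (S : Standing P τ V G m M pm pM β) {θ lam lam' : ℝ}
include S

theorem ae_rat {Q : Ω → Prop} (hQ : ∀ᵐ ω ∂P, Q ω) : ∀ᵐ ω ∂P, ∀ x : ℚ, Q (τ x ω) :=
  ae_all_iff.2 fun x => (S.flow.measurePreserving x).quasiMeasurePreserving.ae hQ

theorem ae_forall_ne_of_ne_one {c : ℝ} (h : P {ω | ∃ x, V x ω = c} ≠ 1) :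
    ∀ᵐ ω ∂P, ∀ x, V x ω ≠ c := by
  have hm : ∀ s : ℝ, Measurable (V s) := fun s =>
    S.pot.measurable.comp (measurable_const.prodMk measurable_id)
  have hA : MeasurableSet {ω | ∃ x, V x ω = c} := by
    have : {ω | ∃ x, V x ω = c} = ⋃ N : ℕ, ⋂ k : ℕ, ⋃ s : ℚ, ⋃ _ : |(s : ℝ)| ≤ N,
        {ω | |V s ω - c| < 1 / ((k : ℝ) + 1)} := by
      ext ω
      simp only [mem_ofPred_eq, mem_iUnion, mem_iInter, exists_prop]
      exact exists_eq_iff_rat (S.pot.uniformContinuous ω).continuous c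
    rw [this]
    exact MeasurableSet.iUnion fun N => MeasurableSet.iInter fun k => MeasurableSet.iUnion fun s =>
      MeasurableSet.iUnion fun _ =>
        measurableSet_lt (((hm s).sub_const c).abs) measurable_const
  have hinv : ∀ y, τ y ⁻¹' {ω | ∃ x, V x ω = c} = {ω | ∃ x, V x ω = c} := by
    intro y
    have hs : ∀ x ω, V x (τ y ω) = V (x + y) ω := fun x ω => by
      rw [S.pot.stationary, S.pot.stationary (x + y), S.flow.add]; rfl
    ext ω
    simp only [mem_preimage, mem_ofPred_eq, hs]
    constructor
    · rintro ⟨x, hx⟩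
      exact ⟨_, hx⟩
    · rintro ⟨x, hx⟩
      exact ⟨x - y, by rwa [sub_add_cancel]⟩
  have h0 := (S.flow.ergodic _ hA hinv).resolve_right h
  filter_upwards [measure_eq_zero_iff_ae_notMem.1 h0] with ω hω x hx
  exact hω ⟨x, hx⟩

theorem ae_forall_of_ae {Q : ℝ → Prop} (hQ : IsClosed {s | Q s})
    (h : ∀ᵐ ω ∂P, Q (HJ.pot β V 0 ω)) : ∀ᵐ ω ∂P, ∀ x, Q (HJ.pot β V x ω) := by
  filter_upwards [S.ae_rat h] with ω hω x
  have hcl : IsClosed {x | Q (HJ.pot β V x ω)} := hQ.preimage (S.pot.continuous_pot ω)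
  have hsub : range ((↑) : ℚ → ℝ) ⊆ {x | Q (HJ.pot β V x ω)} := by
    rintro _ ⟨q, rfl⟩
    have := hω q
    rwa [S.pot.pot_shift S.flow, zero_add] at this
  have : closure (range ((↑) : ℚ → ℝ)) ⊆ {x | Q (HJ.pot β V x ω)} := hcl.closure_subset_iff.2 hsub
  rw [Rat.denseRange_cast.closure_range] at this
  exact this (mem_univ x)

theorem ae_exists_nonpos {Φ : ℝ → ℝ} (hΦ : Continuous Φ) (h0 : ∀ s, 0 ≤ Φ s)
    (h : ∀ᵐ ω ∂P, ∃ x, 0 < Φ (HJ.pot β V x ω)) : ∀ᵐ ω ∂P, ∃ x ≤ 0, 0 < Φ (HJ.pot β V x ω) := by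
  have := S.prob
  have hst := S.pot.isStationary_comp S.flow S.pos hΦ
  have hpos : 0 < ∫ ω, Φ (HJ.pot β V 0 ω) ∂P := by
    refine lt_of_le_of_ne (integral_nonneg fun ω => h0 _) fun heq => ?_
    have h1 := (integral_eq_zero_iff_of_nonneg (fun ω => h0 _) hst.integrable).1 heq.symm
    have h2 := S.ae_forall_of_ae (Q := fun s => Φ s = 0) (isClosed_eq hΦ continuous_const) h1
    obtain ⟨ω, ⟨x, hx⟩, hω⟩ := (h.and h2).exists
    exact hx.ne' (hω x)
  filter_upwards [hst.ae_hasMean S.flow] with ω hω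
  by_contra! hcon
  have hz : ∀ x ≤ 0, Φ (HJ.pot β V x ω) = 0 := fun x hx => le_antisymm (hcon x hx) (h0 _)
  have hlim : Tendsto (fun x => (∫ s in (0 : ℝ)..x, Φ (HJ.pot β V s ω)) / x) atBot (𝓝 0) := by
    refine tendsto_const_nhds.congr' ?_
    filter_upwards [eventually_le_atBot 0] with x hx
    rw [intervalIntegral.integral_congr (g := fun _ => 0) fun s hs => ?_]
    · simp
    · rw [uIcc_of_ge hx] at hs
      exact hz s hs.2
  exact hpos.ne (tendsto_nhds_unique hlim hω.bot)

theorem ae_exists_nonpos_lt {c : ℝ} (hc : 0 < c) : ∀ᵐ ω ∂P, ∃ x ≤ 0, HJ.pot β V x ω < c := by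
  have := S.ae_exists_nonpos (Φ := fun s => max (c - s) 0) (by fun_prop) (fun s => le_max_right _ _)
    (by
      filter_upwards [S.pot.ae_pot S.pos] with ω hω
      exact (hω.2.1 c hc).imp fun x hx => lt_max_of_lt_left (by linarith))
  filter_upwards [this] with ω ⟨x, hx, h⟩
  refine ⟨x, hx, ?_⟩
  rcases lt_max_iff.1 h with h | h <;> linarith

theorem ae_exists_nonpos_gt {c : ℝ} (hc : c < β) : ∀ᵐ ω ∂P, ∃ x ≤ 0, c < HJ.pot β V x ω := by
  have := S.ae_exists_nonpos (Φ := fun s => max (s - c) 0) (by fun_prop) (fun s => le_max_right _ _)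
    (by
      filter_upwards [S.pot.ae_pot S.pos] with ω hω
      exact (hω.2.2 c hc).imp fun x hx => lt_max_of_lt_left (by linarith))
  filter_upwards [this] with ω ⟨x, hx, h⟩
  refine ⟨x, hx, ?_⟩
  rcases lt_max_iff.1 h with h | h <;> linarith

/-! ### The means of the branches -/

theorem integrable_br {r : ℝ → ℝ} (hr : Continuous r) (lam : ℝ) :
    Integrable (fun ω => r (lam - HJ.pot β V 0 ω)) P :=
  have := S.prob
  (S.isStationary_br hr lam).integrable

theorem integrable_hyst (lam : ℝ) :
    Integrable (fun ω => hyst G m M pm pM lam (fun y => HJ.pot β V y ω) 0) P :=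
  have := S.prob
  (S.pot.isStationary_hyst S.flow S.pos S.well lam).integrable

theorem meanBr_one_anti (h : lam ≤ lam') :
    meanBr P β V (br₁ G m pm) lam' ≤ meanBr P β V (br₁ G m pm) lam :=
  integral_mono (S.integrable_br S.well.continuous_br₁ _) (S.integrable_br S.well.continuous_br₁ _)
    fun _ => S.well.antitone_br₁ (by linarith)

theorem meanBr_three_anti (h : lam ≤ lam') :
    meanBr P β V (br₃ G M pM) lam' ≤ meanBr P β V (br₃ G M pM) lam :=
  integral_mono (S.integrable_br S.well.continuous_br₃ _) (S.integrable_br S.well.continuous_br₃ _)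
    fun _ => S.well.antitone_br₃ (by linarith)

theorem meanBr_four_mono (h : lam ≤ lam') :
    meanBr P β V (br₄ G) lam ≤ meanBr P β V (br₄ G) lam' :=
  integral_mono (S.integrable_br S.well.continuous_br₄ _) (S.integrable_br S.well.continuous_br₄ _)
    fun _ => S.well.monotone_br₄ (by linarith)

theorem meanBr_three_le_four (lam lam' : ℝ) :
    meanBr P β V (br₃ G M pM) lam ≤ meanBr P β V (br₄ G) lam' :=
  integral_mono (S.integrable_br S.well.continuous_br₃ _) (S.integrable_br S.well.continuous_br₄ _)
    fun _ => S.well.br₃_le_br₄ _ _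

theorem meanHyst_anti (h : lam ≤ lam') :
    meanHyst P β V G m M pm pM lam' ≤ meanHyst P β V G m M pm pM lam :=
  integral_mono (S.integrable_hyst _) (S.integrable_hyst _) fun _ => hyst_anti S.well h

theorem meanHyst_le_three (lam : ℝ) :
    meanHyst P β V G m M pm pM lam ≤ meanBr P β V (br₃ G M pM) lam :=
  integral_mono (S.integrable_hyst _) (S.integrable_br S.well.continuous_br₃ _)
    fun _ => hyst_le_br₃ S.well

theorem meanHyst_of_lt (h : lam < M) :
    meanHyst P β V G m M pm pM lam = meanBr P β V (br₃ G M pM) lam :=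
  integral_congr_ae <| Eventually.of_forall fun ω =>
    hyst_of_lt (fun x => pot_nonneg S.pos x ω) h

theorem continuous_meanBr {r : ℝ → ℝ} (hr : Continuous r) : Continuous (meanBr P β V r) := by
  have := S.prob
  refine continuous_iff_continuousAt.2 fun lam => ?_
  obtain ⟨K, hK⟩ := (isCompact_Icc (a := lam - 1 - β) (b := lam + 1)).exists_bound_of_continuousOn
    hr.continuousOn
  refine continuousAt_of_dominated (bound := fun _ => K) ?_ ?_ (integrable_const K) ?_
  · exact Eventually.of_forall fun lam' => (S.integrable_br hr lam').aestronglyMeasurable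
  · filter_upwards [Icc_mem_nhds (show lam - 1 < lam by linarith) (show lam < lam + 1 by linarith)]
      with lam' h
    refine Eventually.of_forall fun ω => hK _ ⟨?_, ?_⟩
    · linarith [h.1, pot_le (V := V) S.pos 0 ω]
    · linarith [h.2, pot_nonneg (V := V) S.pos 0 ω]
  · exact Eventually.of_forall fun ω =>
      (hr.comp (continuous_id.sub continuous_const)).continuousAt

theorem branchMean_one (h : m + β ≤ lam) :
    branchMean P G β V (Iic pm) lam = meanBr P β V (br₁ G m pm) lam := by
  refine integral_congr_ae ?_
  filter_upwards [S.pot.ae_pot S.pos] with ω hω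
  have := pot_le (V := V) S.pos 0 ω
  rw [← hω.1, br₁, max_eq_left (by linarith)]

theorem branchMean_three (h : β ≤ lam) (h' : lam ≤ M) :
    branchMean P G β V (Icc pM 0) lam = meanBr P β V (br₃ G M pM) lam := by
  refine integral_congr_ae ?_
  filter_upwards [S.pot.ae_pot S.pos] with ω hω
  have := pot_le (V := V) S.pos 0 ω
  have := pot_nonneg (V := V) S.pos 0 ω
  rw [← hω.1, br₃, max_eq_left (by linarith), min_eq_left (by linarith)]

theorem branchMean_four (h : β ≤ lam) :
    branchMean P G β V (Ici 0) lam = meanBr P β V (br₄ G) lam := by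
  refine integral_congr_ae ?_
  filter_upwards [S.pot.ae_pot S.pos] with ω hω
  have := pot_le (V := V) S.pos 0 ω
  rw [← hω.1, br₄, max_eq_left (by linarith)]

/-! ### Flat pieces -/

theorem beta_le_effHam (θ : ℝ) : β ≤ effHam P β V G θ :=
  le_of_forall_lt_imp_le_of_dense fun _ ha => S.le_effHam (S.lowerAt_of_lt ha)

theorem M_le_effHam (h : β < M) (h' : M ≤ m + β) (hθ : θ ≤ meanBr P β V (br₃ G M pM) M) :
    M ≤ effHam P β V G θ := by
  refine le_of_forall_lt_imp_le_of_dense fun a ha => ?_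
  have hlt : max a β < M := max_lt ha h
  refine (le_max_left a β).trans (S.le_effHam (S.lowerAt_hyst (le_max_right _ _)
    (hlt.trans_le h') ?_))
  rw [S.meanHyst_of_lt hlt]
  exact hθ.trans (S.meanBr_three_anti hlt.le)

theorem effHam_eq_of_mem_one_three (h : β < M) (h' : M = m + β)
    (h1 : meanBr P β V (br₁ G m pm) M ≤ θ) (h3 : θ ≤ meanBr P β V (br₃ G M pM) M) :
    effHam P β V G θ = M := by
  refine le_antisymm (le_of_forall_gt_imp_ge_of_dense fun a ha => ?_) (S.M_le_effHam h h'.le h3)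
  exact S.effHam_le (S.upperAt_four_one ha (h' ▸ ha.le) ((S.meanBr_one_anti ha.le).trans h1)
    (h3.trans (S.meanBr_three_le_four _ _)))

theorem effHam_eq_of_mem_one_four (h : M ≤ β) (h' : β = m + β)
    (h1 : meanBr P β V (br₁ G m pm) β ≤ θ) (h4 : θ ≤ meanBr P β V (br₄ G) β) :
    effHam P β V G θ = β := by
  refine le_antisymm (le_of_forall_gt_imp_ge_of_dense fun a ha => ?_) (S.beta_le_effHam θ)
  exact S.effHam_le (S.upperAt_four_one (h.trans_lt ha) (h' ▸ ha.le)
    ((S.meanBr_one_anti ha.le).trans h1) (h4.trans (S.meanBr_four_mono ha.le)))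

theorem meanBr_three_lt_four : meanBr P β V (br₃ G M pM) β < meanBr P β V (br₄ G) β := by
  have := S.prob
  refine lt_of_le_of_ne (S.meanBr_three_le_four _ _) fun heq => ?_
  have hae := (integral_eq_iff_of_ae_le (S.integrable_br S.well.continuous_br₃ β)
    (S.integrable_br S.well.continuous_br₄ β)
    (Eventually.of_forall fun ω => S.well.br₃_le_br₄ _ _)).1 heq
  have h1 : ∀ᵐ ω ∂P, HJ.pot β V 0 ω = β := by
    filter_upwards [hae] with ω hω
    have h0 : br₄ G (β - HJ.pot β V 0 ω) = 0 :=
      le_antisymm (hω ▸ (S.well.br₃_mem _).2) (S.well.br₄_mem _)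
    have h2 := S.well.map_br₄ (s := β - HJ.pot β V 0 ω) (by linarith [pot_le (V := V) S.pos 0 ω])
    rw [h0, S.well.map_zero] at h2
    linarith
  have h2 := S.ae_forall_of_ae (Q := fun s => s = β) (isClosed_eq continuous_id continuous_const) h1
  obtain ⟨ω, hω, hω'⟩ := (h2.and (S.pot.ae_pot S.pos)).exists
  obtain ⟨x, hx⟩ := hω'.2.1 β S.pos
  exact hx.ne (hω x)

theorem hasFlatPiece_beta (h' : β < m + β) : HasFlatPiece (effHam P β V G) β := by
  refine ⟨_, _, S.meanBr_three_lt_four, fun θ hθ => ?_⟩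
  refine le_antisymm (le_of_forall_gt_imp_ge_of_dense fun a ha => ?_) (S.beta_le_effHam θ)
  obtain ⟨c, hc1, hc2⟩ := exists_between (lt_min ha h')
  refine (S.effHam_le (lam := c) (S.upperAt_hyst hc1.le (hc2.trans_le (min_le_right _ _)) ?_ ?_)).trans
    (hc2.trans_le (min_le_left _ _)).le
  · exact ((S.meanHyst_le_three c).trans (S.meanBr_three_anti hc1.le)).trans hθ.1.le
  · exact hθ.2.le.trans (S.meanBr_four_mono hc1.le)

theorem meanHyst_lt_three (h0 : P {ω | ∃ x, V x ω = 0} = 1) :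
    meanHyst P β V G m M pm pM M < meanBr P β V (br₃ G M pM) M := by
  have := S.prob
  refine lt_of_le_of_ne (S.meanHyst_le_three M) fun heq => ?_
  have hae := (integral_eq_iff_of_ae_le (S.integrable_hyst M)
    (S.integrable_br S.well.continuous_br₃ M)
    (Eventually.of_forall fun ω => hyst_le_br₃ S.well)).1 heq
  have h1 : ∀ᵐ ω ∂P, ¬LowState (M - M) (M - m) (fun y => HJ.pot β V y ω) 0 := by
    filter_upwards [hae] with ω hω hlow
    simp only [hyst, if_pos hlow] at hω
    exact (S.well.br₁_lt_br₃ _ _).ne hω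
  obtain ⟨ω, ⟨x, hx⟩, hω, hω'⟩ := exists_mem_of_ae h0 ((S.ae_rat h1).and (S.pot.ae_pot S.pos))
  have hlow : LowState (M - M) (M - m) (fun y => HJ.pot β V y ω) x :=
    lowState_of_le (by linarith [S.well.m_lt_M]) (by rw [hω'.1, hx]; simp)
  obtain ⟨u, hu, hsub⟩ := mem_nhdsGT_iff_exists_Ioo_subset.1
    (hlow.eventually_right (S.pot.continuous_pot ω))
  obtain ⟨q, hq1, hq2⟩ := exists_rat_btwn (show x < u from hu)
  exact hω q ((S.pot.lowState_shift S.flow q ω).2 (hsub ⟨hq1, hq2⟩))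

theorem one_lt_meanHyst (h0 : P {ω | ∃ x, V x ω = 1} = 1) :
    meanBr P β V (br₁ G m pm) (m + β) < meanHyst P β V G m M pm pM (m + β) := by
  have := S.prob
  refine lt_of_le_of_ne (integral_mono (S.integrable_br S.well.continuous_br₁ _)
    (S.integrable_hyst _) fun ω => br₁_le_hyst S.well
      (f := fun y => HJ.pot β V y ω) (lam := m + β) (x := 0)) fun heq => ?_
  have hae := (integral_eq_iff_of_ae_le (S.integrable_br S.well.continuous_br₁ (m + β))
    (S.integrable_hyst (m + β))
    (Eventually.of_forall fun ω => br₁_le_hyst S.well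
      (f := fun y => HJ.pot β V y ω) (lam := m + β) (x := 0))).1 heq
  have h1 : ∀ᵐ ω ∂P, LowState (m + β - M) (m + β - m) (fun y => HJ.pot β V y ω) 0 := by
    filter_upwards [hae] with ω hω
    by_contra hlow
    simp only [hyst, if_neg hlow] at hω
    exact (S.well.br₁_lt_br₃ _ _).ne hω
  obtain ⟨ω, ⟨x, hx⟩, hω, hω'⟩ := exists_mem_of_ae h0 ((S.ae_rat h1).and (S.pot.ae_pot S.pos))
  have hlow : ¬LowState (m + β - M) (m + β - m) (fun y => HJ.pot β V y ω) x := fun h => by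
    have := h.lt
    simp only [hω'.1, hx] at this
    linarith
  obtain ⟨u, hu, hsub⟩ := mem_nhdsGT_iff_exists_Ioo_subset.1
    (eventually_right_not_lowState (S.pot.continuous_pot ω) (by linarith [S.well.m_lt_M]) hlow)
  obtain ⟨q, hq1, hq2⟩ := exists_rat_btwn (show x < u from hu)
  exact hsub ⟨hq1, hq2⟩ ((S.pot.lowState_shift S.flow q ω).1 (hω q))

theorem hasFlatPiece_M (h : β < M) (h' : M < m + β) (h0 : P {ω | ∃ x, V x ω = 0} = 1) :
    HasFlatPiece (effHam P β V G) M := by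
  refine ⟨_, _, S.meanHyst_lt_three h0, fun θ hθ => ?_⟩
  refine le_antisymm (le_of_forall_gt_imp_ge_of_dense fun a ha => ?_)
    (S.M_le_effHam h h'.le hθ.2.le)
  obtain ⟨c, hc1, hc2⟩ := exists_between (lt_min ha h')
  refine (S.effHam_le (lam := c) (S.upperAt_hyst (h.trans hc1).le
    (hc2.trans_le (min_le_right _ _)) ?_ ?_)).trans (hc2.trans_le (min_le_left _ _)).le
  · exact (S.meanHyst_anti hc1.le).trans hθ.1.le
  · exact hθ.2.le.trans (S.meanBr_three_le_four _ _)

theorem hasFlatPiece_top (h : M < m + β) (hm : 0 < m) (h0 : P {ω | ∃ x, V x ω = 1} = 1) :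
    HasFlatPiece (effHam P β V G) (m + β) := by
  refine ⟨_, _, S.one_lt_meanHyst h0, fun θ hθ => le_antisymm ?_ ?_⟩
  · exact S.effHam_le (S.upperAt_four_one h le_rfl hθ.1.le
      (hθ.2.le.trans ((S.meanHyst_le_three _).trans (S.meanBr_three_le_four _ _))))
  · refine le_of_forall_lt_imp_le_of_dense fun a ha => ?_
    have hlt : max a β < m + β := max_lt ha (by linarith)
    exact (le_max_left a β).trans (S.le_effHam (S.lowerAt_hyst (le_max_right _ _) hlt
      (hθ.2.le.trans (S.meanHyst_anti hlt.le))))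

theorem tendsto_meanHyst_M (h' : M < m + β) (h0 : P {ω | ∃ x, V x ω = 0} ≠ 1) :
    Tendsto (fun n : ℕ => meanHyst P β V G m M pm pM (M + 1 / ((n : ℝ) + 1))) atTop
      (𝓝 (meanBr P β V (br₃ G M pM) M)) := by
  have := S.prob
  have hlim : Tendsto (fun n : ℕ => 1 / ((n : ℝ) + 1)) atTop (𝓝 0) :=
    tendsto_one_div_add_atTop_nhds_zero_nat
  refine tendsto_integral_of_dominated_convergence (fun _ => -br₁ G m pm (M + 1))
    (fun n => (S.integrable_hyst _).aestronglyMeasurable) (integrable_const _) (fun n => ?_) ?_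
  · refine Eventually.of_forall fun ω => abs_hyst_le S.well (fun x => pot_nonneg S.pos x ω) ?_
    have : 1 / ((n : ℝ) + 1) ≤ 1 := by
      rw [div_le_one (by positivity)]; linarith [Nat.cast_nonneg (α := ℝ) n]
    linarith
  · obtain ⟨ε, hε, hε'⟩ : ∃ ε, 0 < ε ∧ M + ε < m + β := ⟨(m + β - M) / 2, by linarith, by linarith⟩
    filter_upwards [S.ae_exists_nonpos_gt (c := M + ε - m) (by linarith), S.pot.ae_pot S.pos,
      S.ae_forall_ne_of_ne_one h0] with ω ⟨y₀, hy₀, hy⟩ hpot hne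
    have hc := S.pot.continuous_pot (β := β) ω
    obtain ⟨z, -, hz⟩ := (isCompact_Icc (a := y₀) (b := 0)).exists_isMinOn (nonempty_Icc.2 hy₀)
      hc.continuousOn
    have hzpos : 0 < HJ.pot β V z ω := by
      refine lt_of_le_of_ne (pot_nonneg S.pos z ω) fun heq => hne z ?_
      rw [hpot.1] at heq
      exact (mul_eq_zero.1 heq.symm).resolve_left S.pos.ne'
    have hr : Tendsto (fun n : ℕ => br₃ G M pM (M + 1 / ((n : ℝ) + 1) - HJ.pot β V 0 ω)) atTop
        (𝓝 (br₃ G M pM (M - HJ.pot β V 0 ω))) := by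
      refine (S.well.continuous_br₃.tendsto _).comp ?_
      simpa using (hlim.const_add M).sub_const (HJ.pot β V 0 ω)
    refine hr.congr' ?_
    filter_upwards [hlim.eventually (gt_mem_nhds hε), hlim.eventually (gt_mem_nhds hzpos)]
      with n hn1 hn2
    refine (if_neg ?_).symm
    rintro ⟨y, hy1, hy2, hy3⟩
    rcases le_or_gt y₀ y with hle | hlt
    · have : HJ.pot β V z ω ≤ HJ.pot β V y ω := hz ⟨hle, hy1⟩
      simp only at hy2
      linarith
    · have := hy3 y₀ ⟨hlt.le, hy₀⟩
      simp only at this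
      linarith

theorem tendsto_meanHyst_top (h' : M < m + β) (h0 : P {ω | ∃ x, V x ω = 1} ≠ 1) :
    Tendsto (fun n : ℕ => meanHyst P β V G m M pm pM (m + β - 1 / ((n : ℝ) + 1))) atTop
      (𝓝 (meanBr P β V (br₁ G m pm) (m + β))) := by
  have := S.prob
  have hlim : Tendsto (fun n : ℕ => 1 / ((n : ℝ) + 1)) atTop (𝓝 0) :=
    tendsto_one_div_add_atTop_nhds_zero_nat
  refine tendsto_integral_of_dominated_convergence (fun _ => -br₁ G m pm (m + β))
    (fun n => (S.integrable_hyst _).aestronglyMeasurable) (integrable_const _) (fun n => ?_) ?_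
  · refine Eventually.of_forall fun ω => abs_hyst_le S.well (fun x => pot_nonneg S.pos x ω) ?_
    have : 0 < 1 / ((n : ℝ) + 1) := by positivity
    linarith
  · have hε : 0 < (m + β - M) / 2 := by linarith
    filter_upwards [S.ae_exists_nonpos_lt hε, S.pot.ae_pot S.pos,
      S.ae_forall_ne_of_ne_one h0] with ω ⟨y₀, hy₀, hy⟩ hpot hne
    have hc := S.pot.continuous_pot (β := β) ω
    obtain ⟨z, -, hz⟩ := (isCompact_Icc (a := y₀) (b := 0)).exists_isMaxOn (nonempty_Icc.2 hy₀)
      hc.continuousOn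
    have hzlt : 0 < β - HJ.pot β V z ω := by
      refine sub_pos.2 (lt_of_le_of_ne (pot_le S.pos z ω) fun heq => hne z ?_)
      rw [hpot.1] at heq
      exact mul_left_cancel₀ S.pos.ne' (heq.trans (mul_one β).symm)
    have hr : Tendsto (fun n : ℕ => br₁ G m pm (m + β - 1 / ((n : ℝ) + 1) - HJ.pot β V 0 ω)) atTop
        (𝓝 (br₁ G m pm (m + β - HJ.pot β V 0 ω))) := by
      refine (S.well.continuous_br₁.tendsto _).comp ?_
      simpa using (hlim.const_sub (m + β)).sub_const (HJ.pot β V 0 ω)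
    refine hr.congr' ?_
    filter_upwards [hlim.eventually (gt_mem_nhds hε), hlim.eventually (gt_mem_nhds hzlt)]
      with n hn1 hn2
    refine (if_pos ⟨y₀, hy₀, by linarith, fun y hy' => ?_⟩).symm
    have : HJ.pot β V y ω ≤ HJ.pot β V z ω := hz hy'
    linarith

theorem not_hasFlatPiece_M (h : β < M) (h' : M < m + β) (h0 : P {ω | ∃ x, V x ω = 0} ≠ 1) :
    ¬HasFlatPiece (effHam P β V G) M := by
  refine not_hasFlatPiece (x₁ := meanBr P β V (br₃ G M pM) M) (x₂ := meanBr P β V (br₄ G) M)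
    fun θ h3 h4 => ?_
  have c3 := S.continuous_meanBr S.well.continuous_br₃
  have c4 := S.continuous_meanBr S.well.continuous_br₄
  have hlim : Tendsto (fun n : ℕ => 1 / ((n : ℝ) + 1)) atTop (𝓝 0) :=
    tendsto_one_div_add_atTop_nhds_zero_nat
  rcases lt_or_gt_of_ne h3 with h3 | h3
  · obtain ⟨n, hn1, hn2⟩ := (((S.tendsto_meanHyst_M h' h0).eventually (lt_mem_nhds h3)).and
      (hlim.eventually (gt_mem_nhds (sub_pos.2 h')))).exists
    have hn : 0 < 1 / ((n : ℝ) + 1) := by positivity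
    have := S.le_effHam (S.lowerAt_hyst (θ := θ) (lam := M + 1 / ((n : ℝ) + 1)) (by linarith)
      (by linarith) hn1.le)
    exact (show M < effHam P β V G θ by linarith).ne'
  rcases lt_or_gt_of_ne h4 with h4 | h4
  · obtain ⟨c, ⟨⟨hc1, hc2⟩, hc3⟩, hc4⟩ := ((((c3.tendsto M).eventually (gt_mem_nhds h3)).and
      ((c4.tendsto M).eventually (lt_mem_nhds h4))).and (lt_mem_nhds h)
      |>.filter_mono nhdsWithin_le_nhds |>.and (self_mem_nhdsWithin (s := Iio M))).exists
    exact ((S.effHam_le (S.upperAt_four_three hc3.le (le_of_lt hc4) hc1.le hc2.le)).trans_lt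
      hc4).ne
  · obtain ⟨c, hc1, hc2⟩ := (((c4.tendsto M).eventually (gt_mem_nhds h4))
      |>.filter_mono nhdsWithin_le_nhds |>.and (self_mem_nhdsWithin (s := Ioi M))).exists
    exact (lt_of_lt_of_le hc2
      (S.le_effHam (S.lowerAt_four (h.trans hc2).le hc1.le))).ne'

theorem not_hasFlatPiece_top (h' : M < m + β) (hm : 0 < m) (h0 : P {ω | ∃ x, V x ω = 1} ≠ 1) :
    ¬HasFlatPiece (effHam P β V G) (m + β) := by
  refine not_hasFlatPiece (x₁ := meanBr P β V (br₁ G m pm) (m + β))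
    (x₂ := meanBr P β V (br₄ G) (m + β)) fun θ h1 h4 => ?_
  have c1 := S.continuous_meanBr S.well.continuous_br₁
  have c4 := S.continuous_meanBr S.well.continuous_br₄
  have hlim : Tendsto (fun n : ℕ => 1 / ((n : ℝ) + 1)) atTop (𝓝 0) :=
    tendsto_one_div_add_atTop_nhds_zero_nat
  have hlim' : Tendsto (fun n : ℕ => m + β - 1 / ((n : ℝ) + 1)) atTop (𝓝 (m + β)) := by
    simpa using hlim.const_sub (m + β)
  rcases lt_or_gt_of_ne h1 with h1 | h1
  · obtain ⟨c, hc1, hc2⟩ := (((c1.tendsto (m + β)).eventually (lt_mem_nhds h1))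
      |>.filter_mono nhdsWithin_le_nhds |>.and (self_mem_nhdsWithin (s := Ioi (m + β)))).exists
    exact (lt_of_lt_of_le hc2 (S.le_effHam (S.lowerAt_one (le_of_lt hc2) hc1.le))).ne'
  rcases lt_or_gt_of_ne h4 with h4 | h4
  · obtain ⟨n, ⟨hn1, hn2⟩, hn3⟩ := ((((S.tendsto_meanHyst_top h' h0).eventually
      (gt_mem_nhds h1)).and (((c4.tendsto (m + β)).comp hlim').eventually (lt_mem_nhds h4))).and
      (hlim.eventually (gt_mem_nhds hm))).exists
    have hn : 0 < 1 / ((n : ℝ) + 1) := by positivity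
    have := S.effHam_le (S.upperAt_hyst (θ := θ) (lam := m + β - 1 / ((n : ℝ) + 1)) (by linarith)
      (by linarith) hn1.le (le_of_lt hn2))
    exact (show effHam P β V G θ < m + β by linarith).ne
  · obtain ⟨c, hc1, hc2⟩ := (((c4.tendsto (m + β)).eventually (gt_mem_nhds h4))
      |>.filter_mono nhdsWithin_le_nhds |>.and (self_mem_nhdsWithin (s := Ioi (m + β)))).exists
    have hc : m + β < c := hc2
    exact (hc.trans_le (S.le_effHam (S.lowerAt_four (by linarith) hc1.le))).ne'

theorem hasFlatPiece_M_iff (h : β < M) (h' : M < m + β) :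
    HasFlatPiece (effHam P β V G) M ↔ P {ω | ∃ x, V x ω = 0} = 1 :=
  ⟨fun hf => by_contra fun h0 => S.not_hasFlatPiece_M h h' h0 hf, S.hasFlatPiece_M h h'⟩

theorem hasFlatPiece_top_iff (h' : M < m + β) (hm : 0 < m) :
    HasFlatPiece (effHam P β V G) (m + β) ↔ P {ω | ∃ x, V x ω = 1} = 1 :=
  ⟨fun hf => by_contra fun h0 => S.not_hasFlatPiece_top h' hm h0 hf, S.hasFlatPiece_top h' hm⟩

end Standing

end Stochastic

end HJ

theorem theorem3p3 {Ω : Type*} [MeasurableSpace Ω] (P : Measure Ω) [IsProbabilityMeasure P]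
    (τ : ℝ → Ω → Ω) (hτ : HJ.IsErgodicFlow P τ)
    (V : ℝ → Ω → ℝ) (hV : HJ.IsPotential P τ V)
    (G : ℝ → ℝ) (m M pm pM : ℝ) (hG : HJ.IsDoubleWell G m M pm pM)
    (β : ℝ) (hβ : 0 < β) :
    ∃ Hbar : ℝ → ℝ,
      -- `Hbar` is the effective Hamiltonian
      HJ.IsEffectiveHamiltonian P G β V Hbar ∧
      (∀ H' : ℝ → ℝ, HJ.HomogenizesTo P G β V H' → H' = Hbar) ∧
      -- (a)
      (β < M → M = m + β →
        ∀ θ ∈ Icc (HJ.branchMean P G β V (Iic pm) M) (HJ.branchMean P G β V (Icc pM 0) M),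
          Hbar θ = M) ∧
      -- (b)
      (β < M → M < m + β →
        (HJ.HasFlatPiece Hbar M ↔ P {ω | ∃ x, V x ω = 0} = 1) ∧
        (HJ.HasFlatPiece Hbar (m + β) ↔ P {ω | ∃ x, V x ω = 1} = 1)) ∧
      -- (c)
      (M ≤ β → β = m + β →
        ∀ θ ∈ Icc (HJ.branchMean P G β V (Iic pm) β) (HJ.branchMean P G β V (Ici 0) β),
          Hbar θ = β) ∧
      -- (d)
      (M ≤ β → β < m + β →
        HJ.HasFlatPiece Hbar β ∧
        (HJ.HasFlatPiece Hbar (m + β) ↔ P {ω | ∃ x, V x ω = 1} = 1)) := by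
  have S : HJ.Standing P τ V G m M pm pM β := ⟨inferInstance, hτ, hV, hG, hβ⟩
  refine ⟨HJ.effHam P β V G, S.isEffectiveHamiltonian, fun H' h => h.eq S.isEffectiveHamiltonian,
    fun h h' θ hθ => ?_, fun h h' => ?_, fun h h' θ hθ => ?_, fun h h' => ?_⟩
  · rw [S.branchMean_one h'.ge, S.branchMean_three h.le le_rfl] at hθ
    exact S.effHam_eq_of_mem_one_three h h' hθ.1 hθ.2
  · exact ⟨S.hasFlatPiece_M_iff h h', S.hasFlatPiece_top_iff h' (by linarith)⟩
  · rw [S.branchMean_one h'.ge, S.branchMean_four le_rfl] at hθ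
    exact S.effHam_eq_of_mem_one_four h h' hθ.1 hθ.2
  · exact ⟨S.hasFlatPiece_beta h', S.hasFlatPiece_top_iff (h.trans_lt h') (by linarith)⟩
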